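/- Let $W$ be a complete discrete valuation ring with normalized valuation $\mathrm{val}$ (with $\mathrm{val}(0)=+\infty$) and finite residue field of cardinality $q$, equipped with its Haar probability measure. For $d\ge 1$, let $\Omega=W^{2d}$ (with the product measure) be the probability space of pairs $(A,B)$ of monic polynomials of degree $d$ over $W$. For $0\le j<d$, let $\psi_j : W[X]_{<d-j}\times W[X]_{<d-j}\to W[X]_{<2d-j}/W[X]_{<j}$, $(U,V)\mapsto AU+BV$, be the truncated Sylvester map. Let $r_j$ be its determinant in the canonical bases $(X^{d-j-1},0),\dots,(1,0),(0,X^{d-j-1}),\dots,(0,1)$ and $X^{2d-j-1},\dots,X^j$ (the $j$-th principal subresultant), and let $R_j=A\,\mathcal U_j+B\,\mathcal V_j$ be the $j$-th subresultant, where $(\mathcal U_j,\mathcal V_j)$ is the pair given by the Cramer formulae for $AU+BV\equiv r_jX^j \pmod{W[X]_{<j}}$. Put $V_j=\mathrm{val}(r_j)$, let $W_j$ be the minimum of the valuations of the coefficients of $R_j$, and put $\delta_j=V_j-W_j$; these are random variables on $\Omega$. Let $\sigma$ be the permutation of $\{1,\dots,d\}$ listing first the odd values in increasing order and then the even values in decreasing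 order, i.e. $\sigma(i)=2i-1$ if $2i\le d+1$ and $\sigma(i)=2(d+1-i)$ otherwise. For $0\le j<d$ let $\tau_j(1)<\dots<\tau_j(d-j)$ be the numbers $\sigma(1),\dots,\sigma(d-j)$ sorted in increasing order. Then for all $j\in\{0,\dots,d-1\}$, $V_j$ is almost surely finite and square-integrable, $\delta_j$ is integrable, and: 1. $\displaystyle \mathbb E[V_j]=\sum_{i=1}^{d-j}\frac1{q^{\sigma(i)}-1}$, and in particular $\displaystyle\frac1{q-1}\le\mathbb E[V_j]<\frac q{(q-1)^2}$. 2. $\displaystyle \frac{q^j-1}{q^{j+1}-1}\le\mathbb E[\delta_j]\le\mathbb E[V_j]$. 3. The standard deviation $\mathrm{sd}(V_j)$ satisfies $\displaystyle \mathrm{sd}(V_j)^2=\sum_{i=1}^{d-j}\frac{(2i-1)\,q^{\tau_j(i)}}{(q^{\tau_j(i)}-1)^2}$, and in particular $\displaystyle\frac{\sqrt q}{q-1}\le\mathrm{sd}(V_j)<\frac{q\sqrt{q+1}}{(q-1)^2}$. 4. $\mathbb P[V_j\ge m]\le q^{-m+O(\sqrt m)}$: there is an absolute constant $C_1$ such that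 $\mathbb P[V_j\ge m]\le q^{-m+C_1\sqrt m}$ for all integers $m\ge0$. 5. $\mathbb E[\max(V_0,\dots,V_{d-1})]\le\log_q d+O(\sqrt{\log_q d})$: there is an absolute constant $C_2$ such that, whenever $d\ge2$, the variable $\max(V_0,\dots,V_{d-1})$ is integrable and $\mathbb E[\max(V_0,\dots,V_{d-1})]\le\log_q d+C_2\sqrt{\log_q d}$. The constants $C_1,C_2$ do not depend on $W$, $d$, $j$ or $m$. -/

import Mathlib

open Polynomial MeasureTheory ProbabilityTheory IsLocalRing

namespace SubresVal

noncomputable section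

section Subresultants

variable {R : Type*} [CommRing R]

/-- The images under the truncated Sylvester map `(U, V) ↦ A * U + B * V` of the canonical basis
`(X ^ (dB - j - 1), 0), …, (1, 0), (0, X ^ (dA - j - 1)), …, (0, 1)` of its source
`R[X]_{< dB - j} × R[X]_{< dA - j}`. -/
def sylvesterCol (A B : R[X]) (dA dB j : ℕ) : Fin ((dB - j) + (dA - j)) → R[X] :=
  Fin.addCases (fun k : Fin (dB - j) => A * X ^ (dB - j - 1 - (k : ℕ)))
    (fun k : Fin (dA - j) => B * X ^ (dA - j - 1 - (k : ℕ)))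

/-- The coordinates of a polynomial in the canonical basis `X ^ (dA + dB - j - 1), …, X ^ j` of the
target `R[X]_{< dA + dB - j} / R[X]_{< j}` of the truncated Sylvester map (for `j ≤ dA, dB`, there
are `(dB - j) + (dA - j)` basis vectors). -/
def truncCoords (dA dB j : ℕ) (P : R[X]) : Fin ((dB - j) + (dA - j)) → R :=
  fun i => P.coeff (dA + dB - j - 1 - (i : ℕ))

/-- The matrix of the `j`-th truncated Sylvester map in the canonical bases. -/
def sylvesterTrunc (A B : R[X]) (dA dB j : ℕ) :
    Matrix (Fin ((dB - j) + (dA - j))) (Fin ((dB - j) + (dA - j))) R :=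
  Matrix.of fun i c => truncCoords dA dB j (sylvesterCol A B dA dB j c) i

/-- The `j`-th principal subresultant of `A` and `B`, computed in degree `(dA, dB)`. -/
def principalSubresultant (A B : R[X]) (dA dB j : ℕ) : R :=
  (sylvesterTrunc A B dA dB j).det

/-- The coordinates of the pair of `j`-th cofactors `(U_j, V_j)`, given by the Cramer formulae for
the linear system `A * U + B * V ≡ det * X ^ j` modulo polynomials of degree `< j`. -/
def cofactorCoords (A B : R[X]) (dA dB j : ℕ) : Fin ((dB - j) + (dA - j)) → R :=
  Matrix.cramer (sylvesterTrunc A B dA dB j) (truncCoords dA dB j (X ^ j))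

/-- The cofactor `U_j`, of degree `< dB - j`. -/
def cofactorU (A B : R[X]) (dA dB j : ℕ) : R[X] :=
  ∑ k : Fin (dB - j),
    C (cofactorCoords A B dA dB j (Fin.castAdd (dA - j) k)) * X ^ (dB - j - 1 - (k : ℕ))

/-- The cofactor `V_j`, of degree `< dA - j`. -/
def cofactorV (A B : R[X]) (dA dB j : ℕ) : R[X] :=
  ∑ k : Fin (dA - j),
    C (cofactorCoords A B dA dB j (Fin.natAdd (dB - j) k)) * X ^ (dA - j - 1 - (k : ℕ))

/-- The `j`-th subresultant `R_j = A * U_j + B * V_j` of `A` and `B`, computed in degree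
`(dA, dB)`. -/
def subresultant (A B : R[X]) (dA dB j : ℕ) : R[X] :=
  A * cofactorU A B dA dB j + B * cofactorV A B dA dB j

/-- The monic polynomial `X ^ d + a_{d-1} X ^ (d-1) + ⋯ + a_0`. -/
def monicPoly {d : ℕ} (a : Fin d → R) : R[X] :=
  X ^ d + ∑ i : Fin d, C (a i) * X ^ (i : ℕ)

end Subresultants

section RandomVariables

/-- The set of pairs of monic polynomials of degree `d` over `W`, identified with `W ^ (2d)` through
the non-leading coefficients. -/
abbrev Pairs (W : Type*) (d : ℕ) : Type _ := (Fin d → W) × (Fin d → W)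

/-- The product measure on pairs of monic polynomials of degree `d`, for the measure `μ` on `W`. -/
def pairMeasure {W : Type*} [MeasurableSpace W] (μ : Measure W) (d : ℕ) : Measure (Pairs W d) :=
  (Measure.pi fun _ : Fin d => μ).prod (Measure.pi fun _ : Fin d => μ)

variable {W : Type*} [CommRing W] [IsDomain W] [IsDiscreteValuationRing W]

/-- The valuation `V_j` of the `j`-th principal subresultant of the pair `ω` (computed in degree
`(d, d)`); it is infinite when this subresultant vanishes. -/
def valV {d : ℕ} (j : ℕ) (ω : Pairs W d) : ℕ∞ :=
  IsDiscreteValuationRing.addVal W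
    (principalSubresultant (monicPoly ω.1) (monicPoly ω.2) d d j)

/-- The minimum `W_j` of the valuations of the coefficients of the `j`-th subresultant. -/
def minValW {d : ℕ} (j : ℕ) (ω : Pairs W d) : ℕ∞ :=
  ⨅ n : ℕ, IsDiscreteValuationRing.addVal W
    ((subresultant (monicPoly ω.1) (monicPoly ω.2) d d j).coeff n)

/-- The difference `δ_j = V_j - W_j`. -/
def delta {d : ℕ} (j : ℕ) (ω : Pairs W d) : ℕ∞ := valV j ω - minValW j ω

/-- The maximum of `V_0, …, V_{d-1}`. -/
def maxV {d : ℕ} (ω : Pairs W d) : ℕ∞ := (Finset.range d).sup fun j => valV j ω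

end RandomVariables

/-- The real number underlying an element of `ℕ ∪ {∞}` (with the junk value `0` at `∞`; it is only
applied to random variables that are almost surely finite). -/
def toReal (v : ℕ∞) : ℝ := (v.toNat : ℝ)

/-- The permutation `σ` of `{1, …, d}` which lists first the odd values in increasing order and then
the even values in decreasing order. -/
def sigma (d i : ℕ) : ℕ := if 2 * i ≤ d + 1 then 2 * i - 1 else 2 * (d + 1 - i)

/-- `tau d j 1 < ⋯ < tau d j (d - j)` are the numbers `σ(1), …, σ(d - j)` sorted in increasing
order (`Nat.nth` counts from `0`). -/
def tau (d j i : ℕ) : ℕ :=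
  Nat.nth (fun n => n ∈ (Finset.Icc 1 (d - j)).image (sigma d)) (i - 1)

end

end SubresVal

/-! Up to a unit, r_j generates the Fitting ideal of the cokernel of the truncated Sylvester map, so
an isomorphism between two such cokernels gives equal valuations (`psIdeal_eq_of_maps`). Replacing B
by C = B - A does not change this ideal, and (A, C) is uniform among pairs with A monic of degree d
and deg C < d. These pairs are sorted by the degree e of C modulo the maximal ideal (ϖ).

If C ≡ 0, then C = ϖ C' and r_j acquires the factor ϖ^(d-j). Otherwise A = P S + P' T and C = Q S +
Q' T in a unique way, with P Q' - P' Q = 1, P monic of degree k = d - e, Q residually a nonzero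
constant, and (S, T) an arbitrary pair of degree e (`bijOn_compPair_redPairs`). For j ≤ e the
subresultant is that of (S, T); for j ≥ e it is r_{j-e}(P, Q) (`psIdeal_eq_low`, `psIdeal_eq_high`).
In the second case Q is replaced by its inverse modulo P, which turns the index m into k - m
(`psIdeal_dual`). At the new index the constant term of the second component is irrelevant, so this
component may be taken residually zero and divided by ϖ.

Counting in W / (ϖ^M) gives a linear recursion for the tails of V_j when d ≥ 2j + 1 (`freq_rec`);
otherwise (d, j) may be lowered to (d - 1, j - 1). For the generating series G_n of V_j with d = n +
j, consecutive relations subtract to G_{n+1} (1 - x X^(n+1)) = G_n (1 - x X^n), where x = q^(-t) and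
t = min(2n + 1, n + 1 + j) (`IsTail.gen_step`). The exponents t met up to n = d - j are the numbers
τ_j(i). Differentiating the resulting product at 1 gives the mean and the variance, evaluating it
slightly below q gives the tail, and a union bound gives the maximum.

For δ_j, the upper bound is δ_j ≤ V_j. For the lower bound, restrict to the event that r_{j+1} is a
unit, of probability at least 1 - 1/q. There R_j is almost surely a unit multiple of a remainder T,
uniform of degree ≤ j (`associated_remainder`, `exists_ncard_isRem`). The valuation of its
coefficient of X^j has mean 1/(q-1), the minimum over all its coefficients has mean 1/(q^(j+1)-1),
and the difference of the two, times 1 - 1/q, is the bound. -/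

namespace SubresVal

/-! ### Determinants of square presentations of a module. -/

section Fitting

variable {R : Type*} [CommRing R]

theorem det_dvd_det_of_range_le {ι : Type*} [Fintype ι] [DecidableEq ι] (F G : Matrix ι ι R)
    (h : F.mulVecLin.range ≤ G.mulVecLin.range) : G.det ∣ F.det := by
  have h' : ∀ i, ∃ v, G.mulVec v = F.mulVec (Pi.single i 1) := fun i => by
    obtain ⟨v, hv⟩ := h ⟨Pi.single i 1, rfl⟩
    exact ⟨v, hv⟩
  choose K hK using h'
  have : F = G * Matrix.of fun i j => K j i := by
    ext i j
    have := congrFun (hK j) i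
    rw [Matrix.mulVec_single_one] at this
    simpa [Matrix.mul_apply, Matrix.mulVec, dotProduct] using this.symm
  rw [this, Matrix.det_mul]
  exact Dvd.intro _ rfl

/-- Two square presentations of the same module have the same determinant up to units. -/
theorem span_det_eq_of_ker_eq {ι κ M : Type*} [Fintype ι] [DecidableEq ι] [Fintype κ]
    [DecidableEq κ] [AddCommGroup M] [Module R M] (F : Matrix ι ι R) (G : Matrix κ κ R)
    (π : (ι → R) →ₗ[R] M) (π' : (κ → R) →ₗ[R] M) (hr : π.range = π'.range)
    (hF : ∀ c, π c = 0 ↔ ∃ x, F.mulVec x = c) (hG : ∀ c, π' c = 0 ↔ ∃ x, G.mulVec x = c) :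
    Ideal.span {F.det} = Ideal.span {G.det} := by
  have hx : ∀ j : κ, ∃ x : ι → R, π x = - π' (Pi.single j 1) := fun j => by
    have : - π' (Pi.single j 1) ∈ π.range := by rw [hr]; exact neg_mem ⟨_, rfl⟩
    exact this
  have hy : ∀ j : ι, ∃ x : κ → R, π' x = - π (Pi.single j 1) := fun j => by
    have : - π (Pi.single j 1) ∈ π'.range := by rw [← hr]; exact neg_mem ⟨_, rfl⟩
    exact this
  choose x hx using hx
  choose y hy using hy
  let X : Matrix ι κ R := Matrix.of fun i j => x j i
  let Y : Matrix κ ι R := Matrix.of fun i j => y j i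
  have hX : ∀ b, π (X.mulVec b) = - π' b := fun b => by
    have e1 : X.mulVec b = ∑ j, b j • x j := by
      ext i; simp [X, Matrix.mulVec, dotProduct, mul_comm]
    have e2 : b = ∑ j, b j • (Pi.single j (1 : R) : κ → R) := by
      ext i; simp [Pi.single_apply]
    rw [e1, map_sum]
    conv_rhs => rw [e2, map_sum]
    simp [hx]
  have hY : ∀ b, π' (Y.mulVec b) = - π b := fun b => by
    have e1 : Y.mulVec b = ∑ j, b j • y j := by
      ext i; simp [Y, Matrix.mulVec, dotProduct, mul_comm]
    have e2 : b = ∑ j, b j • (Pi.single j (1 : R) : ι → R) := by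
      ext i; simp [Pi.single_apply]
    rw [e1, map_sum]
    conv_rhs => rw [e2, map_sum]
    simp [hy]
  -- Both block matrices have the kernel of (a, b) ↦ π a + π' b as image, and their determinants are
  -- those of F and of G. Equal images make each determinant divide the other.
  let H₁ : Matrix (ι ⊕ κ) (ι ⊕ κ) R := Matrix.fromBlocks F X 0 1
  let H₂ : Matrix (ι ⊕ κ) (ι ⊕ κ) R := Matrix.fromBlocks 1 0 Y G
  have h₁ : ∀ z : ι ⊕ κ → R, z ∈ H₁.mulVecLin.range ↔ π (z ∘ Sum.inl) + π' (z ∘ Sum.inr) = 0 := by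
    intro z
    constructor
    · rintro ⟨w, rfl⟩
      have : π (F.mulVec (w ∘ Sum.inl)) = 0 := (hF _).2 ⟨_, rfl⟩
      simp [H₁, Matrix.fromBlocks_mulVec, hX, this]
    · intro hz
      have : π (z ∘ Sum.inl - X.mulVec (z ∘ Sum.inr)) = 0 := by
        rw [map_sub, hX, sub_neg_eq_add, hz]
      obtain ⟨w, hw⟩ := (hF _).1 this
      refine ⟨Sum.elim w (z ∘ Sum.inr), ?_⟩
      simp only [Matrix.mulVecLin_apply, H₁, Matrix.fromBlocks_mulVec, Sum.elim_comp_inl, hw,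
        Sum.elim_comp_inr, sub_add_cancel, Matrix.zero_mulVec, zero_add, Matrix.one_mulVec]
      exact Sum.elim_comp_inl_inr z
  have h₂ : ∀ z : ι ⊕ κ → R, z ∈ H₂.mulVecLin.range ↔ π (z ∘ Sum.inl) + π' (z ∘ Sum.inr) = 0 := by
    intro z
    constructor
    · rintro ⟨w, rfl⟩
      have : π' (G.mulVec (w ∘ Sum.inr)) = 0 := (hG _).2 ⟨_, rfl⟩
      simp [H₂, Matrix.fromBlocks_mulVec, hY, this]
    · intro hz
      have : π' (z ∘ Sum.inr - Y.mulVec (z ∘ Sum.inl)) = 0 := by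
        rw [map_sub, hY, sub_neg_eq_add, add_comm, hz]
      obtain ⟨w, hw⟩ := (hG _).1 this
      refine ⟨Sum.elim (z ∘ Sum.inl) w, ?_⟩
      simp only [Matrix.mulVecLin_apply, H₂, Matrix.fromBlocks_mulVec, Sum.elim_comp_inl, hw,
        Sum.elim_comp_inr, add_sub_cancel, Matrix.zero_mulVec, add_zero, Matrix.one_mulVec]
      exact Sum.elim_comp_inl_inr z
  have hH : H₁.mulVecLin.range = H₂.mulVecLin.range := by
    ext z; rw [h₁, h₂]
  have d₁ : H₁.det = F.det := by simp [H₁]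
  have d₂ : H₂.det = G.det := by simp [H₂]
  rw [← d₁, ← d₂]
  apply le_antisymm
  · exact Ideal.span_singleton_le_span_singleton.2 (det_dvd_det_of_range_le _ _ hH.le)
  · exact Ideal.span_singleton_le_span_singleton.2 (det_dvd_det_of_range_le _ _ hH.ge)

end Fitting

/-! ### The truncated Sylvester map and the ideal of its determinant. -/

section Sylvester

variable {R : Type*} [CommRing R]

/-- The submodule `A R[X]_{<n} + C R[X]_{<n} + R[X]_{<j}`. -/
noncomputable def sylSub (A C : R[X]) (n j : ℕ) : Submodule R R[X] :=
  (degreeLT R n).map (LinearMap.mulLeft R A) ⊔ (degreeLT R n).map (LinearMap.mulLeft R C) ⊔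
    degreeLT R j

theorem mem_sylSub {A C : R[X]} {n j : ℕ} {p : R[X]} :
    p ∈ sylSub A C n j ↔ ∃ U ∈ degreeLT R n, ∃ V ∈ degreeLT R n, ∃ Z ∈ degreeLT R j,
      A * U + C * V + Z = p := by
  simp only [sylSub, Submodule.mem_sup, Submodule.mem_map, LinearMap.mulLeft_apply]
  constructor
  · rintro ⟨_, ⟨_, ⟨U, hU, rfl⟩, _, ⟨V, hV, rfl⟩, rfl⟩, Z, hZ, rfl⟩
    exact ⟨U, hU, V, hV, Z, hZ, rfl⟩
  · rintro ⟨U, hU, V, hV, Z, hZ, rfl⟩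
    exact ⟨_, ⟨_, ⟨U, hU, rfl⟩, _, ⟨V, hV, rfl⟩, rfl⟩, Z, hZ, rfl⟩

theorem mem_degreeLT_coeff {n : ℕ} {p : R[X]} : p ∈ degreeLT R n ↔ ∀ i, n ≤ i → p.coeff i = 0 := by
  rw [mem_degreeLT, degree_lt_iff_coeff_zero]

theorem degreeLT_le {m n : ℕ} (h : m ≤ n) {p : R[X]} (hp : p ∈ degreeLT R m) :
    p ∈ degreeLT R n := degreeLT_mono h hp

theorem mul_mem_degreeLT {a b c : ℕ} {p q : R[X]} (hp : p ∈ degreeLT R a) (hq : q ∈ degreeLT R b)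
    (h : a + b ≤ c + 1) : p * q ∈ degreeLT R c := by
  rw [mem_degreeLT_coeff] at *
  intro i hi
  rw [coeff_mul]
  refine Finset.sum_eq_zero fun x hx => ?_
  have hx := Finset.HasAntidiagonal.mem_antidiagonal.1 hx
  rcases le_or_gt a x.1 with h1 | h1
  · rw [hp _ h1, zero_mul]
  · rw [hq _ (by omega), mul_zero]

/-- The polynomial with given coordinates in the basis `X ^ (N - 1), …` (decreasing degrees). -/
noncomputable def polyOfCoords (N : ℕ) {ι : ℕ} : (Fin ι → R) →ₗ[R] R[X] :=
  LinearMap.lsum R (fun _ => R) R fun i => (monomial (N - 1 - (i : ℕ)) : R →ₗ[R] R[X])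

theorem polyOfCoords_apply (N : ℕ) {ι : ℕ} (c : Fin ι → R) :
    polyOfCoords N c = ∑ i, C (c i) * X ^ (N - 1 - (i : ℕ)) := by
  simp [polyOfCoords, LinearMap.lsum_apply, C_mul_X_pow_eq_monomial]

theorem polyOfCoords_mem {N ι : ℕ} (h : ι ≤ N) (c : Fin ι → R) :
    polyOfCoords N c ∈ degreeLT R N := by
  rw [polyOfCoords_apply]
  refine Submodule.sum_mem _ fun i _ => ?_
  rw [mem_degreeLT]
  refine (degree_C_mul_X_pow_le _ _).trans_lt ?_
  have := i.2
  exact_mod_cast (by omega : N - 1 - (i : ℕ) < N)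

theorem coeff_polyOfCoords {N ι : ℕ} (h : ι ≤ N) (c : Fin ι → R) (i : Fin ι) :
    (polyOfCoords N c).coeff (N - 1 - i) = c i := by
  rw [polyOfCoords_apply, finsetSum_coeff, Finset.sum_eq_single i]
  · simp
  · intro b _ hb
    rw [coeff_C_mul, coeff_X_pow, if_neg, mul_zero]
    have h1 := b.2; have h2 := i.2
    intro h3
    apply hb
    ext
    omega
  · simp

/-- A polynomial of degree `< N` is the sum of its top part and of its low degree part. -/
theorem sub_polyOfCoords_mem {N ι : ℕ} (h : ι ≤ N) {p : R[X]} (hp : p ∈ degreeLT R N) :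
    p - polyOfCoords N (fun i : Fin ι => p.coeff (N - 1 - i)) ∈ degreeLT R (N - ι) := by
  rw [mem_degreeLT_coeff]
  intro k hk
  rw [coeff_sub]
  rcases lt_or_ge k N with h1 | h1
  · have := coeff_polyOfCoords h (fun i : Fin ι => p.coeff (N - 1 - i)) ⟨N - 1 - k, by omega⟩
    simp only [show N - 1 - (N - 1 - k) = k by omega] at this
    rw [this, sub_self]
  · rw [(mem_degreeLT_coeff.1 hp) k h1, (mem_degreeLT_coeff.1 (polyOfCoords_mem h _)) k h1, sub_self]

theorem truncCoords_eq_iff {d j : ℕ} (hj : j ≤ d) {p : R[X]} (hp : p ∈ degreeLT R (2 * d - j))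
    (c : Fin ((d - j) + (d - j)) → R) :
    truncCoords d d j p = c ↔ p - polyOfCoords (2 * d - j) c ∈ degreeLT R j := by
  constructor
  · rintro rfl
    have := sub_polyOfCoords_mem (ι := (d - j) + (d - j)) (by omega) hp
    rw [show 2 * d - j - (d - j + (d - j)) = j by omega] at this
    unfold truncCoords
    rwa [← two_mul d]
  · intro h
    ext i
    have h1 := (mem_degreeLT_coeff.1 h) (2 * d - j - 1 - i) (by have := i.2; omega)
    rw [coeff_sub, coeff_polyOfCoords (by omega)] at h1
    unfold truncCoords
    rw [← two_mul d]
    exact sub_eq_zero.1 h1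

theorem mulVec_sylvesterTrunc (A B : R[X]) (d j : ℕ) (x : Fin ((d - j) + (d - j)) → R) :
    (sylvesterTrunc A B d d j).mulVec x = truncCoords d d j
      (A * polyOfCoords (d - j) (fun k : Fin (d - j) => x (Fin.castAdd (d - j) k)) +
        B * polyOfCoords (d - j) (fun k : Fin (d - j) => x (Fin.natAdd (d - j) k))) := by
  ext i
  rw [polyOfCoords_apply, polyOfCoords_apply, Finset.mul_sum, Finset.mul_sum]
  simp only [Matrix.mulVec, dotProduct, sylvesterTrunc, Matrix.of_apply, Fin.sum_univ_add,
    sylvesterCol, Fin.addCases_left, Fin.addCases_right, truncCoords, coeff_add, finsetSum_coeff]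
  congr 1 <;>
  · refine Finset.sum_congr rfl fun k _ => ?_
    rw [mul_left_comm, coeff_C_mul, mul_comm]

theorem exists_polyOfCoords {n : ℕ} {U : R[X]} (hU : U ∈ degreeLT R n) :
    polyOfCoords n (fun k : Fin n => U.coeff (n - 1 - k)) = U := by
  have := sub_polyOfCoords_mem le_rfl hU
  rw [Nat.sub_self, mem_degreeLT_coeff] at this
  rw [← sub_eq_zero, ← neg_eq_zero, neg_sub]
  ext i
  simpa using this i (Nat.zero_le _)

/-- Truncation forgets exactly the degrees < j, and A U + B V has degree < 2d - j, so nothing is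
lost at the top. The cokernel of the matrix is thus R[X]_{<2d-j} modulo `sylSub`. -/
theorem exists_mulVec_iff {A B : R[X]} {d j : ℕ} (hj : j ≤ d) (hA : A ∈ degreeLT R (d + 1))
    (hB : B ∈ degreeLT R (d + 1)) (c : Fin ((d - j) + (d - j)) → R) :
    (∃ x, (sylvesterTrunc A B d d j).mulVec x = c) ↔
      polyOfCoords (2 * d - j) c ∈ sylSub A B (d - j) j := by
  have key : ∀ U ∈ degreeLT R (d - j), ∀ V ∈ degreeLT R (d - j),
      A * U + B * V ∈ degreeLT R (2 * d - j) := fun U hU V hV =>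
    add_mem (mul_mem_degreeLT hA hU (by omega)) (mul_mem_degreeLT hB hV (by omega))
  rw [mem_sylSub]
  constructor
  · rintro ⟨x, hx⟩
    rw [mulVec_sylvesterTrunc, truncCoords_eq_iff hj (key _ (polyOfCoords_mem le_rfl _) _
      (polyOfCoords_mem le_rfl _))] at hx
    exact ⟨_, polyOfCoords_mem le_rfl _, _, polyOfCoords_mem le_rfl _, _, neg_mem hx, by abel⟩
  · rintro ⟨U, hU, V, hV, Z, hZ, h⟩
    refine ⟨Fin.addCases (fun k : Fin (d - j) => U.coeff (d - j - 1 - k))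
      (fun k : Fin (d - j) => V.coeff (d - j - 1 - k)), ?_⟩
    rw [mulVec_sylvesterTrunc]
    simp only [Fin.addCases_left, Fin.addCases_right]
    rw [exists_polyOfCoords hU, exists_polyOfCoords hV, truncCoords_eq_iff hj (key U hU V hV), ← h]
    simpa using hZ

/-- The ideal generated by the `j`-th principal subresultant in degree `(d, d)`. -/
noncomputable def psIdeal (A C : R[X]) (d j : ℕ) : Ideal R :=
  Ideal.span {principalSubresultant A C d d j}

/-- The form in which the Fitting invariance is used: Φ and Φ' embed the two cokernels in the same
module with the same image. The parameters d, j and d', j' may differ. -/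
theorem psIdeal_eq_of_maps {M : Type*} [AddCommGroup M] [Module R M] {A B A' B' : R[X]}
    {d j d' j' : ℕ} (hj : j ≤ d) (hj' : j' ≤ d') (hA : A ∈ degreeLT R (d + 1))
    (hB : B ∈ degreeLT R (d + 1)) (hA' : A' ∈ degreeLT R (d' + 1)) (hB' : B' ∈ degreeLT R (d' + 1))
    (Φ Φ' : R[X] →ₗ[R] M)
    (h : ∀ p ∈ degreeLT R (2 * d - j), Φ p = 0 ↔ p ∈ sylSub A B (d - j) j)
    (h' : ∀ p ∈ degreeLT R (2 * d' - j'), Φ' p = 0 ↔ p ∈ sylSub A' B' (d' - j') j')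
    (hr : (degreeLT R (2 * d - j)).map Φ = (degreeLT R (2 * d' - j')).map Φ') :
    psIdeal A B d j = psIdeal A' B' d' j' := by
  have hrange : ∀ (A B : R[X]) (d j : ℕ) (Φ : R[X] →ₗ[R] M), j ≤ d →
      (∀ p ∈ degreeLT R (2 * d - j), Φ p = 0 ↔ p ∈ sylSub A B (d - j) j) →
      (Φ ∘ₗ polyOfCoords (ι := (d - j) + (d - j)) (2 * d - j)).range =
        (degreeLT R (2 * d - j)).map Φ := by
    intro A B d j Φ hj h
    ext m
    constructor
    · rintro ⟨c, rfl⟩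
      exact ⟨_, polyOfCoords_mem (by omega) c, rfl⟩
    · rintro ⟨p, hp, rfl⟩
      refine ⟨fun i => p.coeff (2 * d - j - 1 - i), ?_⟩
      have h1 := sub_polyOfCoords_mem (ι := (d - j) + (d - j)) (by omega) hp
      rw [show 2 * d - j - (d - j + (d - j)) = j by omega] at h1
      have h2 := (h _ (degreeLT_le (by omega) h1)).2
        (Submodule.mem_sup_right h1)
      rw [map_sub] at h2
      exact (sub_eq_zero.1 h2).symm
  unfold psIdeal principalSubresultant
  refine span_det_eq_of_ker_eq _ _ (Φ ∘ₗ polyOfCoords (2 * d - j)) (Φ' ∘ₗ polyOfCoords (2 * d' - j'))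
    ?_ ?_ ?_
  · rw [hrange A B d j Φ hj h, hrange A' B' d' j' Φ' hj' h', hr]
  · intro c
    rw [LinearMap.comp_apply, h _ (polyOfCoords_mem (by omega) c), exists_mulVec_iff hj hA hB]
  · intro c
    rw [LinearMap.comp_apply, h' _ (polyOfCoords_mem (by omega) c), exists_mulVec_iff hj' hA' hB']

theorem psIdeal_eq_of_sylSub_eq {A B A' B' : R[X]}
    {d j : ℕ} (hj : j ≤ d) (hA : A ∈ degreeLT R (d + 1))
    (hB : B ∈ degreeLT R (d + 1)) (hA' : A' ∈ degreeLT R (d + 1)) (hB' : B' ∈ degreeLT R (d + 1))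
    (h : sylSub A B (d - j) j = sylSub A' B' (d - j) j) :
    psIdeal A B d j = psIdeal A' B' d j := by
  refine psIdeal_eq_of_maps hj hj hA hB hA' hB' (sylSub A B (d - j) j).mkQ
    (sylSub A B (d - j) j).mkQ ?_ ?_ rfl
  · intro p _; simp
  · intro p _; simp [h]

theorem psIdeal_eq_top_iff {A B : R[X]} {d j : ℕ} (hj : j ≤ d) (hA : A ∈ degreeLT R (d + 1))
    (hB : B ∈ degreeLT R (d + 1)) :
    psIdeal A B d j = ⊤ ↔ degreeLT R (2 * d - j) ≤ sylSub A B (d - j) j := by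
  rw [psIdeal, Ideal.span_singleton_eq_top, principalSubresultant, ← Matrix.isUnit_iff_isUnit_det,
    ← Matrix.mulVec_surjective_iff_isUnit]
  constructor
  · intro h p hp
    have h1 := sub_polyOfCoords_mem (ι := (d - j) + (d - j)) (by omega) hp
    rw [show 2 * d - j - (d - j + (d - j)) = j by omega] at h1
    have h2 := (exists_mulVec_iff hj hA hB _).1 (h fun i => p.coeff (2 * d - j - 1 - i))
    have h3 := add_mem h2 (Submodule.mem_sup_right h1)
    simpa using h3
  · intro h c
    exact (exists_mulVec_iff hj hA hB c).2 (h (polyOfCoords_mem (by omega) c))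

/-- Only the d - j columns coming from the second polynomial are scaled. -/
theorem psIdeal_smul (A C : R[X]) (x : R) (d j : ℕ) :
    psIdeal A (Polynomial.C x * C) d j = Ideal.span {x ^ (d - j)} * psIdeal A C d j := by
  have : sylvesterTrunc A (Polynomial.C x * C) d d j = sylvesterTrunc A C d d j *
      Matrix.diagonal (Fin.addCases (fun _ : Fin (d - j) => 1) (fun _ : Fin (d - j) => x)) := by
    ext i c
    rw [Matrix.mul_diagonal]
    refine Fin.addCases (fun c => ?_) (fun c => ?_) c
    · simp [sylvesterTrunc, sylvesterCol]
    · simp [sylvesterTrunc, sylvesterCol, truncCoords, mul_assoc, mul_comm x,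
        -Fin.natAdd_eq_addNat]
  unfold psIdeal principalSubresultant
  rw [this, Matrix.det_mul, Matrix.det_diagonal, Fin.prod_univ_add, Ideal.span_singleton_mul_span_singleton]
  simp [mul_comm, -Fin.natAdd_eq_addNat]

theorem sylvesterTrunc_map {S : Type*} [CommRing S] (f : R →+* S) (A B : R[X]) (dA dB j : ℕ) :
    sylvesterTrunc (A.map f) (B.map f) dA dB j = (sylvesterTrunc A B dA dB j).map f := by
  ext i c
  simp only [sylvesterTrunc, truncCoords, Matrix.of_apply, Matrix.map_apply]
  rw [← coeff_map]
  congr 1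
  refine Fin.addCases (fun c => ?_) (fun c => ?_) c <;> simp [sylvesterCol]

theorem principalSubresultant_map {S : Type*} [CommRing S] (f : R →+* S) (A B : R[X])
    (dA dB j : ℕ) :
    principalSubresultant (A.map f) (B.map f) dA dB j = f (principalSubresultant A B dA dB j) := by
  rw [principalSubresultant, principalSubresultant, RingHom.map_det, sylvesterTrunc_map]
  rfl

theorem psIdeal_map {S : Type*} [CommRing S] (f : R →+* S) (A B : R[X]) (d j : ℕ) :
    psIdeal (A.map f) (B.map f) d j = (psIdeal A B d j).map f := by
  rw [psIdeal, principalSubresultant_map, psIdeal, Ideal.map_span, Set.image_singleton]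

theorem psIdeal_self (A B : R[X]) (d : ℕ) : psIdeal A B d d = ⊤ := by
  unfold psIdeal principalSubresultant
  have : IsEmpty (Fin ((d - d) + (d - d))) := by rw [Nat.sub_self]; exact Fin.isEmpty
  rw [Matrix.det_isEmpty, Ideal.span_singleton_one]

end Sylvester

/-! ### Division steps: transformations of pairs by matrices of determinant one. -/

section Steps

variable {R : Type*} [CommRing R]

theorem exists_mem_degreeLT (p : R[X]) : ∃ N, p ∈ degreeLT R N :=
  ⟨p.natDegree + 1, mem_degreeLT.2 (degree_lt_iff_coeff_zero _ _ |>.2 fun _ hm =>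
    coeff_eq_zero_of_natDegree_lt (by omega))⟩

/-- Degrees are not additive over a ring with zero divisors, so degree bounds are obtained by
lowering an arbitrary initial bound one unit at a time. -/
theorem mem_degreeLT_of_descent {p : R[X]} {m : ℕ}
    (step : ∀ i, m ≤ i → p ∈ degreeLT R (i + 1) → p ∈ degreeLT R i) : p ∈ degreeLT R m := by
  obtain ⟨N, hN⟩ := exists_mem_degreeLT p
  rcases le_total N m with h | h
  · exact degreeLT_le h hN
  · exact Nat.decreasingInduction' (P := fun i => p ∈ degreeLT R i)
      (fun i _ hi hp => step i hi hp) h hN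

theorem Monic.mem_degreeLT_succ {P : R[X]} {k : ℕ} (hk : P.natDegree = k) :
    P ∈ degreeLT R (k + 1) :=
  mem_degreeLT.2 (degree_lt_iff_coeff_zero _ _ |>.2 fun _ hm =>
    coeff_eq_zero_of_natDegree_lt (by omega))

theorem monic_mul_mem_iff {P : R[X]} {k : ℕ} (hP : P.Monic) (hk : P.natDegree = k) {w : R[X]}
    {i : ℕ} : P * w ∈ degreeLT R (k + i) ↔ w ∈ degreeLT R i := by
  constructor
  · intro h
    rw [mem_degreeLT_coeff] at *
    by_contra hw
    push Not at hw
    obtain ⟨l, hl, hl'⟩ := hw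
    have hw0 : w ≠ 0 := by rintro rfl; simp at hl'
    have h1 : l ≤ w.natDegree := le_natDegree_of_ne_zero hl'
    have h2 := h (k + w.natDegree) (by omega)
    rw [← hk, coeff_mul_degree_add_degree, hP.leadingCoeff, one_mul] at h2
    exact hw0 (leadingCoeff_eq_zero.1 h2)
  · intro h
    exact mul_mem_degreeLT (Monic.mem_degreeLT_succ hk) h (by omega)

theorem modByMonic_mem_degreeLT [Nontrivial R] {P : R[X]} {k : ℕ} (hP : P.Monic)
    (hk : P.natDegree = k) (w : R[X]) : w %ₘ P ∈ degreeLT R k := by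
  rw [mem_degreeLT, ← hk, ← degree_eq_natDegree hP.ne_zero]
  exact degree_modByMonic_lt w hP

theorem mem_degreeLT_one : (1 : R[X]) ∈ degreeLT R 1 := by
  rw [mem_degreeLT_coeff]
  intro i hi
  rw [coeff_one, if_neg (by omega)]

/-- Euclidean division by a monic polynomial, as a linear map. -/
noncomputable def divLin {P : R[X]} (hP : P.Monic) : R[X] →ₗ[R] R[X] where
  toFun w := w /ₘ P
  map_add' a b := by
    nontriviality R
    refine (div_modByMonic_unique (f := a + b) (a /ₘ P + b /ₘ P) (a %ₘ P + b %ₘ P) hP ⟨?_, ?_⟩).1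
    · conv_rhs => rw [← modByMonic_add_div a P, ← modByMonic_add_div b P]
      ring
    · exact (degree_add_le _ _).trans_lt (max_lt (degree_modByMonic_lt _ hP)
        (degree_modByMonic_lt _ hP))
  map_smul' c a := by
    nontriviality R
    refine (div_modByMonic_unique (f := c • a) (c • (a /ₘ P)) (c • (a %ₘ P)) hP ⟨?_, ?_⟩).1
    · conv_rhs => rw [← modByMonic_add_div a P]
      rw [smul_add, mul_smul_comm]
    · exact (degree_smul_le _ _).trans_lt (degree_modByMonic_lt _ hP)

/-- The data of one division step: `P` is monic of degree `k`, `S` is monic of degree `e`, and the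
matrix `(P, P'; Q, Q')` of determinant `1` transforms `(S, T)` into `(A, C)`. -/
structure IsStep (P Q P' Q' : R[X]) (k : ℕ) (S T : R[X]) (e : ℕ) : Prop where
  hP : P.Monic
  dP : P.natDegree = k
  dQ : Q ∈ degreeLT R k
  dP' : P' ∈ degreeLT R k
  det : P * Q' - P' * Q = 1
  hS : S.Monic
  dS : S.natDegree = e
  dT : T ∈ degreeLT R e
  hk : 1 ≤ k

theorem bezout_mem_degreeLT {P Q P' Q' : R[X]} {k : ℕ} (hP : P.Monic) (dP : P.natDegree = k)
    (dQ : Q ∈ degreeLT R k) (dP' : P' ∈ degreeLT R k) (det : P * Q' - P' * Q = 1) (hk : 1 ≤ k) :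
    Q' ∈ degreeLT R k := by
  rw [← monic_mul_mem_iff hP dP]
  have : P * Q' = 1 + P' * Q := by rw [← det]; ring
  rw [this]
  exact add_mem (degreeLT_le (by omega) mem_degreeLT_one) (mul_mem_degreeLT dP' dQ (by omega))

namespace IsStep

variable {P Q P' Q' S T : R[X]} {k e : ℕ} (h : IsStep P Q P' Q' k S T e)

include h

theorem dQ' : Q' ∈ degreeLT R k := bezout_mem_degreeLT h.hP h.dP h.dQ h.dP' h.det h.hk

theorem A_mem : P * S + P' * T ∈ degreeLT R (k + e + 1) :=
  add_mem (mul_mem_degreeLT (Monic.mem_degreeLT_succ h.dP) (Monic.mem_degreeLT_succ h.dS) (by omega))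
    (mul_mem_degreeLT h.dP' h.dT (by omega))

theorem C_mem : Q * S + Q' * T ∈ degreeLT R (k + e) :=
  add_mem (mul_mem_degreeLT h.dQ (Monic.mem_degreeLT_succ h.dS) (by omega))
    (mul_mem_degreeLT h.dQ' h.dT (by omega))

theorem S_eq : S = Q' * (P * S + P' * T) - P' * (Q * S + Q' * T) := by
  linear_combination (- S) * h.det

theorem T_eq : T = P * (Q * S + Q' * T) - Q * (P * S + P' * T) := by
  linear_combination (- T) * h.det

theorem P'T_degree [Nontrivial R] : (P' * T).degree < (P * S).degree := by
  have h1 : (P * S).degree = ((k + e : ℕ) : WithBot ℕ) := by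
    rw [degree_eq_natDegree (h.hP.mul h.hS).ne_zero, h.hP.natDegree_mul h.hS, h.dP, h.dS]
  rw [h1, ← mem_degreeLT]
  exact mul_mem_degreeLT h.dP' h.dT (by omega)

theorem A_monic [Nontrivial R] : (P * S + P' * T).Monic :=
  (h.hP.mul h.hS).add_of_left h.P'T_degree

theorem A_natDegree [Nontrivial R] : (P * S + P' * T).natDegree = k + e := by
  rw [natDegree_add_eq_left_of_degree_lt h.P'T_degree, h.hP.natDegree_mul h.hS, h.dP, h.dS]

/-- The key degree estimate. -/
theorem mem_of_combination_mem {n : ℕ} (hn : k ≤ n) {U V : R[X]}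
    (hV : V ∈ degreeLT R n)
    (hUV : (P * S + P' * T) * U + (Q * S + Q' * T) * V ∈ degreeLT R (e + (n - k))) :
    P * U + Q * V ∈ degreeLT R (n - k) ∧ P' * U + Q' * V ∈ degreeLT R (n - k) := by
  have hV' : P * (P' * U + Q' * V) = V + P' * (P * U + Q * V) := by
    linear_combination V * h.det
  -- With w = P U + Q V and w' = P' U + Q' V, the combination is S w + T w'. A bound on w gives a
  -- bound on w' better by one, as P w' = V + P' w; then S w improves the bound on w.
  have step1 : ∀ i, n ≤ k + i → P * U + Q * V ∈ degreeLT R (i + 1) →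
      P' * U + Q' * V ∈ degreeLT R i := fun i hi hw => by
    rw [← monic_mul_mem_iff h.hP h.dP, hV']
    exact add_mem (degreeLT_le hi hV) (mul_mem_degreeLT h.dP' hw (by omega))
  have hw : P * U + Q * V ∈ degreeLT R (n - k) := by
    refine mem_degreeLT_of_descent fun i hi hw => ?_
    rw [← monic_mul_mem_iff h.hS h.dS]
    have : S * (P * U + Q * V) =
      ((P * S + P' * T) * U + (Q * S + Q' * T) * V) - T * (P' * U + Q' * V) := by ring
    rw [this]
    exact sub_mem (degreeLT_le (by omega) hUV)
      (mul_mem_degreeLT h.dT (step1 i (by omega) hw) (by omega))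
  exact ⟨hw, step1 _ (by omega) (degreeLT_le (by omega) hw)⟩

end IsStep

/-- The linear map sending `P u + Q v` to `A u + C v` for `deg v < deg P`. -/
noncomputable def stepMap {P : R[X]} (hP : P.Monic) (P' S T : R[X]) : R[X] →ₗ[R] R[X] :=
  LinearMap.mulLeft R S + LinearMap.mulLeft R T ∘ₗ divLin hP ∘ₗ LinearMap.mulLeft R P'

theorem stepMap_apply {P : R[X]} (hP : P.Monic) (P' S T w : R[X]) :
    stepMap hP P' S T w = S * w + T * ((P' * w) /ₘ P) := rfl

namespace IsStep

variable [Nontrivial R] {P Q P' Q' S T : R[X]} {k e : ℕ} (h : IsStep P Q P' Q' k S T e)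

include h

/-- P' (P u + Q v) = P (P' u + Q' v) - v is a Euclidean division by P, because deg v < k. -/
theorem stepMap_combination {u v : R[X]} (hv : v ∈ degreeLT R k) :
    stepMap h.hP P' S T (P * u + Q * v) = (P * S + P' * T) * u + (Q * S + Q' * T) * v := by
  have : (P' * (P * u + Q * v)) /ₘ P = P' * u + Q' * v := by
    refine (div_modByMonic_unique _ (-v) h.hP ⟨?_, ?_⟩).1
    · linear_combination v * h.det
    · rw [degree_neg, degree_eq_natDegree h.hP.ne_zero, h.dP]
      exact mem_degreeLT.1 hv
  rw [stepMap_apply, this]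
  ring

theorem div_mem {w : R[X]} {i : ℕ} (hw : w ∈ degreeLT R (i + 1)) :
    (P' * w) /ₘ P ∈ degreeLT R i := by
  rw [← monic_mul_mem_iff h.hP h.dP]
  have : P * ((P' * w) /ₘ P) = P' * w - (P' * w) %ₘ P := by
    rw [eq_sub_iff_add_eq, add_comm]; exact modByMonic_add_div _ _
  rw [this]
  exact sub_mem (mul_mem_degreeLT h.dP' hw (by omega))
    (degreeLT_le (by omega) (modByMonic_mem_degreeLT h.hP h.dP _))

theorem stepMap_mem {w : R[X]} {i : ℕ} (hw : w ∈ degreeLT R i) :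
    stepMap h.hP P' S T w ∈ degreeLT R (e + i) := by
  rw [stepMap_apply]
  exact add_mem ((monic_mul_mem_iff h.hS h.dS).2 hw)
    (mul_mem_degreeLT h.dT (h.div_mem (degreeLT_le (Nat.le_succ i) hw)) (by omega))

/-- The map is triangular: S is monic, and the other term has smaller degree than the bound on S w.
Together with `exists_stepMap_sub_mem` this identifies R[X]_{<i} with R[X]_{<e+i} / R[X]_{<e}. -/
theorem mem_of_stepMap_mem {w : R[X]} {i : ℕ} (hw : stepMap h.hP P' S T w ∈ degreeLT R (e + i)) :
    w ∈ degreeLT R i := by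
  refine mem_degreeLT_of_descent fun l hl hl' => ?_
  rw [← monic_mul_mem_iff h.hS h.dS]
  have : S * w = stepMap h.hP P' S T w - T * ((P' * w) /ₘ P) := by rw [stepMap_apply]; ring
  rw [this]
  exact sub_mem (degreeLT_le (by omega) hw) (mul_mem_degreeLT h.dT (h.div_mem hl') (by omega))

theorem exists_stepMap_sub_mem (i : ℕ) : ∀ y ∈ degreeLT R (e + i), ∃ w ∈ degreeLT R i,
    y - stepMap h.hP P' S T w ∈ degreeLT R e := by
  induction i with
  | zero => intro y hy; exact ⟨0, zero_mem _, by simpa using hy⟩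
  | succ i ih =>
    intro y hy
    obtain ⟨w₀, hw₀m, hw₀⟩ : ∃ w₀ ∈ degreeLT R (i + 1),
        (S * w₀).coeff (e + i) = y.coeff (e + i) := by
      refine ⟨C (y.coeff (e + i)) * X ^ i, ?_, ?_⟩
      · rw [mem_degreeLT_coeff]; intro l hl
        rw [coeff_C_mul, coeff_X_pow, if_neg (by omega), mul_zero]
      · rw [mul_left_comm, coeff_C_mul, coeff_mul_X_pow, ← h.dS, h.hS.coeff_natDegree, mul_one]
    have : y - stepMap h.hP P' S T w₀ ∈ degreeLT R (e + i) := by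
      rw [stepMap_apply, ← sub_sub]
      refine sub_mem ?_ (mul_mem_degreeLT h.dT (h.div_mem hw₀m) (by omega))
      have h1 : y - S * w₀ ∈ degreeLT R (e + (i + 1)) :=
        sub_mem hy ((monic_mul_mem_iff h.hS h.dS).2 hw₀m)
      rw [mem_degreeLT_coeff] at h1 ⊢
      intro l hl
      rcases hl.eq_or_lt with hl | hl
      · rw [← hl, coeff_sub, hw₀, sub_self]
      · exact h1 l (by omega)
    obtain ⟨w, hw, hw'⟩ := ih _ this
    refine ⟨w + w₀, add_mem (degreeLT_le (Nat.le_succ i) hw) hw₀m, ?_⟩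
    rw [map_add]
    convert hw' using 1
    ring

/-- The solution v is minus the remainder of P' w modulo P; the determinant then determines u, and P
u = w - Q v bounds its degree. -/
theorem exists_combination {w : R[X]} (hw : w ∈ degreeLT R (k + k)) :
    ∃ u ∈ degreeLT R k, ∃ v ∈ degreeLT R k, P * u + Q * v = w := by
  obtain ⟨l, hl⟩ : ∃ l, P * l - P' * w ∈ degreeLT R k := by
    refine ⟨(P' * w) /ₘ P, ?_⟩
    have h1 := modByMonic_add_div (P' * w) P
    have : P * ((P' * w) /ₘ P) - P' * w = - ((P' * w) %ₘ P) := by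
      rw [eq_neg_iff_add_eq_zero, sub_add_eq_add_sub, add_comm, h1, sub_self]
    rw [this]
    exact neg_mem (modByMonic_mem_degreeLT h.hP h.dP _)
  refine ⟨Q' * w - Q * l, ?_, P * l - P' * w, hl, by linear_combination w * h.det⟩
  rw [← monic_mul_mem_iff h.hP h.dP]
  have : P * (Q' * w - Q * l) = w - Q * (P * l - P' * w) := by
    linear_combination w * h.det
  rw [this]
  exact sub_mem hw (mul_mem_degreeLT h.dQ hl (by omega))

/-- Subresultants of index `≤ e` are those of the pair `(S, T)`. -/
theorem psIdeal_eq_low {j : ℕ} (hj : j ≤ e) :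
    psIdeal (P * S + P' * T) (Q * S + Q' * T) (k + e) j = psIdeal S T e j := by
  set A := P * S + P' * T with hA
  set B := Q * S + Q' * T with hB
  set n := k + e - j with hn
  set L := sylSub A B n j with hL
  -- In degrees < 2e - j both pairs have the same relations, so the inclusion of R[X]_{<2e-j} is
  -- injective on cokernels. It remains to see that it is onto.
  have hLe : ∀ p ∈ degreeLT R (2 * e - j), p ∈ L ↔ p ∈ sylSub S T (e - j) j := by
    intro p hp
    constructor
    · intro hpL
      obtain ⟨U, hU, V, hV, Z, hZ, rfl⟩ := mem_sylSub.1 hpL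
      have h1 : A * U + B * V ∈ degreeLT R (e + (n - k)) := by
        have := sub_mem hp (degreeLT_le (by omega : j ≤ 2 * e - j) hZ)
        rw [add_sub_cancel_right] at this
        exact degreeLT_le (by omega) this
      obtain ⟨h2, h3⟩ := h.mem_of_combination_mem (by omega) hV h1
      refine mem_sylSub.2 ⟨_, degreeLT_le (by omega) h2, _, degreeLT_le (by omega) h3, Z, hZ, ?_⟩
      rw [hA, hB]; ring
    · intro hpL
      obtain ⟨U, hU, V, hV, Z, hZ, rfl⟩ := mem_sylSub.1 hpL
      refine mem_sylSub.2 ⟨Q' * U - Q * V, ?_, P * V - P' * U, ?_, Z, hZ, ?_⟩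
      · exact sub_mem (mul_mem_degreeLT h.dQ' hU (by omega)) (mul_mem_degreeLT h.dQ hV (by omega))
      · exact sub_mem (mul_mem_degreeLT (Monic.mem_degreeLT_succ h.dP) hV (by omega))
          (mul_mem_degreeLT h.dP' hU (by omega))
      · rw [hA, hB]; linear_combination (S * U + T * V) * h.det
  refine psIdeal_eq_of_maps (by omega) hj h.A_mem (degreeLT_le (Nat.le_succ _) h.C_mem)
    (Monic.mem_degreeLT_succ h.dS) (degreeLT_le (Nat.le_succ _) h.dT) L.mkQ L.mkQ ?_ ?_ ?_
  · intro p _; simp [hL, hn]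
  · intro p hp; rw [Submodule.mkQ_apply, Submodule.Quotient.mk_eq_zero, hLe p hp]
  · apply le_antisymm
    · rintro _ ⟨y, hy, rfl⟩
      -- Only the quotient of y by X^m is lowered. Its degree is < e + 2k, so
      -- `exists_stepMap_sub_mem` and `exists_combination` subtract some A u + B v with deg u, deg v
      -- < k and leave degree < e; multiplying back by X^m gives degree < e + m = 2e - j.
      set m := n - k with hm
      have hX : (X ^ m : R[X]).Monic := monic_X_pow m
      have hXd : (X ^ m : R[X]).natDegree = m := natDegree_X_pow m
      have hy0 : y %ₘ X ^ m ∈ degreeLT R m := modByMonic_mem_degreeLT hX hXd y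
      have hyd := modByMonic_add_div y (X ^ m : R[X])
      have hy1 : y /ₘ X ^ m ∈ degreeLT R (e + (k + k)) := by
        rw [← monic_mul_mem_iff hX hXd]
        have : (X ^ m : R[X]) * (y /ₘ X ^ m) = y - y %ₘ X ^ m := by
          rw [eq_sub_iff_add_eq, add_comm]; exact hyd
        rw [this]
        exact sub_mem (degreeLT_le (by omega) hy) (degreeLT_le (by omega) hy0)
      obtain ⟨w, hw, hyw⟩ := h.exists_stepMap_sub_mem _ _ hy1
      obtain ⟨u, hu, v, hv, rfl⟩ := h.exists_combination hw
      rw [h.stepMap_combination hv] at hyw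
      refine ⟨y %ₘ X ^ m + X ^ m * (y /ₘ X ^ m - (A * u + B * v)), ?_, ?_⟩
      · exact add_mem (degreeLT_le (by omega) hy0)
          (degreeLT_le (by omega) ((monic_mul_mem_iff hX hXd).2 hyw))
      · rw [Submodule.mkQ_apply, Submodule.mkQ_apply, Submodule.Quotient.eq, hL, mem_sylSub]
        refine ⟨- (X ^ m * u), neg_mem (degreeLT_le (by omega) ((monic_mul_mem_iff hX hXd).2 hu)),
          - (X ^ m * v), neg_mem (degreeLT_le (by omega) ((monic_mul_mem_iff hX hXd).2 hv)),
          0, zero_mem _, ?_⟩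
        linear_combination (- hyd)
    · exact Submodule.map_mono (degreeLT_mono (by omega))

/-- Subresultants of index `≥ e` are those of the pair `(P, Q)`. -/
theorem psIdeal_eq_high {j : ℕ} (hej : e ≤ j) (hj : j ≤ k + e) :
    psIdeal (P * S + P' * T) (Q * S + Q' * T) (k + e) j = psIdeal P Q k (j - e) := by
  set A := P * S + P' * T with hA
  set B := Q * S + Q' * T with hB
  set n := k + e - j with hn
  have hn' : k - (j - e) = n := by omega
  set L := sylSub A B n j with hL
  -- The isomorphism of cokernels is induced by `stepMap`. The degrees < e that it misses lie in
  -- R[X]_{<j}, hence vanish in the target.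
  refine psIdeal_eq_of_maps (by omega) (by omega) h.A_mem (degreeLT_le (Nat.le_succ _) h.C_mem)
    (Monic.mem_degreeLT_succ h.dP) (degreeLT_le (Nat.le_succ _) h.dQ) L.mkQ
    (L.mkQ ∘ₗ stepMap h.hP P' S T) ?_ ?_ ?_
  · intro p _; simp [hL, hn]
  · intro p hp
    rw [LinearMap.comp_apply, Submodule.mkQ_apply, Submodule.Quotient.mk_eq_zero, hn']
    constructor
    · intro hpL
      obtain ⟨U, hU, V, hV, Z, hZ, hp'⟩ := mem_sylSub.1 hpL
      refine mem_sylSub.2 ⟨U, hU, V, hV, p - (P * U + Q * V), ?_, by ring⟩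
      apply h.mem_of_stepMap_mem
      rw [map_sub, h.stepMap_combination (degreeLT_le (by omega) hV), ← hp',
        add_sub_cancel_left]
      exact degreeLT_le (by omega) hZ
    · intro hpL
      obtain ⟨U, hU, V, hV, Z, hZ, rfl⟩ := mem_sylSub.1 hpL
      rw [map_add, h.stepMap_combination (degreeLT_le (by omega) hV)]
      exact mem_sylSub.2 ⟨U, hU, V, hV, _, degreeLT_le (by omega) (h.stepMap_mem hZ), rfl⟩
  · apply le_antisymm
    · rintro _ ⟨y, hy, rfl⟩
      obtain ⟨w, hw, hyw⟩ := h.exists_stepMap_sub_mem (2 * k - (j - e)) y (degreeLT_le (by omega) hy)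
      refine ⟨w, hw, ?_⟩
      rw [LinearMap.comp_apply, Submodule.mkQ_apply, Submodule.mkQ_apply, eq_comm,
        Submodule.Quotient.eq]
      exact Submodule.mem_sup_right (degreeLT_le hej hyw)
    · rintro _ ⟨w, hw, rfl⟩
      exact ⟨_, degreeLT_le (by omega) (h.stepMap_mem hw), rfl⟩

end IsStep

end Steps

/-! ### Factorization of the pairs having a unit principal subresultant. -/

section Pairs

variable {R : Type*} [CommRing R]

/-- Pairs of a monic polynomial of degree `d` and of a polynomial of degree `< d`. -/
def monicLow (R : Type*) [CommRing R] (d : ℕ) : Set (R[X] × R[X]) :=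
  {x | x.1 - X ^ d ∈ degreeLT R d ∧ x.2 ∈ degreeLT R d}

theorem monic_of_sub_mem [Nontrivial R] {p : R[X]} {d : ℕ} (h : p - X ^ d ∈ degreeLT R d) :
    p.Monic ∧ p.natDegree = d := by
  have h1 := mem_degreeLT.1 h
  have h2 : p = X ^ d + (p - X ^ d) := by ring
  have h3 : (p - X ^ d).degree < (X ^ d : R[X]).degree := by rwa [degree_X_pow]
  rw [h2]
  exact ⟨(monic_X_pow d).add_of_left h3, by
    rw [natDegree_add_eq_left_of_degree_lt h3, natDegree_X_pow]⟩

theorem sub_mem_of_monic {p q : R[X]} {d : ℕ} (hp : p.Monic) (hpd : p.natDegree = d)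
    (hq : q.Monic) (hqd : q.natDegree = d) : p - q ∈ degreeLT R d := by
  rw [mem_degreeLT_coeff]
  intro i hi
  rw [coeff_sub]
  rcases hi.eq_or_lt with h | h
  · rw [← h]
    conv_lhs => enter [1]; rw [← hpd]
    rw [← hqd, hp.coeff_natDegree, hq.coeff_natDegree, sub_self]
  · rw [coeff_eq_zero_of_natDegree_lt (by omega), coeff_eq_zero_of_natDegree_lt (by omega), sub_self]

theorem eq_zero_of_mem_degreeLT_zero {p : R[X]} (h : p ∈ degreeLT R 0) : p = 0 := by
  ext i
  rw [(mem_degreeLT_coeff.1 h) i (Nat.zero_le _), coeff_zero]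

/-- Pairs `(P, P'; Q, Q')` of Bézout coefficients. -/
def IsBezout (x : R[X] × R[X]) (k : ℕ) (y : R[X] × R[X]) : Prop :=
  y.1 ∈ degreeLT R k ∧ x.1 * y.2 - y.1 * x.2 = 1

/-- The coprime pairs in `monicLow R k`. -/
def coprimePairs (R : Type*) [CommRing R] (k : ℕ) : Set (R[X] × R[X]) :=
  {x | x ∈ monicLow R k ∧ ∃ y, IsBezout x k y}

open Classical in
/-- A choice of Bézout coefficients. -/
noncomputable def bezout (k : ℕ) (x : R[X] × R[X]) : R[X] × R[X] :=
  if h : ∃ y, IsBezout x k y then h.choose else 0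

theorem isBezout_bezout {k : ℕ} {x : R[X] × R[X]} (h : x ∈ coprimePairs R k) :
    IsBezout x k (bezout k x) := by
  rw [bezout, dif_pos h.2]
  exact h.2.choose_spec

theorem IsBezout.unique [Nontrivial R] {k : ℕ} {x y z : R[X] × R[X]} (hx : x ∈ monicLow R k)
    (hy : IsBezout x k y) (hz : IsBezout x k z) : y = z := by
  obtain ⟨hm, hd⟩ := monic_of_sub_mem hx.1
  have h1 : y.1 - z.1 = 0 := by
    have h2 : x.1 * ((y.1 - z.1) * y.2 - y.1 * (y.2 - z.2)) = y.1 - z.1 := by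
      linear_combination (y.1 - z.1) * hy.2 - y.1 * (hy.2 - hz.2)
    have h3 : x.1 * ((y.1 - z.1) * y.2 - y.1 * (y.2 - z.2)) ∈ degreeLT R (k + 0) := by
      rw [h2]; exact sub_mem hy.1 hz.1
    rw [← h2, eq_zero_of_mem_degreeLT_zero ((monic_mul_mem_iff hm hd).1 h3), mul_zero]
  have h4 : x.1 * (y.2 - z.2) = 0 := by
    linear_combination hy.2 - hz.2 + x.2 * h1
  ext1
  · exact sub_eq_zero.1 h1
  · refine sub_eq_zero.1 (eq_zero_of_mem_degreeLT_zero ((monic_mul_mem_iff hm hd).1 ?_))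
    rw [h4]
    exact zero_mem (degreeLT R (k + 0))

theorem mem_coprimePairs [Nontrivial R] {k : ℕ} {x : R[X] × R[X]} (hx : x ∈ monicLow R k)
    {a b : R[X]} (h : x.1 * a + x.2 * b = 1) : x ∈ coprimePairs R k := by
  obtain ⟨hm, hd⟩ := monic_of_sub_mem hx.1
  refine ⟨hx, (- (b %ₘ x.1), a + x.2 * (b /ₘ x.1)), neg_mem (modByMonic_mem_degreeLT hm hd _), ?_⟩
  linear_combination h + x.2 * modByMonic_add_div b x.1

theorem isStep_of_mem [Nontrivial R] {k e : ℕ} (hk : 1 ≤ k) {x y z : R[X] × R[X]}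
    (hx : x ∈ monicLow R k) (hb : IsBezout x k z)
    (hy : y ∈ monicLow R e) :
    IsStep x.1 x.2 z.1 z.2 k y.1 y.2 e where
  hP := (monic_of_sub_mem hx.1).1
  dP := (monic_of_sub_mem hx.1).2
  dQ := hx.2
  dP' := hb.1
  det := hb.2
  hS := (monic_of_sub_mem hy.1).1
  dS := (monic_of_sub_mem hy.1).2
  dT := hy.2
  hk := hk

/-- Composition of a coprime pair `(P, Q)` of degree `k` with a pair `(S, T)`. -/
noncomputable def compPair (k : ℕ) (x : (R[X] × R[X]) × (R[X] × R[X])) : R[X] × R[X] :=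
  (x.1.1 * x.2.1 + (bezout k x.1).1 * x.2.2, x.1.2 * x.2.1 + (bezout k x.1).2 * x.2.2)

theorem isStep_bezout [Nontrivial R] {k e : ℕ} (hk : 1 ≤ k) {x y : R[X] × R[X]}
    (hx : x ∈ coprimePairs R k) (hy : y ∈ monicLow R e) :
    IsStep x.1 x.2 (bezout k x).1 (bezout k x).2 k y.1 y.2 e :=
  isStep_of_mem hk hx.1 (isBezout_bezout hx) hy

theorem degreeLT_mem_of_psIdeal_eq_top [Nontrivial R] {d j : ℕ} (hj : j ≤ d) {x : R[X] × R[X]}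
    (hx : x ∈ monicLow R d) : psIdeal x.1 x.2 d j = ⊤ ↔
      degreeLT R (2 * d - j) ≤ sylSub x.1 x.2 (d - j) j :=
  psIdeal_eq_top_iff hj (Monic.mem_degreeLT_succ (monic_of_sub_mem hx.1).2)
    (degreeLT_le (Nat.le_succ _) hx.2)

/-- A division step without any division of coefficients: invertibility of the Sylvester map
supplies the cofactors, and the degree estimate `IsStep.mem_of_combination_mem` makes them unique.
-/
theorem bijOn_compPair [Nontrivial R] {k e : ℕ} (hk : 1 ≤ k) :
    Set.BijOn (compPair k) (coprimePairs R k ×ˢ monicLow R e)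
      {x | x ∈ monicLow R (k + e) ∧ psIdeal x.1 x.2 (k + e) e = ⊤} := by
  refine ⟨?_, ?_, ?_⟩
  · rintro ⟨x, y⟩ ⟨hx, hy⟩
    have h := isStep_bezout hk hx hy
    refine ⟨⟨sub_mem_of_monic h.A_monic h.A_natDegree (monic_X_pow _) (natDegree_X_pow _),
      h.C_mem⟩, ?_⟩
    exact (h.psIdeal_eq_low le_rfl).trans (psIdeal_self _ _ _)
  · rintro ⟨x, y⟩ ⟨hx, hy⟩ ⟨x', y'⟩ ⟨hx', hy'⟩ heq
    have h := isStep_bezout hk hx hy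
    have h' := isStep_bezout hk hx' hy'
    obtain ⟨e1, e2⟩ := Prod.ext_iff.1 heq
    simp only [compPair] at e1 e2
    have hT := h.T_eq
    have hT' := h'.T_eq
    have hS := h.S_eq
    have hS' := h'.S_eq
    rw [← e1, ← e2] at hT' hS'
    -- The difference of the two second components has degree < e and is a combination of the common
    -- pair with cofactors of degree < k, so the degree estimate with n = k makes the cofactors
    -- vanish.
    have h1 : (x.1 * y.1 + (bezout k x).1 * y.2) * (-(x.2 - x'.2)) +
        (x.2 * y.1 + (bezout k x).2 * y.2) * (x.1 - x'.1) ∈ degreeLT R (e + (k - k)) := by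
      have : (x.1 * y.1 + (bezout k x).1 * y.2) * (-(x.2 - x'.2)) +
        (x.2 * y.1 + (bezout k x).2 * y.2) * (x.1 - x'.1) = y.2 - y'.2 := by
        linear_combination hT' - hT
      rw [this, Nat.sub_self]
      exact sub_mem hy.2 hy'.2
    obtain ⟨h2, h3⟩ := h.mem_of_combination_mem le_rfl
      (sub_mem_of_monic h.hP h.dP h'.hP h'.dP) h1
    rw [Nat.sub_self] at h2 h3
    have h2 := eq_zero_of_mem_degreeLT_zero h2
    have h3 := eq_zero_of_mem_degreeLT_zero h3
    have hx1 : x.1 = x'.1 := by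
      linear_combination (x.1 * h3 - (bezout k x).1 * h2) - (x.1 - x'.1) * h.det
    have hx2 : x.2 = x'.2 := by
      linear_combination (x.2 * h3 - (bezout k x).2 * h2) - (x.2 - x'.2) * h.det
    have hxx : x = x' := Prod.ext hx1 hx2
    subst hxx
    have hyy : y = y' := Prod.ext (hS.trans hS'.symm) (hT.trans hT'.symm)
    rw [hyy]
  · rintro ⟨A, B⟩ ⟨hx, htop⟩
    have hsub := (degreeLT_mem_of_psIdeal_eq_top (by omega) hx).1 htop
    rw [show k + e - e = k by omega] at hsub
    dsimp only at hsub
    obtain ⟨hA, hAd⟩ := monic_of_sub_mem hx.1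
    dsimp only at hA hAd
    -- Writing X^e = A U₁ + B V₁ + Z₁ and X^k B = A U + B V + Z amounts to S = Q' A - P' B and T = P
    -- B - Q A, with S = X^e - Z₁, T = Z, P = X^k - V, Q = U, P' = -V₁ and Q' = U₁.
    have hXe : (X ^ e : R[X]) ∈ degreeLT R (2 * (k + e) - e) := by
      rw [mem_degreeLT, degree_X_pow]; exact_mod_cast (by omega : e < 2 * (k + e) - e)
    obtain ⟨U₁, hU₁, V₁, hV₁, Z₁, hZ₁, e₁⟩ := mem_sylSub.1 (hsub hXe)
    have hXk : (X ^ k * B : R[X]) ∈ degreeLT R (2 * (k + e) - e) :=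
      degreeLT_le (by omega) ((monic_mul_mem_iff (monic_X_pow k) (natDegree_X_pow k)).2 hx.2)
    obtain ⟨U, hU, V, hV, Z, hZ, e₂⟩ := mem_sylSub.1 (hsub hXk)
    have hP : X ^ k - V - X ^ k ∈ degreeLT R k := by
      rw [sub_right_comm, sub_self, zero_sub]; exact neg_mem hV
    have hS : X ^ e - Z₁ - X ^ e ∈ degreeLT R e := by
      rw [sub_right_comm, sub_self, zero_sub]; exact neg_mem hZ₁
    obtain ⟨hPm, hPd⟩ := monic_of_sub_mem hP
    obtain ⟨hSm, hSd⟩ := monic_of_sub_mem hS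
    have hdet : (X ^ k - V) * U₁ - (-V₁) * U = 1 := by
      -- A times (determinant - 1) has degree smaller than the degree of the monic A, hence the
      -- determinant is 1.
      have h1 : A * ((X ^ k - V) * U₁ - (-V₁) * U - 1) =
          ((X ^ k - V) * (X ^ e - Z₁) - A) + (-V₁) * Z := by
        linear_combination (X ^ k - V) * e₁ + V₁ * e₂
      have h2 : A * ((X ^ k - V) * U₁ - (-V₁) * U - 1) ∈ degreeLT R (k + e + 0) := by
        rw [h1]
        refine add_mem (sub_mem_of_monic (hPm.mul hSm) ?_ hA hAd)
          (mul_mem_degreeLT (neg_mem hV₁) hZ (by omega))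
        rw [hPm.natDegree_mul hSm, hPd, hSd]; rfl
      exact sub_eq_zero.1 (eq_zero_of_mem_degreeLT_zero ((monic_mul_mem_iff hA hAd).1 h2))
    have hbz : IsBezout (X ^ k - V, U) k (-V₁, U₁) := ⟨neg_mem hV₁, hdet⟩
    have hcop : (X ^ k - V, U) ∈ coprimePairs R k := ⟨⟨hP, hU⟩, _, hbz⟩
    refine ⟨((X ^ k - V, U), (X ^ e - Z₁, Z)), ⟨hcop, ⟨hS, hZ⟩⟩, ?_⟩
    have hb := IsBezout.unique hcop.1 (isBezout_bezout hcop) hbz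
    simp only [compPair, hb]
    ext1
    · dsimp only
      linear_combination A * hdet - (X ^ k - V) * e₁ - V₁ * e₂
    · dsimp only
      linear_combination B * hdet - U * e₁ + U₁ * e₂

end Pairs

/-! ### Inversion modulo P, and insensitivity to constant terms. -/

section Duality

variable {R : Type*} [CommRing R] [Nontrivial R]

/-- The cokernel for (P, Q) at index m is R[X]/(P) modulo Q R[X]_{<k-m} + R[X]_{<m}. As G inverts Q
modulo P, multiplication by Q carries G R[X]_{<m} + R[X]_{<k-m} onto this submodule. -/
theorem psIdeal_dual {P Q G H : R[X]} {k m : ℕ} (hm : m ≤ k) (hP : P.Monic) (hPd : P.natDegree = k)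
    (hQ : Q ∈ degreeLT R k) (hG : G ∈ degreeLT R k) (h : Q * G + P * H = 1) :
    psIdeal P Q k m = psIdeal P G k (k - m) := by
  let L : Submodule R R[X] := (degreeLT R (k - m)).map (LinearMap.mulLeft R Q) ⊔ degreeLT R m ⊔
    (LinearMap.mulLeft R P).range
  have hL : ∀ p, p ∈ L ↔ ∃ V ∈ degreeLT R (k - m), ∃ Z ∈ degreeLT R m, ∃ U, Q * V + Z + P * U = p := by
    intro p
    simp only [L, Submodule.mem_sup, Submodule.mem_map, LinearMap.mulLeft_apply,
      LinearMap.mem_range]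
    constructor
    · rintro ⟨_, ⟨_, ⟨V, hV, rfl⟩, Z, hZ, rfl⟩, _, ⟨U, rfl⟩, rfl⟩
      exact ⟨V, hV, Z, hZ, U, rfl⟩
    · rintro ⟨V, hV, Z, hZ, U, rfl⟩
      exact ⟨_, ⟨_, ⟨V, hV, rfl⟩, Z, hZ, rfl⟩, _, ⟨U, rfl⟩, rfl⟩
  have hPm := Monic.mem_degreeLT_succ hPd
  refine psIdeal_eq_of_maps hm (Nat.sub_le _ _) hPm (degreeLT_le (Nat.le_succ _) hQ) hPm
    (degreeLT_le (Nat.le_succ _) hG) L.mkQ (L.mkQ ∘ₗ LinearMap.mulLeft R Q) ?_ ?_ ?_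
  · intro p hp
    rw [Submodule.mkQ_apply, Submodule.Quotient.mk_eq_zero, hL, mem_sylSub]
    constructor
    · rintro ⟨V, hV, Z, hZ, U, rfl⟩
      refine ⟨U, ?_, V, hV, Z, hZ, by ring⟩
      rw [← monic_mul_mem_iff hP hPd]
      have : P * U = (Q * V + Z + P * U) - Q * V - Z := by ring
      rw [this]
      exact sub_mem (sub_mem (degreeLT_le (by omega) hp) (mul_mem_degreeLT hQ hV (by omega)))
        (degreeLT_le (by omega) hZ)
    · rintro ⟨U, hU, V, hV, Z, hZ, rfl⟩
      exact ⟨V, hV, Z, hZ, U, by ring⟩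
  · intro p hp
    rw [LinearMap.comp_apply, Submodule.mkQ_apply, Submodule.Quotient.mk_eq_zero, hL, mem_sylSub,
      LinearMap.mulLeft_apply]
    constructor
    · rintro ⟨V, hV, Z, hZ, U, hp'⟩
      have hp'' : P * (G * U + H * (p - V)) + G * Z + V = p := by
        linear_combination G * hp' + (p - V) * h
      refine ⟨G * U + H * (p - V), ?_, Z, degreeLT_le (by omega) hZ, V, hV, hp''⟩
      rw [← monic_mul_mem_iff hP hPd]
      have : P * (G * U + H * (p - V)) = p - G * Z - V := by linear_combination hp''
      rw [this]
      exact sub_mem (sub_mem (degreeLT_le (by omega) hp) (mul_mem_degreeLT hG hZ (by omega)))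
        (degreeLT_le (by omega) hV)
    · rintro ⟨U, hU, V, hV, Z, hZ, rfl⟩
      exact ⟨Z, hZ, V, degreeLT_le (by omega) hV, Q * U - H * V, by linear_combination -V * h⟩
  · have key : ∀ q : R[X], L.mkQ (q %ₘ P) = L.mkQ q := fun q => by
      rw [Submodule.mkQ_apply, Submodule.mkQ_apply, Submodule.Quotient.eq, hL]
      exact ⟨0, zero_mem _, 0, zero_mem _, - (q /ₘ P), by
        linear_combination -modByMonic_add_div q P⟩
    ext y
    constructor
    · rintro ⟨p, hp, rfl⟩
      refine ⟨(G * p) %ₘ P, degreeLT_le (by omega) (modByMonic_mem_degreeLT hP hPd _), ?_⟩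
      rw [LinearMap.comp_apply, LinearMap.mulLeft_apply, Submodule.mkQ_apply, Submodule.mkQ_apply,
        Submodule.Quotient.eq, hL]
      exact ⟨0, zero_mem _, 0, zero_mem _, - Q * ((G * p) /ₘ P) - H * p, by
        linear_combination -Q * modByMonic_add_div (G * p) P - p * h⟩
    · rintro ⟨p, hp, rfl⟩
      exact ⟨(Q * p) %ₘ P, degreeLT_le (by omega) (modByMonic_mem_degreeLT hP hPd _), key _⟩

/-- Subresultants of large index do not depend on the constant terms. -/
theorem psIdeal_shift {A B : R[X]} {a b : R} {d j : ℕ} (hA : A ∈ degreeLT R (d + 1))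
    (hB : B ∈ degreeLT R (d + 1)) (hj : j ≤ d) (hdj : d ≤ 2 * j + 1) :
    psIdeal (X * A + C a) (X * B + C b) (d + 1) (j + 1) = psIdeal A B d j := by
  have hX : (X : R[X]).Monic := monic_X
  have hXd : (X : R[X]).natDegree = 1 := natDegree_X
  have hC : ∀ a : R, C a ∈ degreeLT R 1 := fun a => by
    rw [mem_degreeLT_coeff]; intro i hi; rw [coeff_C, if_neg (by omega)]
  have hm : ∀ A ∈ degreeLT R (d + 1), ∀ a, X * A + C a ∈ degreeLT R (d + 1 + 1) := fun A hA a =>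
    add_mem (mul_mem_degreeLT (Monic.mem_degreeLT_succ hXd) hA (by omega))
      (degreeLT_le (by omega) (hC a))
  have e : d + 1 - (j + 1) = d - j := by omega
  -- Multiplication by X identifies the cokernels: a U + b V has degree < d - j ≤ j + 1, so it falls
  -- in the discarded degrees.
  set L := sylSub (X * A + C a) (X * B + C b) (d - j) (j + 1) with hL
  refine psIdeal_eq_of_maps (by omega) hj (hm A hA a) (hm B hB b) hA hB L.mkQ
    (L.mkQ ∘ₗ LinearMap.mulLeft R X) ?_ ?_ ?_
  · intro p _; simp [hL, e]
  · intro p hp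
    rw [LinearMap.comp_apply, Submodule.mkQ_apply, Submodule.Quotient.mk_eq_zero, hL, mem_sylSub,
      mem_sylSub, LinearMap.mulLeft_apply]
    constructor
    · rintro ⟨U, hU, V, hV, Z, hZ, h⟩
      refine ⟨U, hU, V, hV, p - (A * U + B * V), ?_, by ring⟩
      rw [← monic_mul_mem_iff hX hXd]
      have : X * (p - (A * U + B * V)) = C a * U + C b * V + Z := by linear_combination -h
      rw [this]
      exact add_mem (add_mem (mul_mem_degreeLT (hC a) hU (by omega))
        (mul_mem_degreeLT (hC b) hV (by omega))) (degreeLT_le (by omega) hZ)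
    · rintro ⟨U, hU, V, hV, Z, hZ, rfl⟩
      refine ⟨U, hU, V, hV, X * Z - C a * U - C b * V, ?_, by ring⟩
      exact sub_mem (sub_mem (degreeLT_le (by omega) ((monic_mul_mem_iff hX hXd).2 hZ))
        (mul_mem_degreeLT (hC a) hU (by omega))) (mul_mem_degreeLT (hC b) hV (by omega))
  · apply le_antisymm
    · rintro _ ⟨y, hy, rfl⟩
      have hyd := modByMonic_add_div y (X : R[X])
      refine ⟨y /ₘ X, ?_, ?_⟩
      · rw [SetLike.mem_coe, ← monic_mul_mem_iff hX hXd]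
        have : X * (y /ₘ X) = y - y %ₘ X := by rw [eq_sub_iff_add_eq, add_comm]; exact hyd
        rw [this]
        exact sub_mem (degreeLT_le (by omega) hy)
          (degreeLT_le (by omega) (modByMonic_mem_degreeLT hX hXd y))
      · rw [LinearMap.comp_apply, LinearMap.mulLeft_apply, Submodule.mkQ_apply,
          Submodule.mkQ_apply, eq_comm, Submodule.Quotient.eq]
        have : y - X * (y /ₘ X) = y %ₘ X := by rw [sub_eq_iff_eq_add]; exact hyd.symm
        rw [this]
        exact Submodule.mem_sup_right (degreeLT_le (by omega) (modByMonic_mem_degreeLT hX hXd y))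
    · rintro _ ⟨w, hw, rfl⟩
      exact ⟨X * w, degreeLT_le (by omega) ((monic_mul_mem_iff hX hXd).2 hw), rfl⟩

omit [Nontrivial R] in
-- The perturbation b V has degree < d - j ≤ j, so it is discarded.
theorem psIdeal_add_C {A B : R[X]} {d j : ℕ} (hA : A ∈ degreeLT R (d + 1))
    (hB : B ∈ degreeLT R (d + 1)) (hj : j ≤ d) (hdj : d ≤ 2 * j) (b : R) :
    psIdeal A (B + C b) d j = psIdeal A B d j := by
  have hC : ∀ b : R, C b ∈ degreeLT R 1 := fun b => by
    rw [mem_degreeLT_coeff]; intro i hi; rw [coeff_C, if_neg (by omega)]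
  refine psIdeal_eq_of_sylSub_eq hj hA (add_mem hB (degreeLT_le (by omega) (hC b))) hA hB ?_
  have : ∀ B b, sylSub A (B + C b) (d - j) j ≤ sylSub A B (d - j) j := by
    intro B b p hp
    obtain ⟨U, hU, V, hV, Z, hZ, rfl⟩ := mem_sylSub.1 hp
    exact mem_sylSub.2 ⟨U, hU, V, hV, C b * V + Z,
      add_mem (mul_mem_degreeLT (hC b) hV (by omega)) hZ, by ring⟩
  refine le_antisymm (this B b) ?_
  have h := this (B + C b) (- b)
  rwa [C_neg, add_neg_cancel_right] at h

omit [Nontrivial R] in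
theorem psIdeal_add_left {A B : R[X]} {d j : ℕ} (hA : A ∈ degreeLT R (d + 1))
    (hB : B ∈ degreeLT R (d + 1)) (hj : j ≤ d) :
    psIdeal A (A + B) d j = psIdeal A B d j := by
  refine psIdeal_eq_of_sylSub_eq hj hA (add_mem hA hB) hA hB ?_
  ext p
  rw [mem_sylSub, mem_sylSub]
  constructor
  · rintro ⟨U, hU, V, hV, Z, hZ, rfl⟩
    exact ⟨U + V, add_mem hU hV, V, hV, Z, hZ, by ring⟩
  · rintro ⟨U, hU, V, hV, Z, hZ, rfl⟩
    exact ⟨U - V, sub_mem hU hV, V, hV, Z, hZ, by ring⟩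

end Duality

theorem BijOn.sep {α β : Type*} {f : α → β} {s : Set α} {t : Set β} (h : Set.BijOn f s t)
    {p : α → Prop} {q : β → Prop} (hpq : ∀ x ∈ s, p x ↔ q (f x)) :
    Set.BijOn f {x | x ∈ s ∧ p x} {y | y ∈ t ∧ q y} := by
  refine ⟨fun x hx => ⟨h.mapsTo hx.1, (hpq x hx.1).1 hx.2⟩, h.injOn.mono fun x hx => hx.1, ?_⟩
  rintro y ⟨hy, hq⟩
  obtain ⟨x, hx, rfl⟩ := h.surjOn hy
  exact ⟨x, ⟨hx, (hpq x hx).2 hq⟩, rfl⟩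

/-! ### Residual degrees, over a field. -/

section Reduction

theorem map_mem_degreeLT {R S : Type*} [CommRing R] [CommRing S] (f : R →+* S) {p : R[X]} {n : ℕ}
    (hp : p ∈ degreeLT R n) : p.map f ∈ degreeLT S n := by
  rw [mem_degreeLT_coeff] at *
  intro i hi
  rw [coeff_map, hp i hi, map_zero]

theorem IsStep.map {R S : Type*} [CommRing R] [CommRing S] [Nontrivial S] (f : R →+* S)
    {P Q P' Q' B T : R[X]} {k e : ℕ} (h : IsStep P Q P' Q' k B T e) :
    IsStep (P.map f) (Q.map f) (P'.map f) (Q'.map f) k (B.map f) (T.map f) e where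
  hP := h.hP.map f
  dP := by rw [h.hP.natDegree_map, h.dP]
  dQ := map_mem_degreeLT f h.dQ
  dP' := map_mem_degreeLT f h.dP'
  det := by
    rw [← Polynomial.map_mul, ← Polynomial.map_mul, ← Polynomial.map_sub, h.det, Polynomial.map_one]
  hS := h.hS.map f
  dS := by rw [h.hS.natDegree_map, h.dS]
  dT := map_mem_degreeLT f h.dT
  hk := h.hk

variable {K : Type*} [Field K]

theorem IsStep.Q'_eq_zero {P Q P' Q' S T : K[X]} {k e : ℕ} (h : IsStep P Q P' Q' k S T e)
    (hQ : Q.degree = 0) : Q' = 0 := by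
  apply eq_zero_of_mem_degreeLT_zero
  rw [← monic_mul_mem_iff h.hP h.dP]
  have hQ1 : Q ∈ degreeLT K 1 := by rw [mem_degreeLT, hQ]; exact_mod_cast Nat.zero_lt_one
  have : P * Q' = 1 + P' * Q := by rw [← h.det]; ring
  rw [this]
  have := h.hk
  exact add_mem (degreeLT_le (by omega) mem_degreeLT_one) (mul_mem_degreeLT h.dP' hQ1 (by omega))

/-- Let A and C be the transformed pair. If deg C = e, then A Q' = S + P' C has degree < deg A,
which forces Q' = 0, and the determinant makes Q a unit. -/
theorem IsStep.degree_eq_iff {P Q P' Q' S T : K[X]} {k e : ℕ} (h : IsStep P Q P' Q' k S T e) :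
    (Q * S + Q' * T).degree = e ↔ Q.degree = 0 := by
  have hk := h.hk
  constructor
  · intro hC
    have hC1 : Q * S + Q' * T ∈ degreeLT K (e + 1) := by
      rw [mem_degreeLT, hC]; exact_mod_cast Nat.lt_succ_self e
    have hQ' : Q' = 0 := by
      apply eq_zero_of_mem_degreeLT_zero
      rw [← monic_mul_mem_iff h.A_monic h.A_natDegree]
      have : (P * S + P' * T) * Q' = S + P' * (Q * S + Q' * T) := by linear_combination S * h.det
      rw [this]
      exact add_mem (degreeLT_le (by omega) (Monic.mem_degreeLT_succ h.dS))
        (mul_mem_degreeLT h.dP' hC1 (by omega))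
    have hu : Q * (-P') = 1 := by rw [← h.det, hQ']; ring
    exact degree_eq_zero_of_isUnit (IsUnit.of_mul_eq_one _ hu)
  · intro hQ
    rw [h.Q'_eq_zero hQ, zero_mul, add_zero, degree_mul, hQ, zero_add,
      degree_eq_natDegree h.hS.ne_zero, h.dS]

/-- Dividing by A, then by C, leaves a remainder of degree < e, so the Sylvester map is onto. -/
theorem psIdeal_eq_top_of_degree {A C : K[X]} {d e : ℕ} (hA : A.Monic) (hAd : A.natDegree = d)
    (hC : C.degree = e) (hed : e < d) : psIdeal A C d e = ⊤ := by
  have hC0 : C ≠ 0 := by rintro rfl; simp at hC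
  have hCd : C.natDegree = e := natDegree_eq_of_degree_eq_some hC
  rw [psIdeal_eq_top_iff hed.le (Monic.mem_degreeLT_succ hAd)
    (degreeLT_le (by omega) (Monic.mem_degreeLT_succ hCd))]
  intro y hy
  have h1 := modByMonic_add_div y A
  have hy1 := modByMonic_mem_degreeLT hA hAd y
  set y1 := y %ₘ A
  have hu : y /ₘ A ∈ degreeLT K (d - e) := by
    rw [← monic_mul_mem_iff hA hAd]
    have : A * (y /ₘ A) = y - y1 := by rw [eq_sub_iff_add_eq, add_comm]; exact h1
    rw [this]
    exact sub_mem (degreeLT_le (by omega) hy) (degreeLT_le (by omega) hy1)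
  have hlc : C.leadingCoeff ≠ 0 := leadingCoeff_ne_zero.2 hC0
  set C₁ := C * Polynomial.C C.leadingCoeff⁻¹ with hC₁
  have hCm : C₁.Monic := monic_mul_leadingCoeff_inv hC0
  have hC₁d : C₁.natDegree = e := by
    rw [hC₁, natDegree_mul_leadingCoeff_inv _ hC0, hCd]
  have h2 := modByMonic_add_div y1 C₁
  have hz := modByMonic_mem_degreeLT hCm hC₁d y1
  have hv : y1 /ₘ C₁ ∈ degreeLT K (d - e) := by
    rw [← monic_mul_mem_iff hCm hC₁d]
    have : C₁ * (y1 /ₘ C₁) = y1 - y1 %ₘ C₁ := by rw [eq_sub_iff_add_eq, add_comm]; exact h2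
    rw [this]
    exact sub_mem (degreeLT_le (by omega) hy1) (degreeLT_le (by omega) hz)
  refine mem_sylSub.2 ⟨_, hu, Polynomial.C C.leadingCoeff⁻¹ * (y1 /ₘ C₁), ?_, _, hz, ?_⟩
  · exact mul_mem_degreeLT (a := 1) (by
      rw [mem_degreeLT_coeff]; intro i hi; rw [coeff_C, if_neg (by omega)]) hv (by omega)
  · linear_combination h1 + h2

end Reduction

/-! ### Pairs over a local ring, sorted by residual degree. -/

section Local

variable {R : Type*} [CommRing R] [IsLocalRing R]

/-- Pairs in `monicLow R d` whose second component has residual degree `e`. -/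
def redPairs (R : Type*) [CommRing R] [IsLocalRing R] (d : ℕ) (e : WithBot ℕ) :
    Set (R[X] × R[X]) :=
  {x | x ∈ monicLow R d ∧ (x.2.map (residue R)).degree = e}

theorem psIdeal_eq_top_of_mem_redPairs {d e : ℕ} (he : e < d) {x : R[X] × R[X]}
    (hx : x ∈ redPairs R d e) : psIdeal x.1 x.2 d e = ⊤ := by
  obtain ⟨hm, hd⟩ := monic_of_sub_mem hx.1.1
  have := psIdeal_eq_top_of_degree (hm.map (residue R)) (by rw [hm.natDegree_map, hd]) hx.2 he
  rw [psIdeal, principalSubresultant_map, Ideal.span_singleton_eq_top] at this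
  rw [psIdeal, Ideal.span_singleton_eq_top]
  exact isUnit_of_map_unit _ _ this

theorem redPairs_zero_subset {k : ℕ} (hk : 1 ≤ k) : redPairs R k 0 ⊆ coprimePairs R k := by
  intro x hx
  have h := psIdeal_eq_top_of_mem_redPairs (e := 0) (by omega) hx
  rw [degreeLT_mem_of_psIdeal_eq_top (Nat.zero_le _) hx.1] at h
  obtain ⟨U, -, V, -, Z, hZ, h1⟩ := mem_sylSub.1 (h (degreeLT_le (by omega) mem_degreeLT_one))
  rw [eq_zero_of_mem_degreeLT_zero hZ, add_zero] at h1
  exact mem_coprimePairs hx.1 h1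

/-- Residual degree e makes the e-th principal subresultant a unit, so the pair factors; by
`IsStep.degree_eq_iff` over the residue field, the factors that occur are those with Q residually a
nonzero constant. -/
theorem bijOn_compPair_redPairs {k e : ℕ} (hk : 1 ≤ k) :
    Set.BijOn (compPair k) (redPairs R k 0 ×ˢ monicLow R e) (redPairs R (k + e) e) := by
  have h := BijOn.sep (bijOn_compPair (R := R) (e := e) hk)
    (p := fun x => (x.1.2.map (residue R)).degree = 0)
    (q := fun y => (y.2.map (residue R)).degree = e) (by
      rintro ⟨x, y⟩ ⟨hx, hy⟩
      have := ((isStep_bezout hk hx hy).map (residue R)).degree_eq_iff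
      rw [← this]
      simp only [compPair, Polynomial.map_add, Polynomial.map_mul])
  convert h using 1
  · ext ⟨x, y⟩
    constructor
    · rintro ⟨hx, hy⟩
      exact ⟨⟨redPairs_zero_subset hk hx, hy⟩, hx.2⟩
    · rintro ⟨⟨hx, hy⟩, hx'⟩
      exact ⟨⟨hx.1, hx'⟩, hy⟩
  · ext x
    constructor
    · intro hx
      exact ⟨⟨hx.1, psIdeal_eq_top_of_mem_redPairs (by omega) hx⟩, hx.2⟩
    · rintro ⟨⟨hx, -⟩, hx'⟩
      exact ⟨hx, hx'⟩

/-- Replace `(P, Q)` by `(P, Q⁻¹ mod P)`. -/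
noncomputable def dualPair (k : ℕ) (x : R[X] × R[X]) : R[X] × R[X] := (x.1, -(bezout k x).1)

/-- Residually Q' = 0, so -P' is inverse to Q and is again a nonzero constant. The Bézout identity
is symmetric in Q and -P', whence an involution. -/
theorem dualPair_spec {k : ℕ} (hk : 1 ≤ k) {x : R[X] × R[X]} (hx : x ∈ redPairs R k 0) :
    dualPair k x ∈ redPairs R k 0 ∧ dualPair k (dualPair k x) = x := by
  have hc := redPairs_zero_subset hk hx
  have hb := isBezout_bezout hc
  have h1 : (((X : R[X]) ^ 0 - 0), (0 : R[X])) ∈ monicLow R 0 :=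
    ⟨by simp, zero_mem _⟩
  have hst := (isStep_bezout hk hc h1).map (residue R)
  have hQ' := hst.Q'_eq_zero hx.2
  have hu : (-(bezout k x).1).map (residue R) * x.2.map (residue R) = 1 := by
    have := hst.det
    rw [hQ'] at this
    rw [← this, Polynomial.map_neg]
    ring
  have hmem : dualPair k x ∈ redPairs R k 0 :=
    ⟨⟨hx.1.1, neg_mem hb.1⟩, degree_eq_zero_of_isUnit (IsUnit.of_mul_eq_one _ hu)⟩
  refine ⟨hmem, ?_⟩
  have hb' : IsBezout (dualPair k x) k (-x.2, (bezout k x).2) := by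
    refine ⟨neg_mem hx.1.2, ?_⟩
    rw [← hb.2]
    simp only [dualPair]
    ring
  have := IsBezout.unique hmem.1 (isBezout_bezout (redPairs_zero_subset hk hmem)) hb'
  rw [dualPair, this]
  simp [dualPair]

theorem bijOn_dualPair {k : ℕ} (hk : 1 ≤ k) :
    Set.BijOn (dualPair k) (redPairs R k 0) (redPairs R k 0) :=
  Set.InvOn.bijOn (f' := dualPair k)
    ⟨fun _ hx => (dualPair_spec hk hx).2, fun _ hx => (dualPair_spec hk hx).2⟩
    (fun _ hx => (dualPair_spec hk hx).1) fun _ hx => (dualPair_spec hk hx).1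

theorem psIdeal_dualPair {k m : ℕ} (hk : 1 ≤ k) (hm : m ≤ k) {x : R[X] × R[X]}
    (hx : x ∈ redPairs R k 0) :
    psIdeal x.1 x.2 k m = psIdeal (dualPair k x).1 (dualPair k x).2 k (k - m) := by
  have hb := isBezout_bezout (redPairs_zero_subset hk hx)
  obtain ⟨h1, h2⟩ := monic_of_sub_mem hx.1.1
  refine psIdeal_dual (H := (bezout k x).2) hm h1 h2 hx.1.2 (neg_mem hb.1) ?_
  rw [← hb.2]; simp only [dualPair]; ring

/-- Number of pairs in `redPairs` whose `j`-th principal subresultant lies in `I`. -/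
noncomputable def redCount (R : Type*) [CommRing R] [IsLocalRing R] (d : ℕ) (e : WithBot ℕ) (j : ℕ)
    (I : Ideal R) : ℕ :=
  {x | x ∈ redPairs R d e ∧ psIdeal x.1 x.2 d j ≤ I}.ncard

/-- Number of pairs whose `j`-th principal subresultant lies in `I`. -/
noncomputable def pairCount (R : Type*) [CommRing R] (d j : ℕ) (I : Ideal R) : ℕ :=
  {x | x ∈ monicLow R d ∧ psIdeal x.1 x.2 d j ≤ I}.ncard

/-- The condition bears on only one factor of the factorization, (S, T) here and (P, Q) in
`redCount_high`; the other factor is free. -/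
theorem redCount_low {k e j : ℕ} (hk : 1 ≤ k) (hj : j ≤ e) (I : Ideal R) :
    redCount R (k + e) e j I = (redPairs R k 0).ncard * pairCount R e j I := by
  have h := BijOn.sep (bijOn_compPair_redPairs (R := R) (e := e) hk)
    (p := fun x => psIdeal x.2.1 x.2.2 e j ≤ I)
    (q := fun y => psIdeal y.1 y.2 (k + e) j ≤ I) (by
      rintro ⟨x, y⟩ ⟨hx, hy⟩
      rw [← (isStep_bezout hk (redPairs_zero_subset hk hx) hy).psIdeal_eq_low hj]; rfl)
  rw [redCount, ← h.ncard_eq, pairCount, ← Set.ncard_prod]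
  congr 1
  ext ⟨x, y⟩
  exact and_assoc

theorem redCount_high {k e j : ℕ} (hk : 1 ≤ k) (hej : e ≤ j) (hj : j ≤ k + e) (I : Ideal R) :
    redCount R (k + e) e j I = redCount R k 0 (j - e) I * (monicLow R e).ncard := by
  have h := BijOn.sep (bijOn_compPair_redPairs (R := R) (e := e) hk)
    (p := fun x => psIdeal x.1.1 x.1.2 k (j - e) ≤ I)
    (q := fun y => psIdeal y.1 y.2 (k + e) j ≤ I) (by
      rintro ⟨x, y⟩ ⟨hx, hy⟩
      rw [← (isStep_bezout hk (redPairs_zero_subset hk hx) hy).psIdeal_eq_high hej hj]; rfl)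
  rw [redCount, ← h.ncard_eq, redCount, ← Set.ncard_prod]
  congr 1
  ext ⟨x, y⟩
  exact and_right_comm

theorem redCount_dual {k m : ℕ} (hk : 1 ≤ k) (hm : m ≤ k) (I : Ideal R) :
    redCount R k 0 m I = redCount R k 0 (k - m) I :=
  (BijOn.sep (bijOn_dualPair hk) fun x hx => by rw [psIdeal_dualPair hk hm hx]).ncard_eq

/-- Adding a constant to the second component. -/
theorem ncard_add_const {k j : ℕ} (hk : 1 ≤ k) (hj : j ≤ k) (hkj : k ≤ 2 * j) (I : Ideal R)
    (U : Set R) :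
    {x : R[X] × R[X] | (x ∈ monicLow R k ∧ (x.2 - C (x.2.coeff 0)).map (residue R) = 0 ∧
      x.2.coeff 0 ∈ U) ∧ psIdeal x.1 x.2 k j ≤ I}.ncard =
    {x : R[X] × R[X] | (x ∈ monicLow R k ∧ x.2.map (residue R) = 0 ∧ x.2.coeff 0 = 0) ∧
      psIdeal x.1 x.2 k j ≤ I}.ncard * U.ncard := by
  rw [← Set.ncard_prod]
  symm
  apply Set.BijOn.ncard_eq (f := fun x : (R[X] × R[X]) × R => (x.1.1, x.1.2 + C x.2))
  have hC : ∀ a : R, C a ∈ degreeLT R k := fun a => by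
    rw [mem_degreeLT_coeff]; intro i hi; rw [coeff_C, if_neg (by omega)]
  have hps : ∀ x ∈ monicLow R k, ∀ a, psIdeal x.1 (x.2 + C a) k j = psIdeal x.1 x.2 k j :=
    fun x hx a => psIdeal_add_C (Monic.mem_degreeLT_succ (monic_of_sub_mem hx.1).2)
      (degreeLT_le (Nat.le_succ _) hx.2) hj hkj a
  refine ⟨?_, ?_, ?_⟩
  · rintro ⟨x, a⟩ ⟨⟨⟨h1, h2, h3⟩, h4⟩, h5⟩
    refine ⟨⟨⟨h1.1, add_mem h1.2 (hC a)⟩, ?_, ?_⟩, ?_⟩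
    · simpa [h3] using h2
    · simpa [h3] using h5
    · rw [← hps x h1 a] at h4; exact h4
  · rintro ⟨x, a⟩ ⟨⟨⟨h1, h2, h3⟩, h4⟩, h5⟩ ⟨x', a'⟩ ⟨⟨⟨h1', h2', h3'⟩, h4'⟩, h5'⟩ h
    simp only [Prod.mk.injEq] at h
    have ha : a = a' := by
      have := congrArg (fun p => coeff p 0) h.2
      simpa [h3, h3'] using this
    subst ha
    have := add_right_cancel h.2
    exact Prod.ext (Prod.ext h.1 this) rfl
  · rintro x ⟨⟨h1, h2, h3⟩, h4⟩
    refine ⟨((x.1, x.2 - C (x.2.coeff 0)), x.2.coeff 0), ⟨⟨⟨⟨h1.1, sub_mem h1.2 (hC _)⟩, h2, ?_⟩, ?_⟩,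
      h3⟩, ?_⟩
    · simp
    · have := hps (x.1, x.2 - C (x.2.coeff 0)) ⟨h1.1, sub_mem h1.2 (hC _)⟩ (x.2.coeff 0)
      dsimp only at this
      rw [sub_add_cancel] at this
      dsimp only
      rwa [← this]
    · simp

/-- For k ≤ 2j the constant term of the second component does not matter, so the two counts differ
only by the number of allowed constant terms: the units, or the maximal ideal. -/
theorem redCount_const {k j : ℕ} (hk : 1 ≤ k) (hj : j ≤ k) (hkj : k ≤ 2 * j) (I : Ideal R) :
    redCount R k 0 j I * (maximalIdeal R : Set R).ncard =
      redCount R k ⊥ j I * {x : R | IsUnit x}.ncard := by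
  have h0 : redCount R k 0 j I = {x : R[X] × R[X] | (x ∈ monicLow R k ∧
      (x.2 - C (x.2.coeff 0)).map (residue R) = 0 ∧
      x.2.coeff 0 ∈ {x : R | IsUnit x}) ∧ psIdeal x.1 x.2 k j ≤ I}.ncard := by
    rw [redCount]
    congr 1
    ext x
    refine and_congr_left' (and_congr_right' ?_)
    constructor
    · intro h
      have h1 := eq_C_of_degree_eq_zero h
      refine ⟨?_, ?_⟩
      · rw [Polynomial.map_sub, h1, map_C, coeff_map, sub_self]
      · refine (residue_ne_zero_iff_isUnit _).1 fun h0 => ?_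
        rw [coeff_map, h0, C_0] at h1
        rw [h1, degree_zero] at h
        exact absurd h (by decide)
    · rintro ⟨h1, h2⟩
      rw [Polynomial.map_sub, sub_eq_zero] at h1
      rw [h1, map_C, degree_C ((residue_ne_zero_iff_isUnit _).2 h2)]
  have h1 : redCount R k ⊥ j I = {x : R[X] × R[X] | (x ∈ monicLow R k ∧
      (x.2 - C (x.2.coeff 0)).map (residue R) = 0 ∧
      x.2.coeff 0 ∈ (maximalIdeal R : Set R)) ∧ psIdeal x.1 x.2 k j ≤ I}.ncard := by
    rw [redCount]
    congr 1
    ext x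
    refine and_congr_left' (and_congr_right' ?_)
    rw [degree_eq_bot, SetLike.mem_coe, ← residue_eq_zero_iff, Polynomial.map_sub, map_C]
    constructor
    · intro h
      have : residue R (x.2.coeff 0) = 0 := by rw [← coeff_map, h, coeff_zero]
      rw [h, this]; simp
    · rintro ⟨h1, h2⟩
      rwa [h2, C_0, sub_zero] at h1
  rw [h0, h1, ncard_add_const hk hj hkj I, ncard_add_const hk hj hkj I]
  ring

end Local

/-! ### Counting over a finite local ring with principal maximal ideal. -/

section Counting

variable {R : Type*} [CommRing R]

/-- The polynomial `c_{d-1} X ^ (d-1) + ⋯ + c_0`. -/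
noncomputable def lowPoly {d : ℕ} (c : Fin d → R) : R[X] := ∑ i : Fin d, C (c i) * X ^ (i : ℕ)

theorem coeff_lowPoly {d : ℕ} (c : Fin d → R) (i : Fin d) : (lowPoly c).coeff i = c i := by
  rw [lowPoly, finsetSum_coeff, Finset.sum_eq_single i]
  · simp
  · intro b _ hb
    rw [coeff_C_mul, coeff_X_pow, if_neg (fun h => hb (Fin.ext h.symm)), mul_zero]
  · simp

theorem lowPoly_mem {d : ℕ} (c : Fin d → R) : lowPoly c ∈ degreeLT R d :=
  Submodule.sum_mem _ fun i _ => mem_degreeLT.2 <|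
    (degree_C_mul_X_pow_le _ _).trans_lt (by exact_mod_cast i.2)

theorem lowPoly_coeff {d : ℕ} {p : R[X]} (hp : p ∈ degreeLT R d) :
    lowPoly (fun i : Fin d => p.coeff i) = p := by
  ext i
  rcases lt_or_ge i d with h | h
  · exact coeff_lowPoly (fun i : Fin d => p.coeff i) ⟨i, h⟩
  · rw [mem_degreeLT_coeff.1 hp i h, mem_degreeLT_coeff.1 (lowPoly_mem _) i h]

theorem lowPoly_injective (d : ℕ) : Function.Injective (lowPoly (R := R) (d := d)) := by
  intro a b h
  ext i
  rw [← coeff_lowPoly a, h, coeff_lowPoly]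

theorem monicPoly_eq {d : ℕ} (a : Fin d → R) : monicPoly a = X ^ d + lowPoly a := rfl

theorem bijOn_lowPoly (d : ℕ) (J : Set R) (hJ : 0 ∈ J) :
    Set.BijOn (lowPoly (R := R) (d := d)) {c | ∀ i, c i ∈ J}
      {p | p ∈ degreeLT R d ∧ ∀ i, p.coeff i ∈ J} := by
  refine ⟨fun c hc => ⟨lowPoly_mem c, fun i => ?_⟩, (lowPoly_injective d).injOn, ?_⟩
  · rcases lt_or_ge i d with h | h
    · exact (coeff_lowPoly c ⟨i, h⟩).symm ▸ hc _
    · rwa [mem_degreeLT_coeff.1 (lowPoly_mem c) i h]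
  · rintro p ⟨hp, hpJ⟩
    exact ⟨fun i => p.coeff i, fun i => hpJ i, lowPoly_coeff hp⟩

theorem ncard_degreeLT (d : ℕ) (J : Set R) (hJ : 0 ∈ J) :
    {p | p ∈ degreeLT R d ∧ ∀ i, p.coeff i ∈ J}.ncard = J.ncard ^ d := by
  rw [← (bijOn_lowPoly d J hJ).ncard_eq]
  have : Nat.card (Fin d → J) = J.ncard ^ d := by
    rw [Nat.card_fun, Nat.card_fin, ← Nat.card_coe_set_eq]
  rw [← this, ← Nat.card_coe_set_eq]
  exact Nat.card_congr (Equiv.subtypePiEquivPi (p := fun _ x => x ∈ J))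

theorem bijOn_pairs (d : ℕ) :
    Set.BijOn (fun x : Pairs R d => (monicPoly x.1, lowPoly x.2)) Set.univ (monicLow R d) := by
  refine ⟨fun x _ => ⟨?_, lowPoly_mem _⟩, ?_, ?_⟩
  · dsimp only
    rw [monicPoly_eq, add_sub_cancel_left]; exact lowPoly_mem _
  · rintro ⟨a, b⟩ _ ⟨a', b'⟩ _ h
    simp only [Prod.mk.injEq, monicPoly_eq, add_right_inj] at h
    rw [lowPoly_injective d h.1, lowPoly_injective d h.2]
  · rintro ⟨P, Q⟩ ⟨h1, h2⟩
    refine ⟨(fun i => (P - X ^ d).coeff i, fun i => Q.coeff i), trivial, ?_⟩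
    simp only [monicPoly_eq]
    rw [lowPoly_coeff h1, lowPoly_coeff h2, add_sub_cancel]

theorem ncard_monicLow (R : Type*) [CommRing R] (d : ℕ) :
    (monicLow R d).ncard = Nat.card R ^ (2 * d) := by
  rw [← (bijOn_pairs d).ncard_eq, Set.ncard_univ, Nat.card_prod, Nat.card_fun, Nat.card_fin]
  ring

theorem finite_monicLow [Finite R] (d : ℕ) : (monicLow R d).Finite := by
  rw [← (bijOn_pairs d).image_eq]
  exact Set.finite_univ.image _

theorem ncard_eq_sum_fibers {α β : Type*} [DecidableEq β] {s : Set α} (hs : s.Finite) (f : α → β)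
    (t : Finset β) (h : ∀ x ∈ s, f x ∈ t) :
    s.ncard = ∑ b ∈ t, {x | x ∈ s ∧ f x = b}.ncard := by
  classical
  rw [Set.ncard_eq_toFinset_card _ hs,
    Finset.card_eq_sum_card_fiberwise (f := f) (t := t) (fun x hx => h x (hs.mem_toFinset.1 hx))]
  refine Finset.sum_congr rfl fun b _ => ?_
  rw [← Set.ncard_coe_finset]
  congr 1
  ext x
  simp

variable [IsLocalRing R] [Finite R]

theorem pairCount_eq_sum (d j : ℕ) (I : Ideal R) :
    pairCount R d j I = redCount R d ⊥ j I + ∑ e ∈ Finset.range d, redCount R d e j I := by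
  have hfin : {x | x ∈ monicLow R d ∧ psIdeal x.1 x.2 d j ≤ I}.Finite :=
    (finite_monicLow d).subset fun x hx => hx.1
  rw [pairCount, ncard_eq_sum_fibers hfin (fun x => (x.2.map (residue R)).degree)
    (insert ⊥ ((Finset.range d).image (fun e : ℕ => (e : WithBot ℕ))))]
  · rw [Finset.sum_insert (by simp), Finset.sum_image (by intro a _ b _ h; simpa using h)]
    congr 1
    · rw [redCount]; congr 1; ext x; exact and_right_comm
    · refine Finset.sum_congr rfl fun e _ => ?_
      rw [redCount]; congr 1; ext x; exact and_right_comm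
  · rintro x ⟨hx, -⟩
    have := mem_degreeLT.1 (map_mem_degreeLT (residue R) hx.2)
    rw [Finset.mem_insert, Finset.mem_image]
    rcases h : (x.2.map (residue R)).degree with _ | e
    · exact Or.inl rfl
    · rw [h] at this
      change WithBot.some e < _ at this
      rw [← Nat.cast_withBot] at this
      exact Or.inr ⟨e, Finset.mem_range.2 (by exact_mod_cast this), rfl⟩

/-- Data on a finite local ring with principal maximal ideal, behaving like a discrete valuation
ring up to the level `M`. -/
structure IsTruncated (R : Type*) [CommRing R] [IsLocalRing R] (ϖ : R) (q M : ℕ) : Prop where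
  max : maximalIdeal R = Ideal.span {ϖ}
  card : Nat.card (ResidueField R) = q
  cancel : ∀ n i : ℕ, ∀ x : R, i ≤ M →
    (ϖ ^ n * x ∈ Ideal.span {ϖ ^ i} ↔ x ∈ Ideal.span {ϖ ^ (i - n)})

namespace IsTruncated

variable {ϖ : R} {q M : ℕ} (h : IsTruncated R ϖ q M)

include h

omit [Finite R] in
theorem card_eq : Nat.card R = (maximalIdeal R : Set R).ncard * q := by
  rw [Submodule.card_eq_card_quotient_mul_card (maximalIdeal R), ← h.card,
    ← Nat.card_coe_set_eq]
  rfl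

theorem one_lt_q : 1 < q := by
  rw [← h.card]
  have : Finite (ResidueField R) := Finite.of_surjective _ residue_surjective
  exact Finite.one_lt_card

omit h in
theorem card_units : {x : R | IsUnit x}.ncard + (maximalIdeal R : Set R).ncard =
    Nat.card R := by
  have : {x : R | IsUnit x} = ((maximalIdeal R : Set R))ᶜ := by
    ext x; simp [mem_maximalIdeal]
  rw [this, add_comm, Set.ncard_add_ncard_compl]

/-- The quotient of R by this annihilator is isomorphic to ϖ R, the maximal ideal, whose index is q.
-/
theorem card_ann : {x : R | ϖ * x = 0}.ncard = q := by
  have h1 := Submodule.card_eq_card_quotient_mul_card (LinearMap.mulLeft R ϖ).ker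
  rw [Nat.card_congr (LinearMap.quotKerEquivRange (LinearMap.mulLeft R ϖ)).toEquiv, h.card_eq] at h1
  have h2 : ((LinearMap.mulLeft R ϖ).range : Set R) = (maximalIdeal R : Set R) := by
    ext x
    rw [h.max, SetLike.mem_coe, SetLike.mem_coe, Ideal.mem_span_singleton']
    simp [mul_comm]
  have h3 : Nat.card (LinearMap.mulLeft R ϖ).range = (maximalIdeal R : Set R).ncard := by
    rw [← h2, ← Nat.card_coe_set_eq]; rfl
  have h4 : Nat.card (LinearMap.mulLeft R ϖ).ker = {x : R | ϖ * x = 0}.ncard := by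
    rw [← Nat.card_coe_set_eq]; rfl
  rw [h3, h4, mul_comm] at h1
  have h5 : 0 < (maximalIdeal R : Set R).ncard :=
    (Set.ncard_pos (Set.toFinite _)).2 ⟨0, zero_mem _⟩
  exact (Nat.eq_of_mul_eq_mul_right h5 (by linarith)).symm

/-- A residually zero second component is ϖ times exactly q^d polynomials of degree < d, and
dividing by ϖ removes ϖ^(d-j) from the subresultant. For i ≤ d - j the truncated subtraction makes
the remaining condition void, as it should be. -/
theorem redCount_bot (d j i : ℕ) (hi : i ≤ M) :
    redCount R d ⊥ j (Ideal.span {ϖ ^ i}) * q ^ d =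
      pairCount R d j (Ideal.span {ϖ ^ (i - (d - j))}) := by
  have hsec : ∀ p : R[X], ∃ r : R[X], p ∈ degreeLT R d → p.map (residue R) = 0 →
      r ∈ degreeLT R d ∧ C ϖ * r = p := by
    intro p
    by_cases hp : p ∈ degreeLT R d ∧ p.map (residue R) = 0
    · have hc : ∀ i, ∃ y, ϖ * y = p.coeff i := fun i => by
        have : p.coeff i ∈ maximalIdeal R := by
          rw [← residue_eq_zero_iff, ← coeff_map, hp.2, coeff_zero]
        rw [h.max, Ideal.mem_span_singleton'] at this
        obtain ⟨y, hy⟩ := this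
        exact ⟨y, by rw [mul_comm, hy]⟩
      choose y hy using hc
      refine ⟨lowPoly fun i : Fin d => y i, fun _ _ => ⟨lowPoly_mem _, ?_⟩⟩
      conv_rhs => rw [← lowPoly_coeff hp.1]
      simp only [lowPoly, Finset.mul_sum, ← hy, C_mul, mul_assoc]
    · exact ⟨0, fun h1 h2 => absurd ⟨h1, h2⟩ hp⟩
  choose σ hσ using hsec
  have hps : ∀ x : R[X] × R[X], psIdeal x.1 (C ϖ * x.2) d j ≤ Ideal.span {ϖ ^ i} ↔
      psIdeal x.1 x.2 d j ≤ Ideal.span {ϖ ^ (i - (d - j))} := by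
    intro x
    rw [psIdeal_smul, psIdeal, Ideal.span_singleton_mul_span_singleton,
      Ideal.span_singleton_le_iff_mem, Ideal.span_singleton_le_iff_mem, h.cancel _ _ _ hi]
  rw [redCount, ← h.card_ann, ← ncard_degreeLT d {x : R | ϖ * x = 0} (by simp), ← Set.ncard_prod,
    pairCount]
  apply Set.BijOn.ncard_eq
    (f := fun x : (R[X] × R[X]) × R[X] => (x.1.1, σ x.1.2 + x.2))
  have hC : ∀ p : R[X], (∀ i, p.coeff i ∈ {x : R | ϖ * x = 0}) ↔ C ϖ * p = 0 := by
    intro p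
    constructor
    · intro hp; ext i; rw [coeff_C_mul, coeff_zero]; exact hp i
    · intro hp i; rw [Set.mem_ofPred_eq, ← coeff_C_mul, hp, coeff_zero]
  refine ⟨?_, ?_, ?_⟩
  · rintro ⟨x, κ⟩ ⟨⟨⟨hx, hx0⟩, hxI⟩, hκ, hκ0⟩
    rw [degree_eq_bot] at hx0
    obtain ⟨h1, h2⟩ := hσ _ hx.2 hx0
    rw [hC] at hκ0
    refine ⟨⟨hx.1, add_mem h1 hκ⟩, (hps _).1 ?_⟩
    simp only [mul_add, h2, hκ0, add_zero]
    exact hxI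
  · rintro ⟨x, κ⟩ ⟨⟨⟨hx, hx0⟩, hxI⟩, hκ, hκ0⟩ ⟨x', κ'⟩ ⟨⟨⟨hx', hx0'⟩, hxI'⟩, hκ', hκ0'⟩ heq
    rw [degree_eq_bot] at hx0 hx0'
    obtain ⟨h1, h2⟩ := hσ _ hx.2 hx0
    obtain ⟨h1', h2'⟩ := hσ _ hx'.2 hx0'
    rw [hC] at hκ0 hκ0'
    simp only [Prod.mk.injEq] at heq
    dsimp only at hκ0 hκ0' h2 h2'
    have e2 : x.2 = x'.2 := by
      have := congrArg (fun p => C ϖ * p) heq.2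
      simpa only [mul_add, h2, h2', hκ0, hκ0', add_zero] using this
    have exx : x = x' := Prod.ext heq.1 e2
    subst exx
    rw [add_left_cancel heq.2]
  · rintro x ⟨hx, hxI⟩
    have hm : (C ϖ * x.2).map (residue R) = 0 := by
      rw [Polynomial.map_mul, map_C, (residue_eq_zero_iff _).2
        (by rw [h.max]; exact Ideal.mem_span_singleton_self _), C_0, zero_mul]
    have hd : C ϖ * x.2 ∈ degreeLT R d := by
      rw [← smul_eq_C_mul]; exact Submodule.smul_mem _ _ hx.2
    obtain ⟨h1, h2⟩ := hσ _ hd hm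
    refine ⟨((x.1, C ϖ * x.2), x.2 - σ (C ϖ * x.2)), ⟨⟨⟨⟨hx.1, hd⟩, ?_⟩, (hps _).2 hxI⟩,
      sub_mem hx.2 h1, ?_⟩, ?_⟩
    · rw [degree_eq_bot]; exact hm
    · rw [hC, mul_sub, h2, sub_self]
    · simp

end IsTruncated

end Counting

/-! ### The recursion for the frequencies. -/

section Frequency

variable {R : Type*} [CommRing R] [Finite R]

/-- Proportion of the pairs whose `j`-th principal subresultant lies in `I`. -/
noncomputable def freq (R : Type*) [CommRing R] (d j : ℕ) (I : Ideal R) : ℝ :=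
  pairCount R d j I / (Nat.card R : ℝ) ^ (2 * d)

omit [Finite R] in
theorem pairCount_succ [Nontrivial R] {d j : ℕ} (hj : j ≤ d) (hdj : d ≤ 2 * j + 1) (I : Ideal R) :
    pairCount R (d + 1) (j + 1) I = pairCount R d j I * Nat.card R ^ 2 := by
  have : Nat.card R ^ 2 = (Set.univ : Set (R × R)).ncard := by
    rw [Set.ncard_univ, Nat.card_prod, sq]
  rw [pairCount, pairCount, this, ← Set.ncard_prod]
  symm
  apply Set.BijOn.ncard_eq (f := fun x : (R[X] × R[X]) × (R × R) =>
    (X * x.1.1 + C x.2.1, X * x.1.2 + C x.2.2))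
  have hX : (X : R[X]).Monic := monic_X
  have hXd : (X : R[X]).natDegree = 1 := natDegree_X
  have hC : ∀ a : R, C a ∈ degreeLT R (d + 1) := fun a => by
    rw [mem_degreeLT_coeff]; intro i hi; rw [coeff_C, if_neg (by omega)]
  have hXm : ∀ p : R[X], p ∈ degreeLT R d ↔ X * p ∈ degreeLT R (d + 1) := fun p => by
    rw [add_comm, monic_mul_mem_iff hX hXd]
  have hps : ∀ x ∈ monicLow R d, ∀ a b, psIdeal (X * x.1 + C a) (X * x.2 + C b) (d + 1) (j + 1) =
      psIdeal x.1 x.2 d j := fun x hx a b =>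
    psIdeal_shift (Monic.mem_degreeLT_succ (monic_of_sub_mem hx.1).2)
      (degreeLT_le (Nat.le_succ _) hx.2) hj hdj
  have hmem : ∀ x : R[X] × R[X], ∀ a b : R, x ∈ monicLow R d ↔
      (X * x.1 + C a, X * x.2 + C b) ∈ monicLow R (d + 1) := by
    intro x a b
    have e1 : X * x.1 + C a - X ^ (d + 1) = X * (x.1 - X ^ d) + C a := by ring
    simp only [monicLow, Set.mem_ofPred_eq, e1]
    rw [Submodule.add_mem_iff_left _ (hC a), Submodule.add_mem_iff_left _ (hC b), ← hXm, ← hXm]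
  refine ⟨?_, ?_, ?_⟩
  · rintro ⟨x, a, b⟩ ⟨⟨hx, hI⟩, -⟩
    exact ⟨(hmem x a b).1 hx, (hps x hx a b).trans_le hI⟩
  · rintro ⟨x, a, b⟩ ⟨⟨hx, hI⟩, -⟩ ⟨x', a', b'⟩ ⟨⟨hx', hI'⟩, -⟩ heq
    have key : ∀ (p p' : R[X]) (a a' : R), X * p + C a = X * p' + C a' → p = p' ∧ a = a' := by
      intro p p' a a' h
      refine ⟨?_, ?_⟩
      · ext n
        have := congrArg (fun p => coeff p (n + 1)) h
        simpa [coeff_C] using this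
      · have := congrArg (fun p => coeff p 0) h
        simpa using this
    simp only [Prod.mk.injEq] at heq
    obtain ⟨h1, h2⟩ := key _ _ _ _ heq.1
    obtain ⟨h3, h4⟩ := key _ _ _ _ heq.2
    exact Prod.ext (Prod.ext h1 h3) (Prod.ext h2 h4)
  · rintro y ⟨hy, hI⟩
    have e : (X * y.1.divX + C (y.1.coeff 0), X * y.2.divX + C (y.2.coeff 0)) = y :=
      Prod.ext (X_mul_divX_add _) (X_mul_divX_add _)
    have hx : (y.1.divX, y.2.divX) ∈ monicLow R d :=
      (hmem _ (y.1.coeff 0) (y.2.coeff 0)).2 (by dsimp only; rwa [e])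
    refine ⟨((y.1.divX, y.2.divX), (y.1.coeff 0, y.2.coeff 0)), ⟨⟨hx, ?_⟩, trivial⟩, e⟩
    rw [← hps _ hx (y.1.coeff 0) (y.2.coeff 0)]
    have e1 := congrArg Prod.fst e
    have e2 := congrArg Prod.snd e
    dsimp only at e1 e2 ⊢
    rw [e1, e2]
    exact hI

theorem freq_succ [Nontrivial R] {d j : ℕ} (hj : j ≤ d) (hdj : d ≤ 2 * j + 1) (I : Ideal R) :
    freq R (d + 1) (j + 1) I = freq R d j I := by
  have hN : (Nat.card R : ℝ) ≠ 0 := by exact_mod_cast Nat.card_pos.ne'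
  rw [freq, freq, pairCount_succ hj hdj]
  push_cast
  field_simp
  ring

theorem freq_top (d j : ℕ) : freq R d j ⊤ = 1 := by
  have hN : (Nat.card R : ℝ) ≠ 0 := by exact_mod_cast Nat.card_pos.ne'
  have : pairCount R d j ⊤ = Nat.card R ^ (2 * d) := by
    rw [← ncard_monicLow, pairCount]
    congr 1; ext x; simp
  rw [freq, this]
  push_cast
  exact div_self (pow_ne_zero _ hN)

omit [Finite R] in
theorem freq_self {d : ℕ} {I : Ideal R} (hI : I ≠ ⊤) : freq R d d I = 0 := by
  have : pairCount R d d I = 0 := by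
    have h0 : {x | x ∈ monicLow R d ∧ psIdeal x.1 x.2 d d ≤ I} = ∅ := by
      ext x
      simp [psIdeal_self, hI]
    rw [pairCount, h0, Set.ncard_empty]
  rw [freq, this, Nat.cast_zero, zero_div]

variable [IsLocalRing R] {ϖ : R} {q M : ℕ}

namespace IsTruncated

/-- A residually constant second component is traded for a residually zero one, with ratio |units| /
|maximal ideal| = q - 1, which is then divided by ϖ. -/
theorem redCount_zero (h : IsTruncated R ϖ q M) {k j i : ℕ} (hk : 1 ≤ k) (hj : j ≤ k)
    (hkj : k ≤ 2 * j) (hi : i ≤ M) :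
    (redCount R k 0 j (Ideal.span {ϖ ^ i}) : ℝ) =
      (q - 1) / q ^ k * pairCount R k j (Ideal.span {ϖ ^ (i - (k - j))}) := by
  have h1 := redCount_const hk hj hkj (Ideal.span {ϖ ^ i})
  have h2 := h.card_eq
  have h3 := card_units (R := R)
  have h5 : 0 < (maximalIdeal R : Set R).ncard :=
    (Set.ncard_pos (Set.toFinite _)).2 ⟨0, zero_mem _⟩
  have h6 := h.redCount_bot k j i hi
  have hq := h.one_lt_q
  rw [← h6]
  set m := (maximalIdeal R : Set R).ncard
  have hm : (m : ℝ) ≠ 0 := by exact_mod_cast h5.ne'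
  have hq0 : (q : ℝ) ≠ 0 := by exact_mod_cast (by omega : q ≠ 0)
  have hu : (({x : R | IsUnit x}.ncard : ℕ) : ℝ) = (q - 1) * m := by
    have : (({x : R | IsUnit x}.ncard : ℕ) : ℝ) + m = m * q := by
      rw [h2] at h3; exact_mod_cast h3
    linear_combination this
  have h1' : (redCount R k 0 j (Ideal.span {ϖ ^ i}) : ℝ) * m =
      redCount R k ⊥ j (Ideal.span {ϖ ^ i}) * ((q - 1) * m) := by
    rw [← hu]; exact_mod_cast h1
  have h7 := mul_right_cancel₀ hm (h1'.trans (mul_assoc _ _ _).symm)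
  rw [h7]
  push_cast
  field_simp

theorem ncard_redPairs_zero (h : IsTruncated R ϖ q M) {k : ℕ} (hk : 1 ≤ k) :
    ((redPairs R k 0).ncard : ℝ) = (q - 1) / q ^ k * (Nat.card R : ℝ) ^ (2 * k) := by
  have h1 := h.redCount_zero (i := 0) hk le_rfl (by omega) (Nat.zero_le _)
  have h2 : redCount R k 0 k (Ideal.span {ϖ ^ 0}) = (redPairs R k 0).ncard := by
    rw [redCount]; congr 1; ext x; simp
  have h3 : pairCount R k k (Ideal.span {ϖ ^ (0 - (k - k))}) = Nat.card R ^ (2 * k) := by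
    rw [← ncard_monicLow, pairCount]
    congr 1; ext x; simp
  rw [h2, h3] at h1
  rw [h1]; push_cast; rfl

/-- The second component is residually zero with frequency q^(-d), and of residual degree e with
frequency (q-1)/q^(d-e). For e < j, duality moves the index j - e of (P, Q) to d - j; the hypothesis
on d gives d - e ≤ 2(d - j), where `redCount_zero` applies, and the division by ϖ lowers i by j - e.
-/
theorem freq_rec (h : IsTruncated R ϖ q M) {d j i : ℕ} (hd : 2 * j + 1 ≤ d) (hi : i ≤ M) :
    freq R d j (Ideal.span {ϖ ^ i}) =
      freq R d j (Ideal.span {ϖ ^ (i - (d - j))}) / q ^ d +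
      ∑ e ∈ Finset.range d, (q - 1) / q ^ (d - e) *
        if j ≤ e then freq R e j (Ideal.span {ϖ ^ i})
          else freq R (d - e) (d - j) (Ideal.span {ϖ ^ (i - (j - e))}) := by
  have hq := h.one_lt_q
  have hq0 : (q : ℝ) ≠ 0 := by exact_mod_cast (by omega : q ≠ 0)
  have hN : (Nat.card R : ℝ) ≠ 0 := by exact_mod_cast Nat.card_pos.ne'
  have h1 := pairCount_eq_sum d j (Ideal.span {ϖ ^ i})
  have h2 := h.redCount_bot d j i hi
  have h1' : freq R d j (Ideal.span {ϖ ^ i}) =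
      redCount R d ⊥ j (Ideal.span {ϖ ^ i}) / (Nat.card R : ℝ) ^ (2 * d) +
      ∑ e ∈ Finset.range d, redCount R d e j (Ideal.span {ϖ ^ i}) / (Nat.card R : ℝ) ^ (2 * d) := by
    rw [freq, h1, ← Finset.sum_div, ← add_div]
    push_cast; rfl
  rw [h1']
  congr 1
  · rw [freq, ← h2]
    push_cast
    field_simp
  · refine Finset.sum_congr rfl fun e he => ?_
    rw [Finset.mem_range] at he
    obtain ⟨k, rfl⟩ : ∃ k, d = k + e := ⟨d - e, by omega⟩
    have hk : 1 ≤ k := by omega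
    rw [Nat.add_sub_cancel]
    split_ifs with hje
    · rw [redCount_low hk hje]
      push_cast
      rw [h.ncard_redPairs_zero hk, freq]
      field_simp
      ring
    · rw [redCount_high hk (by omega) (by omega), redCount_dual hk (by omega), ncard_monicLow]
      push_cast
      rw [h.redCount_zero hk (by omega) (by omega) hi, freq,
        show k - (k - (j - e)) = j - e by omega, show k - (j - e) = k + e - j by omega]
      field_simp
      ring

end IsTruncated

end Frequency

/-! ### The quotients of W by powers of its maximal ideal. -/

section Truncation

variable {W : Type*} [CommRing W] [IsDomain W] [IsDiscreteValuationRing W]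

/-- The truncation of `W` at level `M`. -/
abbrev Trunc (W : Type*) [CommRing W] [IsLocalRing W] (M : ℕ) : Type _ :=
  W ⧸ (maximalIdeal W ^ M)

theorem maximalIdeal_pow_eq {ϖ : W} (hϖ : Irreducible ϖ) (n : ℕ) :
    maximalIdeal W ^ n = Ideal.span {ϖ ^ n} := by
  rw [hϖ.maximalIdeal_eq, Ideal.span_singleton_pow]

theorem isLocalRing_trunc {M : ℕ} (hM : 1 ≤ M) : IsLocalRing (Trunc W M) := by
  have : Nontrivial (Trunc W M) := Ideal.Quotient.nontrivial_iff.2 fun h => by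
    have h1 := Ideal.pow_le_self (I := maximalIdeal W) (n := M) (by omega)
    rw [h, top_le_iff] at h1
    exact (maximalIdeal.isMaximal W).ne_top h1
  exact IsLocalRing.of_surjective' _ Ideal.Quotient.mk_surjective

theorem finite_trunc [Finite (ResidueField W)] (M : ℕ) : Finite (Trunc W M) := by
  have : Finite (W ⧸ maximalIdeal W) := ‹Finite (ResidueField W)›
  exact Ideal.finite_quotient_pow (IsNoetherian.noetherian _) M

theorem mk_mem_span_iff {ϖ : W} (hϖ : Irreducible ϖ) {i M : ℕ} (hi : i ≤ M) (y : W) :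
    Ideal.Quotient.mk (maximalIdeal W ^ M) y ∈
      Ideal.span {Ideal.Quotient.mk (maximalIdeal W ^ M) ϖ ^ i} ↔ ϖ ^ i ∣ y := by
  have h1 : Ideal.span {Ideal.Quotient.mk (maximalIdeal W ^ M) ϖ ^ i} =
      (maximalIdeal W ^ i).map (Ideal.Quotient.mk (maximalIdeal W ^ M)) := by
    rw [maximalIdeal_pow_eq hϖ i, Ideal.map_span, Set.image_singleton, map_pow]
  rw [h1, Ideal.mem_quotient_iff_mem (Ideal.pow_le_pow_right hi), maximalIdeal_pow_eq hϖ,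
    Ideal.mem_span_singleton]

theorem isTruncated_trunc [Finite (ResidueField W)] {ϖ : W} (hϖ : Irreducible ϖ) {M : ℕ}
    [IsLocalRing (Trunc W M)] :
    IsTruncated (Trunc W M) (Ideal.Quotient.mk (maximalIdeal W ^ M) ϖ)
      (Nat.card (ResidueField W)) M where
  max := by
    have hs : Function.Surjective (Ideal.Quotient.mk (maximalIdeal W ^ M)) :=
      Ideal.Quotient.mk_surjective
    have h1 : (maximalIdeal (Trunc W M)).comap (Ideal.Quotient.mk (maximalIdeal W ^ M)) =
        maximalIdeal W :=
      IsLocalRing.eq_maximalIdeal (Ideal.comap_isMaximal_of_surjective _ hs)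
    have h2 : maximalIdeal W = Ideal.span {ϖ} := hϖ.maximalIdeal_eq
    rw [← Ideal.map_comap_of_surjective _ hs (maximalIdeal (Trunc W M)), h1]
    refine (congrArg (Ideal.map (Ideal.Quotient.mk (maximalIdeal W ^ M))) h2).trans ?_
    rw [Ideal.map_span, Set.image_singleton]
  card := by
    let f : W →+* ResidueField (Trunc W M) :=
      (residue (Trunc W M)).comp (Ideal.Quotient.mk (maximalIdeal W ^ M))
    have hs : Function.Surjective f :=
      (residue_surjective (R := Trunc W M)).comp Ideal.Quotient.mk_surjective
    have hk : RingHom.ker f = maximalIdeal W :=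
      IsLocalRing.eq_maximalIdeal (RingHom.ker_isMaximal_of_surjective f hs)
    have e := RingHom.quotientKerEquivOfSurjective hs
    rw [← Nat.card_congr e.toEquiv, hk]
    rfl
  cancel := by
    intro n i x hi
    obtain ⟨y, rfl⟩ := Ideal.Quotient.mk_surjective x
    have e : Ideal.Quotient.mk (maximalIdeal W ^ M) ϖ ^ n * Ideal.Quotient.mk _ y =
        Ideal.Quotient.mk _ (ϖ ^ n * y) := by rw [map_mul, map_pow]
    rw [e, mk_mem_span_iff hϖ hi, mk_mem_span_iff hϖ (by omega)]
    rcases le_total n i with h | h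
    · obtain ⟨l, rfl⟩ := Nat.exists_eq_add_of_le h
      rw [pow_add, mul_dvd_mul_iff_left (pow_ne_zero _ hϖ.ne_zero), Nat.add_sub_cancel_left]
    · rw [Nat.sub_eq_zero_of_le h, pow_zero]
      exact iff_of_true ((pow_dvd_pow _ h).mul_right _) (one_dvd _)

theorem le_addVal_iff {ϖ : W} (hϖ : Irreducible ϖ) (i : ℕ) (x : W) :
    (i : ℕ∞) ≤ IsDiscreteValuationRing.addVal W x ↔ ϖ ^ i ∣ x := by
  rw [← hϖ.addVal_pow i, IsDiscreteValuationRing.addVal_le_iff_dvd]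

end Truncation

/-! ### Haar measure and its reductions. -/

section Reduction

theorem isTopologicalRing_of_isAdic {W : Type*} [CommRing W] [TopologicalSpace W] {I : Ideal W}
    (h : IsAdic I) : IsTopologicalRing W := by
  unfold IsAdic at h
  subst h
  infer_instance

variable {W : Type*} [CommRing W] [TopologicalSpace W] [MeasurableSpace W] [BorelSpace W]
  {I : Ideal W}

theorem measurableSet_mk_fiber (h : IsAdic I) (M : ℕ) (s : Set (W ⧸ I ^ M)) :
    MeasurableSet {w | Ideal.Quotient.mk (I ^ M) w ∈ s} := by
  have := isTopologicalRing_of_isAdic h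
  apply IsOpen.measurableSet
  rw [isOpen_iff_mem_nhds]
  intro x hx
  refine (h.hasBasis_nhds x).mem_iff.2 ⟨M, trivial, ?_⟩
  rintro _ ⟨y, hy, rfl⟩
  have : Ideal.Quotient.mk (I ^ M) (x + y) = Ideal.Quotient.mk (I ^ M) x := by
    rw [map_add, Ideal.Quotient.eq_zero_iff_mem.2 hy, add_zero]
  rw [Set.mem_ofPred_eq, this]
  exact hx

/-- Coordinatewise reduction of pairs. -/
def redPair {A B : Type*} [CommRing A] [CommRing B] (f : A →+* B) {d : ℕ} (ω : Pairs A d) :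
    Pairs B d :=
  (fun i => f (ω.1 i), fun i => f (ω.2 i))

theorem measurableSet_redPair_fiber (h : IsAdic I) (M d : ℕ) (x : Pairs (W ⧸ I ^ M) d) :
    MeasurableSet {ω : Pairs W d | redPair (Ideal.Quotient.mk (I ^ M)) ω = x} := by
  have h1 : {ω : Pairs W d | redPair (Ideal.Quotient.mk (I ^ M)) ω = x} =
      (⋂ i, {ω : Pairs W d | Ideal.Quotient.mk (I ^ M) (ω.1 i) ∈ ({x.1 i} : Set _)}) ∩
      ⋂ i, {ω : Pairs W d | Ideal.Quotient.mk (I ^ M) (ω.2 i) ∈ ({x.2 i} : Set _)} := by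
    ext ω
    simp only [redPair, Set.mem_ofPred_eq, Prod.ext_iff, funext_iff, Set.mem_inter_iff,
      Set.mem_iInter, Set.mem_singleton_iff]
  rw [h1]
  refine MeasurableSet.inter (MeasurableSet.iInter fun i => ?_) (MeasurableSet.iInter fun i => ?_)
  · have : Measurable fun ω : Pairs W d => ω.1 i := (measurable_pi_apply i).comp measurable_fst
    exact this (measurableSet_mk_fiber h M _)
  · have : Measurable fun ω : Pairs W d => ω.2 i := (measurable_pi_apply i).comp measurable_snd
    exact this (measurableSet_mk_fiber h M _)

instance isProbabilityMeasure_pairMeasure (μ : Measure W) [IsProbabilityMeasure μ] (d : ℕ) :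
    IsProbabilityMeasure (pairMeasure μ d) := by
  unfold pairMeasure; infer_instance

theorem measurableSet_redPair_preimage (h : IsAdic I) (M d : ℕ) [Finite (W ⧸ I ^ M)]
    (E : Set (Pairs (W ⧸ I ^ M) d)) :
    MeasurableSet {ω : Pairs W d | redPair (Ideal.Quotient.mk (I ^ M)) ω ∈ E} := by
  have h1 : {ω : Pairs W d | redPair (Ideal.Quotient.mk (I ^ M)) ω ∈ E} =
      ⋃ x ∈ E, {ω : Pairs W d | redPair (Ideal.Quotient.mk (I ^ M)) ω = x} := by
    ext ω; simp
  rw [h1]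
  exact MeasurableSet.biUnion (Set.to_countable E) fun x _ => measurableSet_redPair_fiber h M d x

/-- The reduction of the Haar measure is uniform. -/
theorem measureReal_redPair_preimage (h : IsAdic I) (μ : Measure W) [μ.IsAddHaarMeasure]
    [IsProbabilityMeasure μ] (M d : ℕ) [Finite (W ⧸ I ^ M)] (E : Set (Pairs (W ⧸ I ^ M) d)) :
    (pairMeasure μ d).real {ω | redPair (Ideal.Quotient.mk (I ^ M)) ω ∈ E} =
      E.ncard / (Nat.card (W ⧸ I ^ M) : ℝ) ^ (2 * d) := by
  classical
  have := isTopologicalRing_of_isAdic h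
  have hinv : (pairMeasure μ d).IsAddLeftInvariant := by unfold pairMeasure; infer_instance
  let F : Pairs (W ⧸ I ^ M) d → Set (Pairs W d) :=
    fun x => {ω | redPair (Ideal.Quotient.mk (I ^ M)) ω = x}
  -- The fibres of the reduction are translates of one another.
  have hconst : ∀ x, (pairMeasure μ d).real (F x) = (pairMeasure μ d).real (F 0) := by
    intro x
    have hs := Ideal.Quotient.mk_surjective (I := I ^ M)
    choose g hg using hs
    let y : Pairs W d := (fun i => g (x.1 i), fun i => g (x.2 i))
    have h1 : F 0 = (fun ω => y + ω) ⁻¹' F x := by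
      ext ω
      simp only [F, redPair, Set.mem_ofPred_eq, Set.mem_preimage, Prod.ext_iff, funext_iff,
        Prod.fst_add, Prod.snd_add, Pi.add_apply, map_add, y, hg, Prod.fst_zero, Prod.snd_zero,
        Pi.zero_apply, add_eq_left]
    have hm : Measurable fun ω : Pairs W d => y + ω := by
      refine Measurable.prodMk (f := fun ω : Pairs W d => y.1 + ω.1)
        (g := fun ω : Pairs W d => y.2 + ω.2) (measurable_pi_lambda _ fun i => ?_)
        (measurable_pi_lambda _ fun i => ?_)
      · exact (measurable_const_add (y.1 i)).comp ((measurable_pi_apply i).comp measurable_fst)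
      · exact (measurable_const_add (y.2 i)).comp ((measurable_pi_apply i).comp measurable_snd)
    rw [h1, measureReal_def, measureReal_def,
      ← Measure.map_apply hm (measurableSet_redPair_fiber h M d x), hinv.map_add_left_eq_self]
  have hsum : ∀ E : Set (Pairs (W ⧸ I ^ M) d),
      (pairMeasure μ d).real {ω | redPair (Ideal.Quotient.mk (I ^ M)) ω ∈ E} =
      E.ncard * (pairMeasure μ d).real (F 0) := by
    intro E
    have hE : E.Finite := Set.toFinite E
    have h1 : {ω : Pairs W d | redPair (Ideal.Quotient.mk (I ^ M)) ω ∈ E} =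
        ⋃ x ∈ hE.toFinset, F x := by
      ext ω; simp [F]
    rw [h1, measureReal_biUnion_finset]
    · rw [Finset.sum_congr rfl fun x _ => hconst x, Finset.sum_const, nsmul_eq_mul,
        Set.ncard_eq_toFinset_card E hE]
    · intro x _ y _ hxy
      refine Set.disjoint_left.2 fun ω hx hy => hxy ?_
      exact hx.symm.trans hy
    · intro x _
      exact measurableSet_redPair_fiber h M d x
  have huniv := hsum Set.univ
  rw [Set.ncard_univ, Nat.card_prod, Nat.card_fun, Nat.card_fin] at huniv
  have h1 : (pairMeasure μ d).real
      {ω | redPair (Ideal.Quotient.mk (I ^ M)) ω ∈ (Set.univ : Set (Pairs (W ⧸ I ^ M) d))} = 1 := by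
    simp
  have hN : (Nat.card (W ⧸ I ^ M) : ℝ) ≠ 0 := by exact_mod_cast Nat.card_pos.ne'
  rw [h1] at huniv
  rw [hsum E, eq_div_iff (pow_ne_zero _ hN), mul_assoc]
  push_cast at huniv
  have h2 : (pairMeasure μ d).real (F 0) * (Nat.card (W ⧸ I ^ M) : ℝ) ^ (2 * d) = 1 := by
    rw [huniv]; ring
  rw [h2, mul_one]

theorem lowPoly_map {A B : Type*} [CommRing A] [CommRing B] (f : A →+* B) {d : ℕ} (c : Fin d → A) :
    (lowPoly c).map f = lowPoly fun i => f (c i) := by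
  simp [lowPoly, Polynomial.map_sum]

theorem monicPoly_map {A B : Type*} [CommRing A] [CommRing B] (f : A →+* B) {d : ℕ}
    (c : Fin d → A) : (monicPoly c).map f = monicPoly fun i => f (c i) := by
  rw [monicPoly_eq, monicPoly_eq, Polynomial.map_add, lowPoly_map, Polynomial.map_pow, map_X]

/-- The pair `(A, B - A)` of polynomials attached to a point of the probability space. -/
noncomputable def diffPair {A : Type*} [CommRing A] {d : ℕ} (ω : Pairs A d) : A[X] × A[X] :=
  (monicPoly ω.1, lowPoly (ω.2 - ω.1))

theorem bijOn_diffPair (A : Type*) [CommRing A] (d : ℕ) :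
    Set.BijOn (diffPair (A := A) (d := d)) Set.univ (monicLow A d) := by
  have h := bijOn_pairs (R := A) d
  refine h.comp (f := fun ω : Pairs A d => (ω.1, ω.2 - ω.1)) ?_
  refine ⟨fun _ _ => trivial, ?_, ?_⟩
  · rintro ⟨a, b⟩ _ ⟨a', b'⟩ _ h
    simp only [Prod.mk.injEq] at h
    obtain ⟨rfl, h⟩ := h
    rw [sub_left_inj] at h
    rw [h]
  · rintro ⟨a, b⟩ _
    exact ⟨(a, b + a), trivial, by simp⟩

theorem diffPair_map {A B : Type*} [CommRing A] [CommRing B] (f : A →+* B) {d : ℕ}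
    (ω : Pairs A d) : diffPair (redPair f ω) = ((diffPair ω).1.map f, (diffPair ω).2.map f) := by
  simp only [diffPair, monicPoly_map, lowPoly_map, redPair]
  congr 2
  ext i
  simp

theorem monicPoly_snd {A : Type*} [CommRing A] {d : ℕ} (ω : Pairs A d) :
    monicPoly ω.2 = (diffPair ω).1 + (diffPair ω).2 := by
  simp only [diffPair, monicPoly_eq, lowPoly, Pi.sub_apply, C_sub, sub_mul, Finset.sum_sub_distrib]
  ring

theorem measureReal_diffPair_preimage (h : IsAdic I) (μ : Measure W) [μ.IsAddHaarMeasure]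
    [IsProbabilityMeasure μ] (M d : ℕ) [Finite (W ⧸ I ^ M)]
    (F : Set ((W ⧸ I ^ M)[X] × (W ⧸ I ^ M)[X])) :
    (pairMeasure μ d).real
      {ω | diffPair (redPair (Ideal.Quotient.mk (I ^ M)) ω) ∈ F} =
      {x | x ∈ monicLow (W ⧸ I ^ M) d ∧ x ∈ F}.ncard / (Nat.card (W ⧸ I ^ M) : ℝ) ^ (2 * d) := by
  have h1 := measureReal_redPair_preimage h μ M d {x | diffPair x ∈ F}
  refine h1.trans ?_
  congr 2
  have := BijOn.sep (bijOn_diffPair (W ⧸ I ^ M) d) (p := fun x => diffPair x ∈ F)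
    (q := fun y => y ∈ F) (fun _ _ => Iff.rfl)
  rw [← this.ncard_eq]
  congr 1
  ext x; simp

theorem psIdeal_monic_pair {A : Type*} [CommRing A] [Nontrivial A] {d j : ℕ} (hj : j ≤ d)
    (ω : Pairs A d) :
    psIdeal (monicPoly ω.1) (monicPoly ω.2) d j = psIdeal (diffPair ω).1 (diffPair ω).2 d j := by
  have hm := (bijOn_diffPair A d).mapsTo (Set.mem_univ ω)
  rw [monicPoly_snd]
  exact psIdeal_add_left (Monic.mem_degreeLT_succ (monic_of_sub_mem hm.1).2)
    (degreeLT_le (Nat.le_succ _) hm.2) hj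

end Reduction

/-! ### Tail probabilities as frequencies. -/

section Law

variable {W : Type*} [CommRing W] [IsDomain W] [IsDiscreteValuationRing W]

/-- Principal subresultants commute with reduction, and divisibility by ϖ^i is visible modulo ϖ^M as
soon as i ≤ M. -/
theorem le_valV_iff {ϖ : W} (hϖ : Irreducible ϖ) {d j i M : ℕ} (hi : i ≤ M) (hM : 1 ≤ M)
    (hj : j ≤ d) (ω : Pairs W d) :
    (i : ℕ∞) ≤ valV j ω ↔
      psIdeal (diffPair (redPair (Ideal.Quotient.mk (maximalIdeal W ^ M)) ω)).1
        (diffPair (redPair (Ideal.Quotient.mk (maximalIdeal W ^ M)) ω)).2 d j ≤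
        Ideal.span {Ideal.Quotient.mk (maximalIdeal W ^ M) ϖ ^ i} := by
  have := isLocalRing_trunc (W := W) hM
  rw [valV, le_addVal_iff hϖ, ← psIdeal_monic_pair hj, psIdeal, Ideal.span_singleton_le_iff_mem,
    ← mk_mem_span_iff hϖ hi, ← principalSubresultant_map, monicPoly_map, monicPoly_map]
  rfl

variable [Finite (ResidueField W)] [TopologicalSpace W] [MeasurableSpace W] [BorelSpace W]

theorem measurableSet_le_valV (h : IsAdic (maximalIdeal W)) {d j : ℕ} (hj : j ≤ d) (i : ℕ) :
    MeasurableSet {ω : Pairs W d | (i : ℕ∞) ≤ valV j ω} := by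
  obtain ⟨ϖ, hϖ⟩ := IsDiscreteValuationRing.exists_irreducible W
  have := finite_trunc (W := W) (i + 1)
  have h1 := fun ω : Pairs W d => le_valV_iff hϖ (Nat.le_succ i) (Nat.le_add_left 1 i) hj ω
  simp only [h1]
  exact measurableSet_redPair_preimage h (i + 1) d
    {x | psIdeal (diffPair x).1 (diffPair x).2 d j ≤ _}

theorem measureReal_le_valV {ϖ : W} (hϖ : Irreducible ϖ) (h : IsAdic (maximalIdeal W))
    (μ : Measure W) [μ.IsAddHaarMeasure] [IsProbabilityMeasure μ] {d j i M : ℕ} (hj : j ≤ d)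
    (hi : i ≤ M) (hM : 1 ≤ M) :
    (pairMeasure μ d).real {ω | (i : ℕ∞) ≤ valV j ω} =
      freq (Trunc W M) d j (Ideal.span {Ideal.Quotient.mk (maximalIdeal W ^ M) ϖ ^ i}) := by
  have := finite_trunc (W := W) M
  simp only [le_valV_iff hϖ hi hM hj]
  exact measureReal_diffPair_preimage h μ M d {x | psIdeal x.1 x.2 d j ≤ _}

end Law

/-! ### Generating series of the laws. -/

section TailRecursion

/-- The relations between the tail probabilities `p d j i` of the valuations of the principal
subresultants. -/
structure IsTail (q : ℝ) (p : ℕ → ℕ → ℕ → ℝ) : Prop where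
  zero : ∀ {d j}, j ≤ d → p d j 0 = 1
  self : ∀ d i, p d d (i + 1) = 0
  succ : ∀ {d j}, j ≤ d → d ≤ 2 * j + 1 → ∀ i, p (d + 1) (j + 1) i = p d j i
  split : ∀ {d j}, 2 * j + 1 ≤ d → ∀ i, p d j i = p d j (i - (d - j)) / q ^ d +
    ∑ e ∈ Finset.range d, (q - 1) / q ^ (d - e) *
      if j ≤ e then p e j i else p (d - e) (d - j) (i - (j - e))

/-- The generating series of the distribution with tail `p d j`. -/
noncomputable def gen (p : ℕ → ℕ → ℕ → ℝ) (d j : ℕ) : PowerSeries ℝ :=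
  PowerSeries.mk fun i => p d j i - p d j (i + 1)

namespace IsTail

variable {q : ℝ} {p : ℕ → ℕ → ℕ → ℝ}

theorem _root_.SubresVal.mk_shift (p : ℕ → ℕ → ℕ → ℝ) (d j n : ℕ) :
    PowerSeries.mk (fun i => p d j (i - n) - p d j (i + 1 - n)) =
      PowerSeries.X ^ n * gen p d j := by
  ext i
  rw [PowerSeries.coeff_X_pow_mul', PowerSeries.coeff_mk, gen, PowerSeries.coeff_mk]
  split_ifs with hi
  · rw [Nat.sub_add_comm hi]
  · rw [Nat.sub_eq_zero_of_le (by omega), Nat.sub_eq_zero_of_le (by omega), sub_self]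

theorem gen_self (h : IsTail q p) (d : ℕ) : gen p d d = 1 := by
  ext i
  rw [gen, PowerSeries.coeff_mk, PowerSeries.coeff_one]
  rcases i with _ | i
  · rw [h.zero le_rfl, h.self, sub_zero, if_pos rfl]
  · rw [h.self, h.self, sub_zero, if_neg (by omega)]

theorem gen_succ (h : IsTail q p) {d j : ℕ} (hj : j ≤ d) (hd : d ≤ 2 * j + 1) :
    gen p (d + 1) (j + 1) = gen p d j := by
  simp only [gen, h.succ hj hd]

theorem gen_split (h : IsTail q p) {d j : ℕ} (hd : 2 * j + 1 ≤ d) :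
    gen p d j = PowerSeries.C (q ^ d)⁻¹ * (PowerSeries.X ^ (d - j) * gen p d j) +
      ∑ e ∈ Finset.range d, PowerSeries.C ((q - 1) / q ^ (d - e)) *
        if j ≤ e then gen p e j else PowerSeries.X ^ (j - e) * gen p (d - e) (d - j) := by
  rw [← mk_shift]
  have h1 : ∀ e ∈ Finset.range d, (PowerSeries.C ((q - 1) / q ^ (d - e)) *
      if j ≤ e then gen p e j else PowerSeries.X ^ (j - e) * gen p (d - e) (d - j)) =
      PowerSeries.C ((q - 1) / q ^ (d - e)) * if j ≤ e then gen p e j else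
        PowerSeries.mk fun i => p (d - e) (d - j) (i - (j - e)) -
          p (d - e) (d - j) (i + 1 - (j - e)) := by
    intro e he
    split_ifs with hje
    · rfl
    · rw [mk_shift]
  rw [Finset.sum_congr rfl h1]
  ext i
  rw [map_add, map_sum, PowerSeries.coeff_C_mul, gen, PowerSeries.coeff_mk, PowerSeries.coeff_mk,
    h.split hd i, h.split hd (i + 1), add_sub_add_comm, ← Finset.sum_sub_distrib]
  congr 1
  · ring
  · refine Finset.sum_congr rfl fun e _ => ?_
    rw [PowerSeries.coeff_C_mul, ← mul_sub]
    congr 1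
    split_ifs <;> simp [gen]

/-- The generating series depends only on `n` for the pairs `(n + j, j)` with `n ≤ j + 1`. -/
theorem gen_stable (h : IsTail q p) {n j : ℕ} (hn : n ≤ j + 1) :
    gen p (n + j) j = gen p (n + n) n := by
  rcases Nat.lt_or_ge j n with hj | hj
  · obtain rfl : n = j + 1 := by omega
    exact (h.gen_succ (by omega) (by omega)).symm
  · induction j, hj using Nat.le_induction with
    | base => rfl
    | succ j hj ih => rw [← ih (by omega), ← add_assoc, h.gen_succ (by omega) (by omega)]

/-- After multiplication by q^n, the right-hand side depends on n only through its first term and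
the range of one sum, which prepares a telescoping. The residual degrees e < j are reindexed by m +
1 = j - e and brought to the diagonal by `gen_stable`. -/
theorem gen_split_add (h : IsTail q p) (hq : q ≠ 0) {n j : ℕ} (hn : j + 1 ≤ n) :
    PowerSeries.C (q ^ n) * gen p (n + j) j =
      PowerSeries.C (q ^ j)⁻¹ * (PowerSeries.X ^ n * gen p (n + j) j) +
      PowerSeries.C (q - 1) * (∑ m ∈ Finset.range n, PowerSeries.C (q ^ m) * gen p (m + j) j +
        ∑ m ∈ Finset.range j, PowerSeries.C (q ^ (m + 1))⁻¹ *
          (PowerSeries.X ^ (m + 1) * gen p ((m + 1) + (m + 1)) (m + 1))) := by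
  have h1 := h.gen_split (d := n + j) (j := j) (by omega)
  rw [Nat.add_sub_cancel, add_comm n j, Finset.sum_range_add, add_comm j n] at h1
  have h2 : ∀ m ∈ Finset.range n, (PowerSeries.C ((q - 1) / q ^ (n + j - (j + m))) *
      if j ≤ j + m then gen p (j + m) j
        else PowerSeries.X ^ (j - (j + m)) * gen p (n + j - (j + m)) n) =
      PowerSeries.C ((q ^ n)⁻¹ * (q - 1)) * (PowerSeries.C (q ^ m) * gen p (m + j) j) := by
    intro m hm
    rw [Finset.mem_range] at hm
    rw [if_pos (by omega), add_comm j m, ← mul_assoc, ← map_mul]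
    congr 2
    obtain ⟨l, rfl⟩ := Nat.exists_eq_add_of_lt hm
    rw [show m + l + 1 + j - (m + j) = l + 1 by omega, pow_add, pow_add]
    field_simp
    ring
  have h3 : ∑ e ∈ Finset.range j, (PowerSeries.C ((q - 1) / q ^ (n + j - e)) *
      if j ≤ e then gen p e j else PowerSeries.X ^ (j - e) * gen p (n + j - e) n) =
      ∑ m ∈ Finset.range j, PowerSeries.C ((q ^ n)⁻¹ * (q - 1)) *
        (PowerSeries.C (q ^ (m + 1))⁻¹ *
          (PowerSeries.X ^ (m + 1) * gen p ((m + 1) + (m + 1)) (m + 1))) := by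
    rw [← Finset.sum_range_reflect]
    refine Finset.sum_congr rfl fun m hm => ?_
    rw [Finset.mem_range] at hm
    rw [if_neg (by omega), show j - (j - 1 - m) = m + 1 by omega,
      show n + j - (j - 1 - m) = (m + 1) + n by omega, h.gen_stable (n := m + 1) (by omega),
      ← mul_assoc (PowerSeries.C _) (PowerSeries.C _), ← map_mul]
    congr 2
    rw [pow_add]
    field_simp
  rw [Finset.sum_congr rfl h2, h3, ← Finset.mul_sum, ← Finset.mul_sum] at h1
  have h4 : PowerSeries.C (q ^ n) * PowerSeries.C (q ^ (n + j))⁻¹ = PowerSeries.C (q ^ j)⁻¹ := by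
    rw [← map_mul]; congr 1; rw [pow_add]; field_simp
  have h5 : PowerSeries.C (q ^ n) * PowerSeries.C ((q ^ n)⁻¹ * (q - 1)) =
      PowerSeries.C (q - 1) := by
    rw [← map_mul]; congr 1; field_simp
  rw [← h4, ← h5]
  conv_lhs => rw [h1]
  ring

/-- Difference of `gen_split_add` at n + 1 and at n: of the sums, only the term of index n survives.
-/
theorem gen_step_high (h : IsTail q p) (hq : q ≠ 0) {n j : ℕ} (hn : j + 1 ≤ n) :
    gen p (n + 1 + j) j - PowerSeries.C (q ^ (n + 1 + j))⁻¹ *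
        (PowerSeries.X ^ (n + 1) * gen p (n + 1 + j) j) =
      gen p (n + j) j - PowerSeries.C (q ^ (n + 1 + j))⁻¹ *
        (PowerSeries.X ^ n * gen p (n + j) j) := by
  have h1 := h.gen_split_add hq hn
  have h2 := h.gen_split_add hq (n := n + 1) (j := j) (by omega)
  rw [Finset.sum_range_succ] at h2
  have e1 : (PowerSeries.C (q ^ (n + 1))⁻¹ : PowerSeries ℝ) * PowerSeries.C (q ^ (n + 1)) = 1 := by
    rw [← map_mul, inv_mul_cancel₀ (pow_ne_zero _ hq), map_one]
  have e2 : (PowerSeries.C (q ^ (n + 1 + j))⁻¹ : PowerSeries ℝ) =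
      PowerSeries.C (q ^ (n + 1))⁻¹ * PowerSeries.C (q ^ j)⁻¹ := by
    rw [← map_mul, pow_add _ (n + 1), mul_inv]
  have e3 : (PowerSeries.C (q ^ (n + 1)) : PowerSeries ℝ) =
      PowerSeries.C (q - 1) * PowerSeries.C (q ^ n) + PowerSeries.C (q ^ n) := by
    rw [← map_mul, ← map_add]; congr 1; ring
  rw [e2]
  linear_combination PowerSeries.C (q ^ (n + 1))⁻¹ * (h2 - h1) +
    (gen p (n + j) j - gen p (n + 1 + j) j) * e1 -
    PowerSeries.C (q ^ (n + 1))⁻¹ * gen p (n + j) j * e3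

/-- The same telescoping along d = 2n. Here j moves too: the last sum gains a term, which the change
of the factor q^(-j) in the first term absorbs (`e4`). For n = 0 there is no previous relation to
subtract. -/
theorem gen_step_diag (h : IsTail q p) (hq : q ≠ 0) (n : ℕ) :
    gen p (n + 1 + (n + 1)) (n + 1) - PowerSeries.C (q ^ (n + 1 + n))⁻¹ *
        (PowerSeries.X ^ (n + 1) * gen p (n + 1 + (n + 1)) (n + 1)) =
      gen p (n + n) n - PowerSeries.C (q ^ (n + 1 + n))⁻¹ *
        (PowerSeries.X ^ n * gen p (n + n) n) := by
  have key : ∀ j, PowerSeries.C (q ^ (j + 1)) * gen p (j + 1 + (j + 1)) (j + 1) =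
      PowerSeries.C (q ^ j)⁻¹ * (PowerSeries.X ^ (j + 1) * gen p (j + 1 + (j + 1)) (j + 1)) +
      PowerSeries.C (q - 1) *
        (∑ m ∈ Finset.range (j + 1), PowerSeries.C (q ^ m) * gen p (m + m) m +
        ∑ m ∈ Finset.range j, PowerSeries.C (q ^ (m + 1))⁻¹ *
          (PowerSeries.X ^ (m + 1) * gen p ((m + 1) + (m + 1)) (m + 1))) := by
    intro j
    have h1 := h.gen_split_add hq (n := j + 1) (j := j) le_rfl
    rw [h.gen_stable (n := j + 1) le_rfl] at h1
    rw [h1]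
    congr 3
    refine Finset.sum_congr rfl fun m hm => ?_
    rw [Finset.mem_range] at hm
    rw [h.gen_stable (by omega)]
  have e1 : (PowerSeries.C (q ^ (n + 1))⁻¹ : PowerSeries ℝ) * PowerSeries.C (q ^ (n + 1)) = 1 := by
    rw [← map_mul, inv_mul_cancel₀ (pow_ne_zero _ hq), map_one]
  have e2 : (PowerSeries.C (q ^ (n + 1 + n))⁻¹ : PowerSeries ℝ) =
      PowerSeries.C (q ^ (n + 1))⁻¹ * PowerSeries.C (q ^ n)⁻¹ := by
    rw [← map_mul, pow_add _ (n + 1), mul_inv]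
  have e3 : (PowerSeries.C (q ^ (n + 1)) : PowerSeries ℝ) =
      PowerSeries.C (q - 1) * PowerSeries.C (q ^ n) + PowerSeries.C (q ^ n) := by
    rw [← map_mul, ← map_add]; congr 1; ring
  rw [e2]
  rcases n with _ | n
  · have h1 := key 0
    have h0 : gen p (0 + 0) 0 = 1 := h.gen_self 0
    simp only [zero_add, Finset.sum_range_one, Finset.sum_range_zero, pow_zero, add_zero,
      inv_one, map_one] at h1 h0 e1 e3 ⊢
    rw [h0] at h1 ⊢
    linear_combination PowerSeries.C (q ^ 1)⁻¹ * h1 +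
      (1 - gen p (1 + 1) 1) * e1 - PowerSeries.C (q ^ 1)⁻¹ * e3
  · have h1 := key n
    have h2 := key (n + 1)
    rw [Finset.sum_range_succ _ (n + 1), Finset.sum_range_succ (fun m => PowerSeries.C (q ^ (m + 1))⁻¹ *
      (PowerSeries.X ^ (m + 1) * gen p ((m + 1) + (m + 1)) (m + 1))) n] at h2
    have e4 : (PowerSeries.C (q ^ n)⁻¹ : PowerSeries ℝ) =
      PowerSeries.C (q - 1) * PowerSeries.C (q ^ (n + 1))⁻¹ + PowerSeries.C (q ^ (n + 1))⁻¹ := by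
      rw [← map_mul, ← map_add]; congr 1; rw [pow_succ]; field_simp; ring
    linear_combination PowerSeries.C (q ^ (n + 1 + 1))⁻¹ * (h2 - h1) +
      (gen p (n + 1 + (n + 1)) (n + 1) - gen p (n + 1 + 1 + (n + 1 + 1)) (n + 1 + 1)) * e1 -
      PowerSeries.C (q ^ (n + 1 + 1))⁻¹ * gen p (n + 1 + (n + 1)) (n + 1) * e3 -
      PowerSeries.C (q ^ (n + 1 + 1))⁻¹ * PowerSeries.X ^ (n + 1) *
        gen p (n + 1 + (n + 1)) (n + 1) * e4

/-- The exponents in the law of the valuations of the `j`-th principal subresultant. -/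
def _root_.SubresVal.expo (j n : ℕ) : ℕ := min (2 * n - 1) (n + j)

/-- For n ≤ j both series lie on the diagonal by `gen_stable`, otherwise the direct step applies;
this is why the exponent is a minimum. Iterating gives a product of factors (1 - x X^(i-1)) / (1 - x
X^i). -/
theorem gen_step (h : IsTail q p) (hq : q ≠ 0) (n j : ℕ) :
    gen p (n + 1 + j) j - PowerSeries.C (q ^ expo j (n + 1))⁻¹ *
        (PowerSeries.X ^ (n + 1) * gen p (n + 1 + j) j) =
      gen p (n + j) j - PowerSeries.C (q ^ expo j (n + 1))⁻¹ *
        (PowerSeries.X ^ n * gen p (n + j) j) := by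
  rcases Nat.lt_or_ge j n with hn | hn
  · rw [expo, min_eq_right (by omega), h.gen_step_high hq hn]
  · rw [expo, min_eq_left (by omega), h.gen_stable (n := n) (by omega),
      h.gen_stable (n := n + 1) (by omega), show 2 * (n + 1) - 1 = n + 1 + n by omega,
      h.gen_step_diag hq]

end IsTail

end TailRecursion

/-! ### The tail recursion for the valuations. -/

section Law

variable {W : Type*} [CommRing W] [IsDomain W] [IsDiscreteValuationRing W]
  [Finite (ResidueField W)] [TopologicalSpace W] [MeasurableSpace W] [BorelSpace W]

/-- The tail probabilities of the valuation of the principal subresultants. -/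
noncomputable def tailProb (μ : Measure W) (d j i : ℕ) : ℝ :=
  (pairMeasure μ d).real {ω | (i : ℕ∞) ≤ valV j ω}

theorem isTail_tailProb (h : IsAdic (maximalIdeal W)) (μ : Measure W) [μ.IsAddHaarMeasure]
    [IsProbabilityMeasure μ] : IsTail (Nat.card (ResidueField W) : ℝ) (tailProb μ) := by
  obtain ⟨ϖ, hϖ⟩ := IsDiscreteValuationRing.exists_irreducible W
  have key : ∀ {d j i : ℕ} (M : ℕ), j ≤ d → i ≤ M → 1 ≤ M → tailProb μ d j i =
      freq (Trunc W M) d j (Ideal.span {Ideal.Quotient.mk (maximalIdeal W ^ M) ϖ ^ i}) :=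
    fun M => measureReal_le_valV hϖ h μ
  have hfin := fun M => finite_trunc (W := W) M
  constructor
  · intro d j hj
    rw [key 1 hj (by omega) le_rfl, pow_zero, Ideal.span_singleton_one, freq_top]
  · intro d i
    have := isLocalRing_trunc (W := W) (M := i + 1) (by omega)
    rw [key (i + 1) le_rfl le_rfl (by omega), freq_self]
    intro h1
    rw [Ideal.eq_top_iff_one, ← map_one (Ideal.Quotient.mk _), mk_mem_span_iff hϖ le_rfl] at h1
    exact hϖ.not_isUnit (isUnit_of_dvd_one ((dvd_pow_self ϖ (by omega)).trans h1))
  · intro d j hj hd i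
    have := isLocalRing_trunc (W := W) (M := i + 1) (by omega)
    rw [key (i + 1) (by omega) (by omega) (by omega), key (i + 1) hj (by omega) (by omega),
      freq_succ hj hd]
  · intro d j hd i
    have := isLocalRing_trunc (W := W) (M := i + 1) (by omega)
    rw [key (i + 1) (by omega) (by omega) (by omega),
      (isTruncated_trunc hϖ (M := i + 1)).freq_rec hd (by omega),
      key (i + 1) (by omega) (by omega) (by omega)]
    congr 1
    refine Finset.sum_congr rfl fun e he => ?_
    rw [Finset.mem_range] at he
    congr 1
    split_ifs with hje
    · rw [key (i + 1) hje (by omega) (by omega)]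
    · rw [key (i + 1) (by omega) (by omega) (by omega)]

end Law

/-! ### Moments and generating functions along a chain of laws. -/

section Shift

theorem hasSum_shift {g w : ℕ → ℝ} {n : ℕ} {a : ℝ} (h : HasSum (fun m => w (m + n) * g m) a) :
    HasSum (fun m => w m * if n ≤ m then g (m - n) else 0) a := by
  rw [← (add_left_injective n).hasSum_iff]
  · convert h using 2 with m
    simp
  · intro m hm
    rw [if_neg, mul_zero]
    intro h1
    exact hm ⟨m - n, Nat.sub_add_cancel h1⟩

theorem sum_range_shift_le {g : ℕ → ℝ} (hg : ∀ m, 0 ≤ g m) {s : ℝ} (hs : 0 ≤ s) (n N : ℕ) :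
    ∑ m ∈ Finset.range N, s ^ m * (if n ≤ m then g (m - n) else 0) ≤
      s ^ n * ∑ m ∈ Finset.range N, s ^ m * g m := by
  have hnn : ∀ m, 0 ≤ s ^ m * g m := fun m => mul_nonneg (pow_nonneg hs _) (hg _)
  rcases Nat.lt_or_ge N n with h | h
  · rw [Finset.sum_eq_zero]
    · exact mul_nonneg (pow_nonneg hs _) (Finset.sum_nonneg fun m _ => hnn m)
    · intro m hm
      rw [Finset.mem_range] at hm
      rw [if_neg (by omega), mul_zero]
  · obtain ⟨L, rfl⟩ := Nat.exists_eq_add_of_le h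
    rw [Finset.sum_range_add, Finset.sum_eq_zero, zero_add]
    · have h1 : ∀ m ∈ Finset.range L, s ^ (n + m) * (if n ≤ n + m then g (n + m - n) else 0) =
          s ^ n * (s ^ m * g m) := by
        intro m _
        rw [if_pos (by omega), Nat.add_sub_cancel_left, pow_add, mul_assoc]
      rw [Finset.sum_congr rfl h1, ← Finset.mul_sum]
      refine mul_le_mul_of_nonneg_left ?_ (pow_nonneg hs _)
      exact Finset.sum_le_sum_of_subset_of_nonneg (Finset.range_mono (by omega)) fun m _ _ => hnn m
    · intro m hm
      rw [Finset.mem_range] at hm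
      rw [if_neg (by omega), mul_zero]

end Shift

/-- Sequences of distributions whose generating series are successively multiplied by
`(1 - x s ^ n) / (1 - x s ^ (n + 1))` for `x = q ^ (-t (n + 1))`. -/
structure IsChain (q : ℝ) (t : ℕ → ℕ) (g : ℕ → ℕ → ℝ) : Prop where
  two_le : 2 ≤ q
  le_expo : ∀ n, n ≤ t n
  nonneg : ∀ n m, 0 ≤ g n m
  zero : ∀ m, g 0 m = if m = 0 then 1 else 0
  step : ∀ n m, g (n + 1) m -
      (q ^ t (n + 1))⁻¹ * (if n + 1 ≤ m then g (n + 1) (m - (n + 1)) else 0) =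
    g n m - (q ^ t (n + 1))⁻¹ * (if n ≤ m then g n (m - n) else 0)

namespace IsChain

variable {q : ℝ} {t : ℕ → ℕ} {g : ℕ → ℕ → ℝ}

/-- Summing `step` against w moves the shift of the law onto the weight. It is used with w(m) = s^m,
m and m². -/
theorem weighted (h : IsChain q t g) {n : ℕ} {w : ℕ → ℝ} {a a' b b' : ℝ}
    (ha' : HasSum (fun m => w m * g (n + 1) m) a')
    (hb' : HasSum (fun m => w (m + (n + 1)) * g (n + 1) m) b')
    (ha : HasSum (fun m => w m * g n m) a) (hb : HasSum (fun m => w (m + n) * g n m) b) :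
    a' - (q ^ t (n + 1))⁻¹ * b' = a - (q ^ t (n + 1))⁻¹ * b := by
  refine (ha'.sub ((hasSum_shift hb').mul_left _)).unique ?_
  convert ha.sub ((hasSum_shift hb).mul_left _) using 2 with m
  linear_combination w m * h.step n m

theorem hasSum_zero (h : IsChain q t g) (w : ℕ → ℝ) : HasSum (fun m => w m * g 0 m) (w 0) := by
  convert hasSum_ite_eq 0 (w 0) using 2 with m
  rw [h.zero]
  split_ifs with hm
  · rw [hm, mul_one]
  · rw [mul_zero]

theorem inv_mul_pow_le (h : IsChain q t g) {s : ℝ} (hs : 0 ≤ s) (n : ℕ) :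
    (q ^ t n)⁻¹ * s ^ n ≤ (s / q) ^ n := by
  have hq : 1 ≤ q := by linarith [h.two_le]
  rw [div_pow, div_eq_mul_inv, mul_comm]
  exact mul_le_mul_of_nonneg_left
    (inv_anti₀ (by positivity) (pow_le_pow_right₀ hq (h.le_expo n))) (pow_nonneg hs _)

theorem inv_mul_pow_lt_one (h : IsChain q t g) {s : ℝ} (hs : 0 ≤ s) (hsq : s < q) (n : ℕ) :
    (q ^ t (n + 1))⁻¹ * s ^ (n + 1) < 1 := by
  refine (h.inv_mul_pow_le hs _).trans_lt (pow_lt_one₀ ?_ ?_ (by omega))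
  · exact div_nonneg hs (hs.trans hsq.le)
  · exact (div_lt_one (hs.trans_lt hsq)).2 hsq

/-- A partial sum for n + 1 is at most the full sum for n plus q^(-t) s^(n+1) times itself; this
factor is < 1, so the last term is absorbed. -/
theorem summable (h : IsChain q t g) {s : ℝ} (hs : 0 ≤ s) (hsq : s < q) (n : ℕ) :
    Summable fun m => s ^ m * g n m := by
  induction n with
  | zero => exact (h.hasSum_zero _).summable
  | succ n ih =>
    have hx := h.inv_mul_pow_lt_one hs hsq n
    have hq : 0 < q := by linarith [h.two_le]
    have hx0 : 0 ≤ (q ^ t (n + 1))⁻¹ := by positivity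
    set x := (q ^ t (n + 1))⁻¹
    have hnn : ∀ k m, 0 ≤ s ^ m * g k m := fun k m => mul_nonneg (pow_nonneg hs _) (h.nonneg _ _)
    refine summable_of_sum_range_le (c := (∑' m, s ^ m * g n m) / (1 - x * s ^ (n + 1)))
      (hnn _) fun N => ?_
    rw [le_div_iff₀ (by linarith)]
    have h1 : ∑ m ∈ Finset.range N, s ^ m * g (n + 1) m ≤ ∑ m ∈ Finset.range N, s ^ m * g n m +
        x * ∑ m ∈ Finset.range N,
          s ^ m * (if n + 1 ≤ m then g (n + 1) (m - (n + 1)) else 0) := by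
      rw [Finset.mul_sum, ← Finset.sum_add_distrib]
      refine Finset.sum_le_sum fun m _ => ?_
      have h2 := h.step n m
      have h3 : 0 ≤ x * (if n ≤ m then g n (m - n) else 0) := by
        refine mul_nonneg hx0 ?_
        split_ifs
        · exact h.nonneg _ _
        · exact le_rfl
      have h4 : g (n + 1) m ≤ g n m +
          x * (if n + 1 ≤ m then g (n + 1) (m - (n + 1)) else 0) := by linarith
      calc _ ≤ s ^ m * (g n m + x * (if n + 1 ≤ m then g (n + 1) (m - (n + 1)) else 0)) :=
            mul_le_mul_of_nonneg_left h4 (pow_nonneg hs _)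
        _ = _ := by ring
    have h2 := mul_le_mul_of_nonneg_left (sum_range_shift_le (h.nonneg (n + 1)) hs (n + 1) N) hx0
    have h3 := ih.sum_le_tsum (Finset.range N) fun m _ => hnn n m
    linarith

/-- The probability generating function of a member of the chain. -/
noncomputable def _root_.SubresVal.pgf (g : ℕ → ℕ → ℝ) (n : ℕ) (s : ℝ) : ℝ := ∑' m, s ^ m * g n m

theorem pgf_zero (h : IsChain q t g) (s : ℝ) : pgf g 0 s = 1 := by
  simpa [pgf] using (h.hasSum_zero fun m => s ^ m).tsum_eq

theorem pgf_succ (h : IsChain q t g) {s : ℝ} (hs : 0 ≤ s) (hsq : s < q) (n : ℕ) :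
    pgf g (n + 1) s * (1 - (q ^ t (n + 1))⁻¹ * s ^ (n + 1)) =
      pgf g n s * (1 - (q ^ t (n + 1))⁻¹ * s ^ n) := by
  have key : ∀ k, HasSum (fun m => s ^ (m + k) * g k m) (s ^ k * pgf g k s) := by
    intro k
    have e : (fun m => s ^ (m + k) * g k m) = fun m => s ^ k * (s ^ m * g k m) := by
      funext m; ring
    rw [e]
    exact (h.summable hs hsq k).hasSum.mul_left (s ^ k)
  have := h.weighted (n := n) (w := fun m => s ^ m) (h.summable hs hsq _).hasSum (key (n + 1))
    (h.summable hs hsq _).hasSum (key n)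
  unfold pgf at this ⊢
  linear_combination this

theorem pgf_nonneg (h : IsChain q t g) {s : ℝ} (hs : 0 ≤ s) (n : ℕ) : 0 ≤ pgf g n s :=
  tsum_nonneg fun _ => mul_nonneg (pow_nonneg hs _) (h.nonneg _ _)

theorem pgf_one (h : IsChain q t g) (n : ℕ) : pgf g n 1 = 1 := by
  induction n with
  | zero => exact h.pgf_zero 1
  | succ n ih =>
    have hq : 1 < q := by linarith [h.two_le]
    have h1 := h.pgf_succ zero_le_one hq n
    have h2 := h.inv_mul_pow_lt_one zero_le_one hq n
    rw [one_pow] at h1 h2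
    rw [one_pow, ih] at h1
    exact mul_right_cancel₀ (by linarith) h1

theorem hasSum_one (h : IsChain q t g) (n : ℕ) : HasSum (g n) 1 := by
  have hq : 1 < q := by linarith [h.two_le]
  have h1 := (h.summable zero_le_one hq n).hasSum
  rw [← pgf, h.pgf_one] at h1
  simpa using h1

theorem summable_pow_mul (h : IsChain q t g) (k n : ℕ) : Summable fun m : ℕ => (m : ℝ) ^ k * g n m := by
  -- Any s with 1 < s < q would do, as s^m dominates every power of m.
  have hq : (3 / 2 : ℝ) < q := by linarith [h.two_le]
  refine summable_of_isBigO_nat (h.summable (by norm_num) hq n) ?_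
  exact (isLittleO_pow_const_const_pow_of_one_lt k (by norm_num)).isBigO.mul
    (Asymptotics.isBigO_refl _ _)

/-- The mean of a member of the chain. -/
noncomputable def _root_.SubresVal.chainMean (q : ℝ) (t : ℕ → ℕ) (n : ℕ) : ℝ :=
  ∑ i ∈ Finset.range n, 1 / (q ^ t (i + 1) - 1)

/-- The variance of a member of the chain. -/
noncomputable def _root_.SubresVal.chainVar (q : ℝ) (t : ℕ → ℕ) (n : ℕ) : ℝ :=
  ∑ i ∈ Finset.range n, (2 * i + 1) * q ^ t (i + 1) / (q ^ t (i + 1) - 1) ^ 2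

theorem one_lt_pow (h : IsChain q t g) (n : ℕ) : 1 < q ^ t (n + 1) :=
  one_lt_pow₀ (by linarith [h.two_le]) (by have := h.le_expo (n + 1); omega)

/-- At s = 1 the factor (1 - x s^n) / (1 - x s^(n+1)) has logarithmic derivative x / (1 - x) = 1 /
(q^t - 1), where x = q^(-t). -/
theorem hasSum_mean (h : IsChain q t g) (n : ℕ) :
    HasSum (fun m : ℕ => (m : ℝ) * g n m) (chainMean q t n) := by
  induction n with
  | zero => simpa [chainMean] using h.hasSum_zero fun m : ℕ => (m : ℝ)
  | succ n ih =>
    have hs : Summable fun m : ℕ => (m : ℝ) * g (n + 1) m := by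
      simpa using h.summable_pow_mul 1 (n + 1)
    have key : ∀ {k a}, HasSum (fun m : ℕ => (m : ℝ) * g k m) a →
        HasSum (fun m : ℕ => ((m + k : ℕ) : ℝ) * g k m) (a + k) := by
      intro k a ha
      convert ha.add ((h.hasSum_one k).mul_left (k : ℝ)) using 2 with m
      · push_cast; ring
      · ring
    have h1 := h.weighted (n := n) (w := fun m : ℕ => (m : ℝ)) hs.hasSum (key hs.hasSum) ih (key ih)
    have h2 := h.one_lt_pow n
    have h3 : ∑' m : ℕ, (m : ℝ) * g (n + 1) m = chainMean q t (n + 1) := by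
      rw [chainMean, Finset.sum_range_succ, ← chainMean]
      set E := ∑' m : ℕ, (m : ℝ) * g (n + 1) m
      set y := q ^ t (n + 1)
      have hy0 : y ≠ 0 := by linarith
      have hy1 : y - 1 ≠ 0 := by linarith
      push_cast at h1
      field_simp at h1 ⊢
      linear_combination h1
    rw [← h3]
    exact hs.hasSum

/-- The same factor adds ((n+1)² - n²) x / (1 - x)² to the variance, hence the weight 2n + 1. -/
theorem hasSum_sq (h : IsChain q t g) (n : ℕ) :
    HasSum (fun m : ℕ => (m : ℝ) ^ 2 * g n m) (chainVar q t n + chainMean q t n ^ 2) := by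
  induction n with
  | zero => simpa [chainMean, chainVar, -ne_eq] using h.hasSum_zero fun m : ℕ => (m : ℝ) ^ 2
  | succ n ih =>
    have hs := h.summable_pow_mul 2 (n + 1)
    have key : ∀ {k a}, HasSum (fun m : ℕ => (m : ℝ) ^ 2 * g k m) a →
        HasSum (fun m : ℕ => ((m + k : ℕ) : ℝ) ^ 2 * g k m)
          (a + 2 * k * chainMean q t k + k ^ 2) := by
      intro k a ha
      convert (ha.add ((h.hasSum_mean k).mul_left (2 * k : ℝ))).add
        ((h.hasSum_one k).mul_left ((k : ℝ) ^ 2)) using 2 with m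
      · push_cast; ring
      · ring
    have h1 := h.weighted (n := n) (w := fun m : ℕ => (m : ℝ) ^ 2) hs.hasSum (key hs.hasSum) ih (key ih)
    have h2 := h.one_lt_pow n
    have h3 : ∑' m : ℕ, (m : ℝ) ^ 2 * g (n + 1) m =
        chainVar q t (n + 1) + chainMean q t (n + 1) ^ 2 := by
      have e1 : chainMean q t (n + 1) = chainMean q t n + 1 / (q ^ t (n + 1) - 1) := by
        rw [chainMean, Finset.sum_range_succ, ← chainMean]
      rw [e1] at h1
      rw [e1, chainVar, Finset.sum_range_succ, ← chainVar]
      set F := ∑' m : ℕ, (m : ℝ) ^ 2 * g (n + 1) m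
      set y := q ^ t (n + 1)
      set E := chainMean q t n
      set V := chainVar q t n
      have hy0 : y ≠ 0 := by linarith
      have hy1 : y - 1 ≠ 0 := by linarith
      push_cast at h1
      field_simp at h1 ⊢
      clear_value F E V y
      linear_combination h1
    rw [← h3]
    exact hs.hasSum

/-- The numerators are at most 1 and are dropped; exponents t n ≥ n bound the denominators. -/
theorem pgf_le_prod (h : IsChain q t g) {s : ℝ} (hs : 1 ≤ s) (hsq : s < q) (n : ℕ) :
    pgf g n s ≤ ∏ i ∈ Finset.range n, (1 - (s / q) ^ (i + 1))⁻¹ := by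
  have hs0 : 0 ≤ s := by linarith
  induction n with
  | zero => rw [h.pgf_zero]; simp
  | succ n ih =>
    rw [Finset.prod_range_succ]
    have h1 := h.pgf_succ hs0 hsq n
    have h2 := h.inv_mul_pow_lt_one hs0 hsq n
    have h3 := h.inv_mul_pow_le hs0 (n + 1)
    have h4 : 0 ≤ (q ^ t (n + 1))⁻¹ * s ^ n := by
      have := h.two_le; positivity
    have h5 : (s / q) ^ (n + 1) < 1 :=
      pow_lt_one₀ (div_nonneg hs0 (by linarith)) ((div_lt_one (by linarith)).2 hsq) (by omega)
    rw [← div_eq_mul_inv, le_div_iff₀ (by linarith)]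
    have h6 := h.pgf_nonneg hs0 (n + 1)
    have h7 := h.pgf_nonneg hs0 n
    calc pgf g (n + 1) s * (1 - (s / q) ^ (n + 1))
        ≤ pgf g (n + 1) s * (1 - (q ^ t (n + 1))⁻¹ * s ^ (n + 1)) :=
          mul_le_mul_of_nonneg_left (by linarith) h6
      _ = pgf g n s * (1 - (q ^ t (n + 1))⁻¹ * s ^ n) := h1
      _ ≤ pgf g n s * 1 := mul_le_mul_of_nonneg_left (by linarith) h7
      _ ≤ _ := by rw [mul_one]; exact ih

/-- Markov's inequality for s^V. -/
theorem tail_le (h : IsChain q t g) {s : ℝ} (hs : 1 ≤ s) (hsq : s < q) (n m : ℕ) :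
    s ^ m * (1 - ∑ k ∈ Finset.range m, g n k) ≤ pgf g n s := by
  have hs0 : 0 ≤ s := by linarith
  have h1 : HasSum (fun k => g n (k + m)) (1 - ∑ k ∈ Finset.range m, g n k) := by
    exact (hasSum_nat_add_iff' m).2 (h.hasSum_one n)
  have h2 := h.summable hs0 hsq n
  rw [pgf, ← h2.sum_add_tsum_nat_add m]
  have h3 : s ^ m * (1 - ∑ k ∈ Finset.range m, g n k) ≤ ∑' k, s ^ (k + m) * g n (k + m) := by
    refine hasSum_le (fun k => ?_) (h1.mul_left (s ^ m)) ((summable_nat_add_iff m).2 h2).hasSum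
    exact mul_le_mul_of_nonneg_right (pow_le_pow_right₀ hs (by omega)) (h.nonneg _ _)
  have h4 : 0 ≤ ∑ k ∈ Finset.range m, s ^ k * g n k :=
    Finset.sum_nonneg fun k _ => mul_nonneg (pow_nonneg hs0 _) (h.nonneg _ _)
  linarith

end IsChain

/-! ### The product bounding the generating function near its pole q. -/

section Bounds

theorem one_add_quadratic_le_pow {a : ℝ} (ha : 0 ≤ a) (k : ℕ) :
    1 + k * a + k * (k - 1) / 2 * a ^ 2 ≤ (1 + a) ^ k := by
  induction k with
  | zero => simp
  | succ k ih =>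
    rw [pow_succ]
    refine le_trans ?_ (mul_le_mul_of_nonneg_right ih (by positivity))
    have h1 : 0 ≤ (k : ℝ) * (k - 1) := by
      rcases k with _ | k
      · simp
      · push_cast; rw [add_sub_cancel_right]; positivity
    have h2 : 0 ≤ (k : ℝ) * (k - 1) * a ^ 3 := by positivity
    push_cast
    nlinarith

theorem inv_one_sub_pow_le {N k : ℕ} (hk : 1 ≤ k) (hkN : k ≤ N) :
    (1 - ((N : ℝ) / (N + 1)) ^ k)⁻¹ ≤ 2 * N / k := by
  have hN : (0 : ℝ) < N := by exact_mod_cast (by omega : 0 < N)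
  have hk0 : (0 : ℝ) < k := by exact_mod_cast hk
  have hkN' : (k : ℝ) ≤ N := by exact_mod_cast hkN
  have h1 := one_add_mul_le_pow (a := 1 / (N : ℝ)) (by linarith [one_div_pos.2 hN]) k
  have e : (1 + 1 / (N : ℝ)) = ((N : ℝ) / (N + 1))⁻¹ := by field_simp
  rw [e, inv_pow] at h1
  set u := ((N : ℝ) / (N + 1)) ^ k
  have hu : 0 < u := by positivity
  have h2 : u ≤ (1 + (k : ℝ) * (1 / N))⁻¹ := (le_inv_comm₀ (by positivity) hu).1 h1
  rw [inv_le_comm₀ _ (by positivity), inv_div]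
  · refine le_trans ?_ (sub_le_sub_left h2 1)
    rw [div_le_iff₀ (by positivity)]
    have : 1 - (1 + (k : ℝ) * (1 / N))⁻¹ = k / (N + k) := by field_simp; ring
    rw [this, div_mul_eq_mul_div, le_div_iff₀ (by positivity)]
    nlinarith
  · have : (1 + (k : ℝ) * (1 / N))⁻¹ < 1 := inv_lt_one_of_one_lt₀ (by
      have : 0 < (k : ℝ) * (1 / N) := by positivity
      linarith)
    linarith

/-- For the factors beyond N, where Bernoulli's inequality is too weak: the quadratic term of (1 +
1/N)^(k+1) yields 2N² / (k(k+1)), which telescopes. -/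
theorem inv_one_sub_pow_le_exp {N k : ℕ} (hN : 1 ≤ N) (hk : 1 ≤ k) :
    (1 - ((N : ℝ) / (N + 1)) ^ (k + 1))⁻¹ ≤
      Real.exp (2 * N ^ 2 * (1 / k - 1 / (k + 1 : ℕ))) := by
  have hN : (0 : ℝ) < N := by exact_mod_cast hN
  have hk0 : (0 : ℝ) < k := by exact_mod_cast hk
  have h1 := one_add_quadratic_le_pow (a := 1 / (N : ℝ)) (by positivity) (k + 1)
  have e : (1 + 1 / (N : ℝ)) = ((N : ℝ) / (N + 1))⁻¹ := by field_simp
  rw [e, inv_pow] at h1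
  set u := ((N : ℝ) / (N + 1)) ^ (k + 1)
  have hu : 0 < u := by positivity
  set c : ℝ := (k + 1) * k / (2 * N ^ 2) with hc
  have hc0 : 0 < c := by positivity
  have h2 : 1 + c ≤ u⁻¹ := by
    refine le_trans ?_ h1
    have : 0 ≤ ((k + 1 : ℕ) : ℝ) * (1 / N) := by positivity
    have e2 : ((k + 1 : ℕ) : ℝ) * ((k + 1 : ℕ) - 1) / 2 * (1 / (N : ℝ)) ^ 2 = c := by
      push_cast; rw [hc]; field_simp; ring
    linarith
  have h3 : u ≤ (1 + c)⁻¹ := (le_inv_comm₀ (by positivity) hu).1 h2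
  have h4 : 1 - (1 + c)⁻¹ = (1 + 1 / c)⁻¹ := by field_simp; ring
  have h5 : (1 - u)⁻¹ ≤ 1 + 1 / c := by
    rw [inv_le_comm₀ _ (by positivity), ← h4]
    · linarith
    · have : 0 < (1 + 1 / c)⁻¹ := by positivity
      linarith
  refine h5.trans ?_
  have e3 : 1 / c = 2 * N ^ 2 * (1 / k - 1 / (k + 1 : ℕ)) := by
    push_cast; rw [hc]; field_simp; ring
  rw [e3, add_comm]
  exact Real.add_one_le_exp _

/-- The first N factors contribute at most (2N)^N / N! ≤ e^(2N), and the later ones at most exp(2N²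
· 1/N) = e^(2N). -/
theorem prod_inv_le {N : ℕ} (hN : 1 ≤ N) (n : ℕ) :
    ∏ i ∈ Finset.range n, (1 - ((N : ℝ) / (N + 1)) ^ (i + 1))⁻¹ ≤ Real.exp (4 * N) := by
  have hN0 : (0 : ℝ) < N := by exact_mod_cast hN
  have hpos : ∀ i : ℕ, 0 ≤ (1 - ((N : ℝ) / (N + 1)) ^ (i + 1))⁻¹ := fun i => by
    refine inv_nonneg.2 (sub_nonneg.2 (pow_le_one₀ (by positivity) ?_))
    rw [div_le_one (by positivity)]; linarith
  have low : ∀ n ≤ N, ∏ i ∈ Finset.range n, (1 - ((N : ℝ) / (N + 1)) ^ (i + 1))⁻¹ ≤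
      Real.exp (2 * N) := by
    intro n hn
    have h1 : ∀ n : ℕ, ∏ i ∈ Finset.range n, (2 * N / (i + 1 : ℕ) : ℝ) =
        (2 * N : ℝ) ^ n / n.factorial := by
      intro n
      induction n with
      | zero => simp
      | succ n ih =>
        rw [Finset.prod_range_succ, ih, Nat.factorial_succ]
        push_cast
        field_simp
        ring
    refine (Finset.prod_le_prod (fun i _ => hpos i) fun i hi => ?_).trans
      ((h1 n).trans_le (Real.pow_div_factorial_le_exp _ (by positivity) n))
    rw [Finset.mem_range] at hi
    exact inv_one_sub_pow_le (by omega) (by omega)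
  have high : ∀ n, N ≤ n → ∏ i ∈ Finset.range n, (1 - ((N : ℝ) / (N + 1)) ^ (i + 1))⁻¹ ≤
      Real.exp (2 * N + 2 * N ^ 2 * (1 / N - 1 / n)) := by
    intro n hn
    induction n, hn using Nat.le_induction with
    | base => simpa using low N le_rfl
    | succ n hn ih =>
      rw [Finset.prod_range_succ]
      refine (mul_le_mul ih (inv_one_sub_pow_le_exp hN (hN.trans hn)) (hpos n)
        (Real.exp_nonneg _)).trans_eq ?_
      rw [← Real.exp_add]
      congr 1
      ring
  rcases le_total n N with hn | hn
  · exact (low n hn).trans (Real.exp_le_exp.2 (by linarith))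
  · refine (high n hn).trans (Real.exp_le_exp.2 ?_)
    have h1 : (0 : ℝ) ≤ 2 * N ^ 2 * (1 / n) := by positivity
    have h2 : 2 * (N : ℝ) ^ 2 * (1 / N) = 2 * N := by field_simp
    rw [mul_sub, h2]
    linarith

end Bounds

namespace IsChain

variable {q : ℝ} {t : ℕ → ℕ} {g : ℕ → ℕ → ℝ}

theorem tail_le_exp (h : IsChain q t g) (n m : ℕ) :
    1 - ∑ k ∈ Finset.range m, g n k ≤ (q ^ m)⁻¹ * Real.exp (9 * √(m : ℝ)) := by
  rcases Nat.eq_zero_or_pos m with rfl | hm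
  · simp
  have hq := h.two_le
  have hm1 : (1 : ℝ) ≤ m := by exact_mod_cast hm
  have hs1 : 1 ≤ √(m : ℝ) := Real.one_le_sqrt.2 hm1
  -- Markov's inequality is taken at s = qN/(N+1). The product costs e^(4N) ≤ e^(8√m) and (1 +
  -- 1/N)^m costs e^(m/N) ≤ e^(√m), whence the constant 9.
  set N := ⌈√(m : ℝ)⌉₊ with hNdef
  have hN1 : √(m : ℝ) ≤ N := Nat.le_ceil _
  have hN2 : (N : ℝ) ≤ 2 * √(m : ℝ) := by
    have := Nat.ceil_lt_add_one (Real.sqrt_nonneg (m : ℝ))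
    linarith
  have hNr : (1 : ℝ) ≤ N := hs1.trans hN1
  have hN : 1 ≤ N := by exact_mod_cast hNr
  set θ : ℝ := (N : ℝ) / (N + 1) with hθ
  have hθ0 : 0 < θ := by positivity
  have hθ1 : θ < 1 := by rw [hθ, div_lt_one (by positivity)]; linarith
  have hθ2 : 1 / 2 ≤ θ := by rw [hθ, div_le_div_iff₀ (by norm_num) (by positivity)]; linarith
  have h1 := h.tail_le (s := q * θ) (by nlinarith) (by nlinarith) n m
  have h2 := h.pgf_le_prod (s := q * θ) (by nlinarith) (by nlinarith) n
  rw [mul_div_cancel_left₀ _ (by linarith)] at h2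
  have h3 := h1.trans (h2.trans (prod_inv_le hN n))
  have h4 : (θ ^ m)⁻¹ ≤ Real.exp (√(m : ℝ)) := by
    have e : θ⁻¹ = 1 / N + 1 := by rw [hθ]; field_simp; ring
    rw [← inv_pow, e]
    refine (pow_le_pow_left₀ (by positivity) (Real.add_one_le_exp _) m).trans ?_
    rw [← Real.exp_nat_mul]
    refine Real.exp_le_exp.2 ?_
    rw [mul_one_div, div_le_iff₀ (by positivity)]
    calc (m : ℝ) = √(m : ℝ) * √(m : ℝ) := (Real.mul_self_sqrt (by positivity)).symm
      _ ≤ _ := mul_le_mul_of_nonneg_left hN1 (by positivity)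
  rw [mul_pow, mul_comm, ← le_div_iff₀ (by positivity)] at h3
  refine h3.trans ?_
  rw [div_eq_mul_inv, mul_inv]
  calc Real.exp (4 * N) * ((q ^ m)⁻¹ * (θ ^ m)⁻¹)
      = (q ^ m)⁻¹ * (Real.exp (4 * N) * (θ ^ m)⁻¹) := by ring
    _ ≤ (q ^ m)⁻¹ * (Real.exp (8 * √(m : ℝ)) * Real.exp (√(m : ℝ))) := by
        refine mul_le_mul_of_nonneg_left (mul_le_mul ?_ h4 (by positivity) (by positivity))
          (by positivity)
        exact Real.exp_le_exp.2 (by linarith)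
    _ = _ := by rw [← Real.exp_add]; ring_nf

end IsChain

/-! ### Uniform bounds for the mean and the variance. -/

section Moments

variable {q : ℝ} {t : ℕ → ℕ}

theorem pow_mul_sub_one_le (hq : 2 ≤ q) (ht : ∀ n, n ≤ t n) (i : ℕ) :
    q ^ i * (q - 1) ≤ q ^ t (i + 1) - 1 := by
  have h1 : q ^ (i + 1) ≤ q ^ t (i + 1) := pow_le_pow_right₀ (by linarith) (ht _)
  have h2 : 1 ≤ q ^ i := one_le_pow₀ (by linarith)
  rw [pow_succ] at h1
  linarith

/-- Comparison with the series of 1 / (q^i (q-1)). The induction carries the remaining tail of this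
series, whose positivity makes the inequality strict. -/
theorem chainMean_lt (hq : 2 ≤ q) (ht : ∀ n, n ≤ t n) (n : ℕ) :
    chainMean q t n < q / (q - 1) ^ 2 := by
  have hq1 : 0 < q - 1 := by linarith
  have key : chainMean q t n + (q ^ n)⁻¹ * (q / (q - 1) ^ 2) ≤ q / (q - 1) ^ 2 := by
    induction n with
    | zero => simp [chainMean]
    | succ n ih =>
      rw [chainMean, Finset.sum_range_succ, ← chainMean]
      refine le_trans ?_ ih
      have h1 : 1 / (q ^ t (n + 1) - 1) ≤ 1 / (q ^ n * (q - 1)) :=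
        one_div_le_one_div_of_le (by positivity) (pow_mul_sub_one_le hq ht n)
      have h2 : 1 / (q ^ n * (q - 1)) =
          (q ^ n)⁻¹ * (q / (q - 1) ^ 2) - (q ^ (n + 1))⁻¹ * (q / (q - 1) ^ 2) := by
        rw [pow_succ]; field_simp; ring
      linarith
  have : 0 < (q ^ n)⁻¹ * (q / (q - 1) ^ 2) := by positivity
  linarith

theorem one_div_le_chainMean (hq : 2 ≤ q) (ht : ∀ n, n ≤ t n) (h1 : t 1 = 1) {n : ℕ}
    (hn : 1 ≤ n) : 1 / (q - 1) ≤ chainMean q t n := by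
  have := Finset.single_le_sum (f := fun i => 1 / (q ^ t (i + 1) - 1)) (s := Finset.range n)
    (fun i _ => ?_) (Finset.mem_range.2 hn)
  · simpa [h1, chainMean] using this
  · have h2 := pow_mul_sub_one_le hq ht i
    have h3 : 0 ≤ q ^ i * (q - 1) := mul_nonneg (by positivity) (by linarith)
    exact one_div_nonneg.2 (h3.trans h2)

/-- As y/(y-1)² decreases for y > 1, the exponents may be lowered to their minimum; the term added
in `key` is the exact tail of the comparison series. -/
theorem chainVar_lt (hq : 2 ≤ q) (ht : ∀ n, n ≤ t n) (n : ℕ) :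
    chainVar q t n < q ^ 2 * (q + 1) / (q - 1) ^ 4 := by
  have hq1 : 0 < q - 1 := by linarith
  have key : chainVar q t n +
      (q ^ n)⁻¹ * (2 * n / (q - 1) + (q + 1) / (q - 1) ^ 2) * (q ^ 2 / (q - 1) ^ 2) ≤
      q ^ 2 * (q + 1) / (q - 1) ^ 4 := by
    induction n with
    | zero =>
      apply le_of_eq
      simp [chainVar]
      field_simp
    | succ n ih =>
      rw [chainVar, Finset.sum_range_succ, ← chainVar]
      refine le_trans ?_ ih
      have h1 : (2 * n + 1) * q ^ t (n + 1) / (q ^ t (n + 1) - 1) ^ 2 ≤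
          (2 * n + 1) * (q ^ (n + 1) / (q ^ n * (q - 1)) ^ 2) := by
        rw [mul_div_assoc]
        refine mul_le_mul_of_nonneg_left ?_ (by positivity)
        have h2 : q ^ (n + 1) ≤ q ^ t (n + 1) := pow_le_pow_right₀ (by linarith) (ht _)
        have h3 : 0 < q ^ n * (q - 1) := by positivity
        have h4 : q ^ n * (q - 1) ≤ q ^ (n + 1) - 1 := by
          have : 1 ≤ q ^ n := one_le_pow₀ (by linarith)
          rw [pow_succ]; linarith
        set y := q ^ t (n + 1)
        set z := q ^ (n + 1)
        refine le_trans ?_ (div_le_div_of_nonneg_left (by positivity) (by positivity)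
          (pow_le_pow_left₀ h3.le h4 2))
        rw [div_le_div_iff₀ (by nlinarith) (by nlinarith)]
        have h5 : 0 ≤ (y - z) * (y * z - 1) := mul_nonneg (by linarith) (by nlinarith)
        nlinarith
      have h2 : (2 * n + 1) * (q ^ (n + 1) / (q ^ n * (q - 1)) ^ 2) =
          (q ^ n)⁻¹ * (2 * n / (q - 1) + (q + 1) / (q - 1) ^ 2) * (q ^ 2 / (q - 1) ^ 2) -
          (q ^ (n + 1))⁻¹ * (2 * (n + 1 : ℕ) / (q - 1) + (q + 1) / (q - 1) ^ 2) *
            (q ^ 2 / (q - 1) ^ 2) := by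
        push_cast
        rw [pow_succ]
        field_simp
        ring
      linarith
  have : 0 < (q ^ n)⁻¹ * (2 * n / (q - 1) + (q + 1) / (q - 1) ^ 2) * (q ^ 2 / (q - 1) ^ 2) := by
    positivity
  linarith

theorem div_le_chainVar (hq : 2 ≤ q) (h1 : t 1 = 1) {n : ℕ} (hn : 1 ≤ n) :
    q / (q - 1) ^ 2 ≤ chainVar q t n := by
  have := Finset.single_le_sum
    (f := fun i : ℕ => (2 * i + 1) * q ^ t (i + 1) / (q ^ t (i + 1) - 1) ^ 2) (s := Finset.range n)
    (fun i _ => by positivity) (Finset.mem_range.2 hn)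
  simpa [h1, chainVar] using this

end Moments

/-! ### The laws of the valuations form a chain. -/

section Law

variable {W : Type*} [CommRing W] [IsDomain W] [IsDiscreteValuationRing W]
  [Finite (ResidueField W)] [TopologicalSpace W] [MeasurableSpace W] [BorelSpace W]

theorem isChain_tailProb (h : IsAdic (maximalIdeal W)) (μ : Measure W) [μ.IsAddHaarMeasure]
    [IsProbabilityMeasure μ] (j : ℕ) :
    IsChain (Nat.card (ResidueField W) : ℝ) (expo j)
      fun n m => tailProb μ (n + j) j m - tailProb μ (n + j) j (m + 1) := by
  have ht := isTail_tailProb h μ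
  have hq : 2 ≤ Nat.card (ResidueField W) := Finite.one_lt_card
  constructor
  · exact_mod_cast hq
  · intro n; unfold expo; omega
  · intro n m
    refine sub_nonneg.2 (measureReal_mono fun ω hω => ?_)
    exact le_trans (b := ((m + 1 : ℕ) : ℕ∞)) (by exact_mod_cast Nat.le_succ m) hω
  · intro m
    have := congrArg (PowerSeries.coeff m) (ht.gen_self j)
    rw [gen, PowerSeries.coeff_mk, PowerSeries.coeff_one] at this
    rw [zero_add]
    exact this
  · intro n m
    have := congrArg (PowerSeries.coeff m)
      (ht.gen_step (by exact_mod_cast (by omega : Nat.card (ResidueField W) ≠ 0)) n j)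
    rw [map_sub, map_sub, PowerSeries.coeff_C_mul, PowerSeries.coeff_C_mul,
      PowerSeries.coeff_X_pow_mul', PowerSeries.coeff_X_pow_mul'] at this
    simpa only [gen, PowerSeries.coeff_mk] using this

end Law

/-! ### The permutation σ and the sorted exponents. -/

section Exponents

theorem expo_strictMono (j : ℕ) : StrictMonoOn (expo j) (Set.Ici 1) := by
  intro a ha b _ hab
  have : 1 ≤ a := ha
  unfold expo
  omega

theorem sigma_injOn (d : ℕ) : Set.InjOn (sigma d) (Set.Icc 1 d) := by
  rintro a ⟨ha, ha'⟩ b ⟨hb, hb'⟩ h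
  unfold sigma at h
  split_ifs at h <;> omega

/-- The list σ(1), …, σ(d) ends with …, 4, 2, so dropping its last j entries removes 2, …, 2j, or,
if there are fewer than j even values, all of them and the largest odd values. What remains is 1, 3,
…, 2j + 1, 2j + 2, 2j + 3, …, cut after d - j terms. -/
theorem image_sigma {d j : ℕ} (hj : j < d) :
    (Finset.Icc 1 (d - j)).image (sigma d) = (Finset.Icc 1 (d - j)).image (expo j) := by
  ext m
  simp only [Finset.mem_image, Finset.mem_Icc, sigma, expo]
  constructor
  · rintro ⟨i, ⟨h1, h2⟩, rfl⟩
    split_ifs with h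
    · rcases Nat.lt_or_ge (j + 1) i with h3 | h3
      · exact ⟨2 * i - 1 - j, by omega, by omega⟩
      · exact ⟨i, by omega, by omega⟩
    · exact ⟨2 * (d + 1 - i) - j, by omega, by omega⟩
  · rintro ⟨i, ⟨h1, h2⟩, rfl⟩
    rcases Nat.lt_or_ge (j + 1) i with h3 | h3
    · rw [min_eq_right (by omega)]
      rcases Nat.even_or_odd' (i + j) with ⟨l, hl | hl⟩
      · exact ⟨d + 1 - l, by omega, by rw [if_neg (by omega)]; omega⟩
      · exact ⟨l + 1, by omega, by rw [if_pos (by omega)]; omega⟩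
    · rw [min_eq_left (by omega)]
      exact ⟨i, by omega, by rw [if_pos (by omega)]⟩

theorem sum_Icc_one (n : ℕ) (f : ℕ → ℝ) :
    ∑ i ∈ Finset.Icc 1 n, f i = ∑ i ∈ Finset.range n, f (i + 1) := by
  induction n with
  | zero => simp
  | succ n ih => rw [Finset.sum_Icc_succ_top (by omega), ih, Finset.sum_range_succ]

theorem sum_sigma {d j : ℕ} (hj : j < d) (f : ℕ → ℝ) :
    ∑ i ∈ Finset.Icc 1 (d - j), f (sigma d i) = ∑ i ∈ Finset.range (d - j), f (expo j (i + 1)) := by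
  rw [← sum_Icc_one (d - j) fun i => f (expo j i),
    ← Finset.sum_image (f := f) (g := sigma d) (s := Finset.Icc 1 (d - j)),
    ← Finset.sum_image (f := f) (g := expo j) (s := Finset.Icc 1 (d - j)), image_sigma hj]
  · intro a ha b hb h
    rw [Finset.mem_coe, Finset.mem_Icc] at ha hb
    exact (expo_strictMono j).injOn ha.1 hb.1 h
  · intro a ha b hb h
    rw [Finset.mem_coe, Finset.mem_Icc] at ha hb
    exact sigma_injOn d ⟨ha.1, by omega⟩ ⟨hb.1, by omega⟩ h

theorem tau_eq {d j i : ℕ} (hj : j < d) (hi : 1 ≤ i) (hid : i ≤ d - j) : tau d j i = expo j i := by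
  have hm := expo_strictMono j
  have hmem : expo j i ∈ (Finset.Icc 1 (d - j)).image (expo j) :=
    Finset.mem_image_of_mem _ (Finset.mem_Icc.2 ⟨hi, hid⟩)
  have hc : Nat.count (fun n => n ∈ (Finset.Icc 1 (d - j)).image (expo j)) (expo j i) = i - 1 := by
    rw [Nat.count_eq_card_filter_range]
    have e : (Finset.range (expo j i)).filter
        (fun n => n ∈ (Finset.Icc 1 (d - j)).image (expo j)) =
        (Finset.Icc 1 (i - 1)).image (expo j) := by
      ext m
      simp only [Finset.mem_filter, Finset.mem_range, Finset.mem_image, Finset.mem_Icc]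
      constructor
      · rintro ⟨h1, a, ⟨h2, h3⟩, rfl⟩
        have := (hm.lt_iff_lt h2 hi).1 h1
        exact ⟨a, by omega, rfl⟩
      · rintro ⟨a, ⟨h2, h3⟩, rfl⟩
        exact ⟨hm h2 hi (by omega), a, by omega, rfl⟩
    rw [e, Finset.card_image_of_injOn, Nat.card_Icc]
    · omega
    · intro a ha b hb h
      rw [Finset.mem_coe, Finset.mem_Icc] at ha hb
      exact hm.injOn ha.1 hb.1 h
  rw [tau, image_sigma hj, ← hc]
  exact Nat.nth_count hmem

theorem sum_sigma_eq_chainMean {d j : ℕ} (hj : j < d) (q : ℝ) :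
    ∑ i ∈ Finset.Icc 1 (d - j), 1 / (q ^ sigma d i - 1) = chainMean q (expo j) (d - j) :=
  sum_sigma hj fun m => 1 / (q ^ m - 1)

theorem sum_tau_eq_chainVar {d j : ℕ} (hj : j < d) (q : ℝ) :
    ∑ i ∈ Finset.Icc 1 (d - j), (2 * (i : ℝ) - 1) * q ^ tau d j i / (q ^ tau d j i - 1) ^ 2 =
      chainVar q (expo j) (d - j) := by
  rw [sum_Icc_one, chainVar]
  refine Finset.sum_congr rfl fun i hi => ?_
  rw [Finset.mem_range] at hi
  rw [tau_eq hj (by omega) (by omega)]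
  push_cast
  ring

end Exponents

/-! ### Expectations of random variables with values in ℕ ∪ {∞}. -/

section IntegerValued

variable {Ω : Type*} [MeasurableSpace Ω] {P : Measure Ω} {V : Ω → ℕ∞}

omit [MeasurableSpace Ω] in
theorem setOf_eq_natCast (V : Ω → ℕ∞) (n : ℕ) :
    {ω | V ω = n} = {ω | (n : ℕ∞) ≤ V ω} \ {ω | ((n + 1 : ℕ) : ℕ∞) ≤ V ω} := by
  ext ω
  simp only [Set.mem_ofPred_eq, Set.mem_sdiff, not_le]
  constructor
  · intro h; rw [h]; exact ⟨le_rfl, by exact_mod_cast Nat.lt_succ_self n⟩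
  · rintro ⟨h1, h2⟩
    lift V ω to ℕ using (h2.trans (ENat.natCast_lt_top _)).ne with v
    norm_cast at *
    omega

theorem measurable_of_le (h : ∀ i : ℕ, MeasurableSet {ω | (i : ℕ∞) ≤ V ω}) : Measurable V := by
  rw [ENat.measurable_iff]
  intro n
  rw [show V ⁻¹' {(n : ℕ∞)} = _ from setOf_eq_natCast V n]
  exact (h n).diff (h (n + 1))

theorem measurable_toReal (hV : Measurable V) : Measurable fun ω => toReal (V ω) :=
  (Measurable.of_discrete (f := toReal)).comp hV

theorem toENNReal_eq_tsum (v : ℕ∞) :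
    (v : ENNReal) = ∑' i : ℕ, if ((i + 1 : ℕ) : ℕ∞) ≤ v then 1 else 0 := by
  induction v using ENat.recTopCoe with
  | top => simp
  | coe n =>
    rw [tsum_eq_sum (s := Finset.range n)]
    · rw [Finset.sum_congr rfl (g := fun _ => 1)]
      · simp
      · intro i hi
        rw [Finset.mem_range] at hi
        rw [if_pos (by exact_mod_cast hi)]
    · intro i hi
      rw [Finset.mem_range] at hi
      rw [if_neg]
      norm_cast

theorem lintegral_eq_tsum (hV : Measurable V) :
    ∫⁻ ω, (V ω : ENNReal) ∂P = ∑' i : ℕ, P {ω | ((i + 1 : ℕ) : ℕ∞) ≤ V ω} := by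
  have hm : ∀ i : ℕ, MeasurableSet {ω | ((i + 1 : ℕ) : ℕ∞) ≤ V ω} := fun i =>
    hV (MeasurableSet.of_discrete (s := {v | ((i + 1 : ℕ) : ℕ∞) ≤ v}))
  simp only [toENNReal_eq_tsum]
  rw [lintegral_tsum]
  · refine tsum_congr fun i => ?_
    rw [← lintegral_indicator_one (hm i)]
    refine lintegral_congr fun ω => ?_
    rw [Set.indicator_apply]
    rfl
  · intro i
    exact (measurable_const.ite (hm i) measurable_const).aemeasurable

theorem ofReal_toReal {v : ℕ∞} (h : v ≠ ⊤) : ENNReal.ofReal (toReal v) = (v : ENNReal) := by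
  lift v to ℕ using h with n
  simp [toReal]

theorem toReal_nonneg (v : ℕ∞) : 0 ≤ toReal v := Nat.cast_nonneg _

theorem toReal_mono {v w : ℕ∞} (h : v ≤ w) (hw : w ≠ ⊤) : toReal v ≤ toReal w := by
  unfold toReal
  exact_mod_cast ENat.toNat_le_toNat h hw

/-- The tail-sum formula for the expectation. -/
theorem integral_toReal [IsFiniteMeasure P] (hV : Measurable V)
    (hs : Summable fun i : ℕ => P.real {ω | ((i + 1 : ℕ) : ℕ∞) ≤ V ω}) :
    (∀ᵐ ω ∂P, V ω ≠ ⊤) ∧ Integrable (fun ω => toReal (V ω)) P ∧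
      ∫ ω, toReal (V ω) ∂P = ∑' i : ℕ, P.real {ω | ((i + 1 : ℕ) : ℕ∞) ≤ V ω} := by
  have h1 : ∫⁻ ω, (V ω : ENNReal) ∂P =
      ENNReal.ofReal (∑' i : ℕ, P.real {ω | ((i + 1 : ℕ) : ℕ∞) ≤ V ω}) := by
    rw [lintegral_eq_tsum hV, ENNReal.ofReal_tsum_of_nonneg (fun _ => measureReal_nonneg) hs]
    simp
  have hm : Measurable fun ω => (V ω : ENNReal) :=
    (Measurable.of_discrete (f := ENat.toENNReal)).comp hV
  have hfin : ∀ᵐ ω ∂P, V ω ≠ ⊤ := by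
    filter_upwards [ae_lt_top hm (by rw [h1]; exact ENNReal.ofReal_ne_top)] with ω hω htop
    rw [htop] at hω
    simp at hω
  have h2 : ∫⁻ ω, ENNReal.ofReal (toReal (V ω)) ∂P =
      ENNReal.ofReal (∑' i : ℕ, P.real {ω | ((i + 1 : ℕ) : ℕ∞) ≤ V ω}) := by
    rw [← h1]
    refine lintegral_congr_ae ?_
    filter_upwards [hfin] with ω hω
    exact ofReal_toReal hω
  have hnn : 0 ≤ᵐ[P] fun ω => toReal (V ω) := Filter.Eventually.of_forall fun _ => toReal_nonneg _
  refine ⟨hfin, ?_, ?_⟩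
  · rw [← lintegral_ofReal_ne_top_iff_integrable (measurable_toReal hV).aestronglyMeasurable hnn, h2]
    exact ENNReal.ofReal_ne_top
  · rw [integral_eq_lintegral_of_nonneg_ae hnn (measurable_toReal hV).aestronglyMeasurable, h2,
      ENNReal.toReal_ofReal (tsum_nonneg fun _ => measureReal_nonneg)]

theorem ae_ne_top [IsFiniteMeasure P]
    (h : Filter.Tendsto (fun i : ℕ => P.real {ω | (i : ℕ∞) ≤ V ω}) Filter.atTop (nhds 0)) :
    ∀ᵐ ω ∂P, V ω ≠ ⊤ := by
  rw [ae_iff]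
  have h1 : P.real {ω | ¬V ω ≠ ⊤} ≤ 0 := by
    refine ge_of_tendsto h (Filter.Eventually.of_forall fun i => measureReal_mono fun ω hω => ?_)
    rw [Set.mem_ofPred_eq, not_not] at hω
    rw [Set.mem_ofPred_eq, hω]
    exact le_top
  have h2 := le_antisymm h1 measureReal_nonneg
  rwa [measureReal_eq_zero_iff] at h2

theorem measureReal_eq_natCast [IsFiniteMeasure P] (hV : Measurable V) (n : ℕ) :
    P.real {ω | V ω = n} =
      P.real {ω | (n : ℕ∞) ≤ V ω} - P.real {ω | ((n + 1 : ℕ) : ℕ∞) ≤ V ω} := by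
  rw [setOf_eq_natCast, measureReal_sdiff]
  · intro ω hω
    exact le_trans (b := ((n + 1 : ℕ) : ℕ∞)) (by exact_mod_cast Nat.le_succ n) hω
  · exact hV (MeasurableSet.of_discrete (s := {v | ((n + 1 : ℕ) : ℕ∞) ≤ v}))

/-- Expectations as sums over the values. -/
theorem integral_comp_toNat [IsFiniteMeasure P] (hV : Measurable V) (hfin : ∀ᵐ ω ∂P, V ω ≠ ⊤)
    {f : ℕ → ℝ} (hf : ∀ n, 0 ≤ f n) {a : ℝ}
    (hs : HasSum (fun n : ℕ => f n * P.real {ω | V ω = n}) a) :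
    Integrable (fun ω => f (V ω).toNat) P ∧ ∫ ω, f (V ω).toNat ∂P = a := by
  have hN : Measurable fun ω => (V ω).toNat := (Measurable.of_discrete (f := ENat.toNat)).comp hV
  have hm : Measurable fun ω => f (V ω).toNat := (Measurable.of_discrete (f := f)).comp hN
  have hnn : 0 ≤ᵐ[P] fun ω => f (V ω).toNat := Filter.Eventually.of_forall fun _ => hf _
  have ha : 0 ≤ a := hs.nonneg fun n => mul_nonneg (hf n) measureReal_nonneg
  have h2 : ∫⁻ ω, ENNReal.ofReal (f (V ω).toNat) ∂P = ENNReal.ofReal a := by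
    rw [← lintegral_map (f := fun n => ENNReal.ofReal (f n)) (Measurable.of_discrete) hN,
      lintegral_countable', ← hs.tsum_eq,
      ENNReal.ofReal_tsum_of_nonneg (fun n => mul_nonneg (hf n) measureReal_nonneg) hs.summable]
    refine tsum_congr fun n => ?_
    rw [ENNReal.ofReal_mul (hf n), Measure.map_apply hN (measurableSet_singleton n)]
    congr 1
    rw [ofReal_measureReal]
    refine measure_congr ?_
    filter_upwards [hfin] with ω hω
    refine propext ?_
    change (V ω).toNat = n ↔ V ω = n
    lift V ω to ℕ using hω with v
    simp
  refine ⟨?_, ?_⟩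
  · rw [← lintegral_ofReal_ne_top_iff_integrable hm.aestronglyMeasurable hnn, h2]
    exact ENNReal.ofReal_ne_top
  · rw [integral_eq_lintegral_of_nonneg_ae hnn hm.aestronglyMeasurable, h2,
      ENNReal.toReal_ofReal ha]

end IntegerValued

/-! ### Moments and tails of V_j. -/

section Law

variable {W : Type*} [CommRing W] [IsDomain W] [IsDiscreteValuationRing W]
  [Finite (ResidueField W)] [TopologicalSpace W] [MeasurableSpace W] [BorelSpace W]

theorem measurable_valV (h : IsAdic (maximalIdeal W)) {d j : ℕ} (hj : j ≤ d) :
    Measurable (valV (W := W) (d := d) j) :=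
  measurable_of_le fun i => measurableSet_le_valV h hj i

variable (h : IsAdic (maximalIdeal W)) (μ : Measure W) [μ.IsAddHaarMeasure]
  [IsProbabilityMeasure μ] {d j : ℕ}
include h

theorem isChain_valV (hj : j ≤ d) : ∃ g : ℕ → ℕ → ℝ,
    IsChain (Nat.card (ResidueField W) : ℝ) (expo j) g ∧
      ∀ m : ℕ, g (d - j) m = (pairMeasure μ d).real {ω | valV j ω = m} := by
  refine ⟨_, isChain_tailProb h μ j, fun m => ?_⟩
  rw [Nat.sub_add_cancel hj, measureReal_eq_natCast (measurable_valV h hj)]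
  rfl

omit [μ.IsAddHaarMeasure] in
theorem tail_valV_eq (hj : j ≤ d) {g : ℕ → ℕ → ℝ}
    (hg : ∀ m : ℕ, g (d - j) m = (pairMeasure μ d).real {ω | valV j ω = m}) (m : ℕ) :
    (pairMeasure μ d).real {ω | (m : ℕ∞) ≤ valV j ω} =
      1 - ∑ k ∈ Finset.range m, g (d - j) k := by
  induction m with
  | zero => simp
  | succ m ih =>
    rw [Finset.sum_range_succ, hg, measureReal_eq_natCast (measurable_valV h hj), ih]
    ring

theorem tail_valV_le (hj : j ≤ d) (m : ℕ) :
    (pairMeasure μ d).real {ω | (m : ℕ∞) ≤ valV j ω} ≤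
      ((Nat.card (ResidueField W) : ℝ) ^ m)⁻¹ * Real.exp (9 * √(m : ℝ)) := by
  obtain ⟨g, hc, hg⟩ := isChain_valV h μ hj
  rw [tail_valV_eq h μ hj hg]
  exact hc.tail_le_exp _ _

theorem valV_ae_ne_top (hj : j ≤ d) : ∀ᵐ ω ∂(pairMeasure μ d), valV j ω ≠ ⊤ := by
  obtain ⟨g, hc, hg⟩ := isChain_valV h μ hj
  refine ae_ne_top ?_
  simp only [tail_valV_eq h μ hj hg]
  have := (hc.hasSum_one (d - j)).tendsto_sum_nat.const_sub 1
  rwa [sub_self] at this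

theorem integral_valV (hj : j ≤ d) :
    Integrable (fun ω => toReal (valV j ω)) (pairMeasure μ d) ∧
      ∫ ω, toReal (valV j ω) ∂(pairMeasure μ d) =
        chainMean (Nat.card (ResidueField W)) (expo j) (d - j) := by
  obtain ⟨g, hc, hg⟩ := isChain_valV h μ hj
  refine integral_comp_toNat (f := fun n => (n : ℝ)) (measurable_valV h hj)
    (valV_ae_ne_top h μ hj) (fun n => Nat.cast_nonneg n) ?_
  simp only [← hg]
  exact hc.hasSum_mean _

theorem integral_sq_valV (hj : j ≤ d) :
    Integrable (fun ω => toReal (valV j ω) ^ 2) (pairMeasure μ d) ∧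
      ∫ ω, toReal (valV j ω) ^ 2 ∂(pairMeasure μ d) =
        chainVar (Nat.card (ResidueField W)) (expo j) (d - j) +
          chainMean (Nat.card (ResidueField W)) (expo j) (d - j) ^ 2 := by
  obtain ⟨g, hc, hg⟩ := isChain_valV h μ hj
  refine integral_comp_toNat (f := fun n => (n : ℝ) ^ 2) (measurable_valV h hj)
    (valV_ae_ne_top h μ hj) (fun n => by positivity) ?_
  simp only [← hg]
  exact hc.hasSum_sq _

theorem memLp_valV (hj : j ≤ d) :
    MemLp (fun ω => toReal (valV j ω)) 2 (pairMeasure μ d) :=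
  (memLp_two_iff_integrable_sq
    (measurable_toReal (measurable_valV h hj)).aestronglyMeasurable).2 (integral_sq_valV h μ hj).1

theorem variance_valV (hj : j ≤ d) :
    variance (fun ω => toReal (valV j ω)) (pairMeasure μ d) =
      chainVar (Nat.card (ResidueField W)) (expo j) (d - j) := by
  rw [variance_eq_sub (memLp_valV h μ hj), (integral_valV h μ hj).2]
  have := (integral_sq_valV h μ hj).2
  simp only [Pi.pow_apply]
  rw [this]
  ring

end Law

/-! ### The remainder of a pair having a unit principal subresultant. -/

section Remainder

variable {R : Type*} [CommRing R]

/-- `T` is the combination of degree `< e` of the pair `x` whose second cofactor is monic of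
degree `k`. -/
def IsRem (k e : ℕ) (x : R[X] × R[X]) (T : R[X]) : Prop :=
  T ∈ degreeLT R e ∧ ∃ P Q : R[X], P - X ^ k ∈ degreeLT R k ∧ Q ∈ degreeLT R k ∧
    T = P * x.2 - Q * x.1

theorem IsRem.map {S : Type*} [CommRing S] (f : R →+* S) {k e : ℕ} {x : R[X] × R[X]} {T : R[X]}
    (h : IsRem k e x T) : IsRem k e (x.1.map f, x.2.map f) (T.map f) := by
  obtain ⟨hT, P, Q, hP, hQ, rfl⟩ := h
  refine ⟨map_mem_degreeLT f hT, P.map f, Q.map f, ?_, map_mem_degreeLT f hQ, by simp⟩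
  simpa using map_mem_degreeLT f hP

/-- Division steps require k ≥ 1; the degenerate case k = 0 is needed for j = d - 1. -/
theorem isRem_zero {e : ℕ} {x : R[X] × R[X]} (hx : x ∈ monicLow R e) : IsRem 0 e x x.2 :=
  ⟨hx.2, 1, 0, by simp, by simp, by simp⟩

theorem isRem_zero_iff {e : ℕ} {x : R[X] × R[X]} (hx : x ∈ monicLow R e) {T : R[X]} :
    IsRem 0 e x T ↔ T = x.2 := by
  constructor
  · rintro ⟨-, P, Q, hP, hQ, rfl⟩
    have h1 := eq_zero_of_mem_degreeLT_zero hP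
    have h2 := eq_zero_of_mem_degreeLT_zero hQ
    rw [pow_zero, sub_eq_zero] at h1
    rw [h1, h2]; ring
  · rintro rfl
    exact isRem_zero hx

variable [Nontrivial R]

theorem isRem_compPair {k e : ℕ} (hk : 1 ≤ k) {x y : R[X] × R[X]}
    (hx : x ∈ coprimePairs R k) (hy : y ∈ monicLow R e) : IsRem k e (compPair k (x, y)) y.2 :=
  ⟨hy.2, x.1, x.2, hx.1.1, hx.1.2, (isStep_bezout hk hx hy).T_eq⟩

theorem isRem_compPair_iff {k e : ℕ} (hk : 1 ≤ k) {x y : R[X] × R[X]}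
    (hx : x ∈ coprimePairs R k) (hy : y ∈ monicLow R e) {T : R[X]} :
    IsRem k e (compPair k (x, y)) T ↔ T = y.2 := by
  constructor
  · rintro ⟨hT, P, Q, hP, hQ, hPQ⟩
    have h := isStep_bezout hk hx hy
    have hT' := h.T_eq
    simp only [compPair] at hPQ
    have h1 : (x.1 * y.1 + (bezout k x).1 * y.2) * (-(x.2 - Q)) +
        (x.2 * y.1 + (bezout k x).2 * y.2) * (x.1 - P) ∈ degreeLT R (e + (k - k)) := by
      have : (x.1 * y.1 + (bezout k x).1 * y.2) * (-(x.2 - Q)) +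
        (x.2 * y.1 + (bezout k x).2 * y.2) * (x.1 - P) = y.2 - T := by
        linear_combination hPQ - hT'
      rw [this, Nat.sub_self]
      exact sub_mem hy.2 hT
    obtain ⟨hPm, hPd⟩ := monic_of_sub_mem hP
    obtain ⟨h2, h3⟩ := h.mem_of_combination_mem le_rfl (sub_mem_of_monic h.hP h.dP hPm hPd) h1
    rw [Nat.sub_self] at h2 h3
    have h2 := eq_zero_of_mem_degreeLT_zero h2
    have h3 := eq_zero_of_mem_degreeLT_zero h3
    have hx1 : x.1 = P := by
      linear_combination (x.1 * h3 - (bezout k x).1 * h2) - (x.1 - P) * h.det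
    have hx2 : x.2 = Q := by
      linear_combination (x.2 * h3 - (bezout k x).2 * h2) - (x.2 - Q) * h.det
    rw [hPQ, ← hx1, ← hx2]
    exact hT'.symm
  · rintro rfl
    exact isRem_compPair hk hx hy

/-- Pairs whose principal subresultant of index `e` is a unit. -/
def unitPairs (R : Type*) [CommRing R] (k e : ℕ) : Set (R[X] × R[X]) :=
  {x | x ∈ monicLow R (k + e) ∧ psIdeal x.1 x.2 (k + e) e = ⊤}

omit [Nontrivial R] in
theorem unitPairs_zero (e : ℕ) : unitPairs R 0 e = monicLow R e := by
  ext x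
  rw [unitPairs, Set.mem_ofPred_eq, zero_add]
  exact and_iff_left (psIdeal_self _ _ _)

theorem exists_isRem {k e : ℕ} {x : R[X] × R[X]} (hx : x ∈ unitPairs R k e) :
    ∃ T, IsRem k e x T := by
  rcases Nat.eq_zero_or_pos k with rfl | hk
  · rw [unitPairs_zero] at hx
    exact ⟨_, isRem_zero hx⟩
  · obtain ⟨⟨y, z⟩, ⟨hy, hz⟩, rfl⟩ := (bijOn_compPair hk).surjOn hx
    exact ⟨_, isRem_compPair hk hy hz⟩

theorem IsRem.unique {k e : ℕ} {x : R[X] × R[X]} (hx : x ∈ unitPairs R k e) {T T' : R[X]}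
    (h : IsRem k e x T) (h' : IsRem k e x T') : T = T' := by
  rcases Nat.eq_zero_or_pos k with rfl | hk
  · rw [unitPairs_zero] at hx
    exact ((isRem_zero_iff hx).1 h).trans ((isRem_zero_iff hx).1 h').symm
  · obtain ⟨⟨y, z⟩, ⟨hy, hz⟩, rfl⟩ := (bijOn_compPair hk).surjOn hx
    exact ((isRem_compPair_iff hk hy hz).1 h).trans ((isRem_compPair_iff hk hy hz).1 h').symm

/-- The remainder is equidistributed. -/
theorem exists_ncard_isRem (k e : ℕ) : ∃ N : ℕ, ∀ c : R[X] → Prop,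
    {x | x ∈ unitPairs R k e ∧ ∃ T, IsRem k e x T ∧ c T}.ncard =
      N * {y : R[X] × R[X] | y ∈ monicLow R e ∧ c y.2}.ncard := by
  rcases Nat.eq_zero_or_pos k with rfl | hk
  · refine ⟨1, fun c => ?_⟩
    rw [one_mul, unitPairs_zero]
    congr 1
    ext x
    refine and_congr_right fun hx => ?_
    simp only [isRem_zero_iff hx, exists_eq_left]
  · refine ⟨(coprimePairs R k).ncard, fun c => ?_⟩
    rw [← Set.ncard_prod]
    symm
    have h := BijOn.sep (bijOn_compPair (R := R) (e := e) hk) (p := fun x => c x.2.2)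
      (q := fun x => ∃ T, IsRem k e x T ∧ c T) (by
        rintro ⟨y, z⟩ ⟨hy, hz⟩
        simp only [isRem_compPair_iff hk hy hz, exists_eq_left])
    rw [unitPairs, ← h.ncard_eq]
    congr 1
    ext x
    simp [and_assoc]

omit [Nontrivial R] in
theorem ncard_degreeLT_univ (m : ℕ) : (degreeLT R m : Set R[X]).ncard = Nat.card R ^ m := by
  rw [← Set.ncard_univ R, ← ncard_degreeLT m Set.univ trivial]
  congr 1
  ext p
  simp

omit [Nontrivial R] in
theorem ncard_monicLow_mem {m e : ℕ} (hm : m ≤ e) :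
    {y : R[X] × R[X] | y ∈ monicLow R e ∧ y.2 ∈ degreeLT R m}.ncard = Nat.card R ^ (e + m) := by
  have h1 : {y : R[X] × R[X] | y ∈ monicLow R e ∧ y.2 ∈ degreeLT R m} =
      ((fun p => X ^ e + p) '' (degreeLT R e : Set R[X])) ×ˢ (degreeLT R m : Set R[X]) := by
    ext y
    simp only [monicLow, Set.mem_ofPred_eq, Set.mem_prod, Set.mem_image, SetLike.mem_coe]
    constructor
    · rintro ⟨⟨h1, -⟩, h2⟩
      exact ⟨⟨_, h1, by ring⟩, h2⟩
    · rintro ⟨⟨p, hp, h1⟩, h2⟩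
      refine ⟨⟨?_, degreeLT_le hm h2⟩, h2⟩
      rw [← h1, add_sub_cancel_left]
      exact hp
  rw [h1, Set.ncard_prod, Set.ncard_image_of_injective _ (add_right_injective _),
    ncard_degreeLT_univ, ncard_degreeLT_univ, pow_add]

/-- Constant terms can be dropped by `psIdeal_shift` down to degree 1, where the Sylvester matrix is
2 × 2 and triangular. -/
theorem psIdeal_succ_self {S T : R[X]} {j : ℕ} (hx : (S, T) ∈ monicLow R (j + 1)) :
    psIdeal S T (j + 1) j = Ideal.span {T.coeff j} := by
  induction j generalizing S T with
  | zero =>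
    have h1 : S.coeff 1 = 1 := by
      obtain ⟨hm, hd⟩ := monic_of_sub_mem hx.1
      have h0 : S.coeff S.natDegree = 1 := hm
      rwa [show S.natDegree = 1 from hd] at h0
    have h2 : T.coeff 1 = 0 := mem_degreeLT_coeff.1 hx.2 1 (by omega)
    have h3 : principalSubresultant S T 1 1 0 = T.coeff 0 := by
      unfold principalSubresultant
      refine (Matrix.det_fin_two (sylvesterTrunc S T 1 1 0 : Matrix (Fin 2) (Fin 2) R)).trans ?_
      have e00 : (sylvesterTrunc S T 1 1 0 : Matrix (Fin 2) (Fin 2) R) 0 0 = S.coeff 1 := by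
        change (S * X ^ 0).coeff 1 = _; simp
      have e11 : (sylvesterTrunc S T 1 1 0 : Matrix (Fin 2) (Fin 2) R) 1 1 = T.coeff 0 := by
        change (T * X ^ 0).coeff 0 = _; simp
      have e01 : (sylvesterTrunc S T 1 1 0 : Matrix (Fin 2) (Fin 2) R) 0 1 = T.coeff 1 := by
        change (T * X ^ 0).coeff 1 = _; simp
      rw [e00, e11, e01, h1, h2]; ring
    rw [psIdeal, h3]
  | succ j ih =>
    have e1 : X * S.divX + C (S.coeff 0) = S := X_mul_divX_add _
    have e2 : X * T.divX + C (T.coeff 0) = T := X_mul_divX_add _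
    have hC : ∀ a : R, C a ∈ degreeLT R (j + 1 + 1) := fun a => by
      rw [mem_degreeLT_coeff]; intro i hi; rw [coeff_C, if_neg (by omega)]
    have hXm : ∀ p : R[X], p ∈ degreeLT R (j + 1) ↔ X * p ∈ degreeLT R (j + 1 + 1) := fun p => by
      rw [add_comm (j + 1), monic_mul_mem_iff monic_X natDegree_X]
    have hx' : (S.divX, T.divX) ∈ monicLow R (j + 1) := by
      constructor
      · dsimp only
        rw [hXm]
        have := sub_mem hx.1 (hC (S.coeff 0))
        dsimp only at this
        rwa [show X * (S.divX - X ^ (j + 1)) = S - X ^ (j + 1 + 1) - C (S.coeff 0) by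
          linear_combination e1]
      · dsimp only
        rw [hXm]
        have := sub_mem hx.2 (hC (T.coeff 0))
        dsimp only at this
        rwa [show X * T.divX = T - C (T.coeff 0) by linear_combination e2]
    have h1 := ih hx'
    rw [← psIdeal_shift (a := S.coeff 0) (b := T.coeff 0)
      (Monic.mem_degreeLT_succ (monic_of_sub_mem hx'.1).2) (degreeLT_le (Nat.le_succ _) hx'.2)
      (by omega) (by omega), e1, e2] at h1
    rw [h1, coeff_divX]

theorem IsRem.psIdeal_eq {k j : ℕ} {x : R[X] × R[X]} (hx : x ∈ unitPairs R k (j + 1)) {T : R[X]}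
    (h : IsRem k (j + 1) x T) : psIdeal x.1 x.2 (k + (j + 1)) j = Ideal.span {T.coeff j} := by
  rcases Nat.eq_zero_or_pos k with rfl | hk
  · rw [unitPairs_zero] at hx
    rw [(isRem_zero_iff hx).1 h, zero_add]
    exact psIdeal_succ_self hx
  · obtain ⟨⟨y, z⟩, ⟨hy, hz⟩, rfl⟩ := (bijOn_compPair hk).surjOn hx
    rw [(isRem_compPair_iff hk hy hz).1 h, ← psIdeal_succ_self hz]
    exact (isStep_bezout hk hy hz).psIdeal_eq_low (Nat.le_succ j)

end Remainder

/-! ### Subresultants as multiples of the remainder. -/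

section Cofactors

variable {R : Type*} [CommRing R]

theorem cofactorU_eq (A B : R[X]) (d j : ℕ) : cofactorU A B d d j = polyOfCoords (d - j)
    (fun k : Fin (d - j) => cofactorCoords A B d d j (Fin.castAdd (d - j) k)) := by
  rw [polyOfCoords_apply]; rfl

theorem cofactorV_eq (A B : R[X]) (d j : ℕ) : cofactorV A B d d j = polyOfCoords (d - j)
    (fun k : Fin (d - j) => cofactorCoords A B d d j (Fin.natAdd (d - j) k)) := by
  rw [polyOfCoords_apply]; rfl

/-- Combinations of degree at most `j` are proportional to the `j`-th subresultant. -/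
theorem C_mul_combination {A B U V : R[X]} {d j : ℕ} (hj : j ≤ d) (hU : U ∈ degreeLT R (d - j)) (hV : V ∈ degreeLT R (d - j))
    (h : A * U + B * V ∈ degreeLT R (j + 1)) :
    C (principalSubresultant A B d d j) * (A * U + B * V) =
      C ((A * U + B * V).coeff j) * subresultant A B d d j := by
  set T := A * U + B * V with hT
  set M := sylvesterTrunc A B d d j with hM
  let y : Fin ((d - j) + (d - j)) → R :=
    Fin.addCases (fun k : Fin (d - j) => U.coeff (d - j - 1 - k))
      (fun k : Fin (d - j) => V.coeff (d - j - 1 - k))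
  have hyU : polyOfCoords (d - j) (fun k : Fin (d - j) => y (Fin.castAdd (d - j) k)) = U := by
    simp only [y, Fin.addCases_left]
    exact exists_polyOfCoords hU
  have hyV : polyOfCoords (d - j) (fun k : Fin (d - j) => y (Fin.natAdd (d - j) k)) = V := by
    simp only [y, Fin.addCases_right]
    exact exists_polyOfCoords hV
  have h1 : M.mulVec y = T.coeff j • truncCoords d d j (X ^ j) := by
    rw [hM, mulVec_sylvesterTrunc, hyU, hyV]
    ext i
    simp only [truncCoords, Pi.smul_apply, smul_eq_mul, coeff_X_pow, ← hT]
    split_ifs with hi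
    · rw [hi, mul_one]
    · rw [mul_zero]
      have := i.2
      exact mem_degreeLT_coeff.1 h _ (by omega)
  -- The cofactor coordinates are the adjugate of M applied to the coordinates of X^j, so it
  -- suffices to apply the adjugate to `h1`.
  have h2 : M.det • y = T.coeff j • cofactorCoords A B d d j := by
    rw [cofactorCoords, Matrix.cramer_eq_adjugate_mulVec, ← hM, ← Matrix.mulVec_smul, ← h1, Matrix.mulVec_mulVec,
      Matrix.adjugate_mul, Matrix.smul_mulVec, Matrix.one_mulVec]
  have h3 : ∀ (ι : Fin (d - j) → Fin ((d - j) + (d - j))),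
      C M.det * polyOfCoords (d - j) (fun k => y (ι k)) =
        C (T.coeff j) * polyOfCoords (d - j) (fun k => cofactorCoords A B d d j (ι k)) := by
    intro ι
    rw [← smul_eq_C_mul, ← smul_eq_C_mul, ← map_smul, ← map_smul]
    congr 1
    ext k
    exact congrFun h2 (ι k)
  have h4 := h3 (Fin.castAdd (d - j))
  have h5 := h3 (Fin.natAdd (d - j))
  rw [hyU, ← cofactorU_eq] at h4
  rw [hyV, ← cofactorV_eq] at h5
  rw [principalSubresultant, subresultant, hT, ← hM, ← hT]
  linear_combination A * h4 + B * h5 + C M.det * hT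

/-- If the principal subresultant of index `j + 1` is a unit, then the `j`-th subresultant is
proportional to the remainder. -/
theorem associated_remainder [IsDomain R] {k j : ℕ} {x : R[X] × R[X]}
    (hx : x ∈ unitPairs R k (j + 1)) {T : R[X]} (h : IsRem k (j + 1) x T) {B : R[X]}
    (hB : B = x.1 + x.2)
    (hr : principalSubresultant x.1 B (k + (j + 1)) (k + (j + 1)) j ≠ 0) (n : ℕ) :
    Associated (T.coeff n)
      ((subresultant x.1 B (k + (j + 1)) (k + (j + 1)) j).coeff n) := by
  subst hB
  have hA := Monic.mem_degreeLT_succ (monic_of_sub_mem hx.1.1).2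
  have hC := degreeLT_le (Nat.le_succ _) hx.1.2
  have h1 := h.psIdeal_eq hx
  rw [← psIdeal_add_left hA hC (by omega), psIdeal, Ideal.span_singleton_eq_span_singleton] at h1
  obtain ⟨u, hu⟩ := h1
  obtain ⟨hT, P, Q, hP, hQ, hPQ⟩ := h
  obtain ⟨hPm, hPd⟩ := monic_of_sub_mem hP
  have e : x.1 * (-(P + Q)) + (x.1 + x.2) * P = T := by rw [hPQ]; ring
  have hP' : P ∈ degreeLT R (k + (j + 1) - j) :=
    degreeLT_le (by omega) (Monic.mem_degreeLT_succ hPd)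
  have h2 := C_mul_combination (j := j) (by omega)
    (neg_mem (add_mem hP' (degreeLT_le (by omega) hQ))) hP' (e ▸ hT)
  -- The coefficient T_j is r_j u with u a unit; cancelling r_j leaves T = u R_j.
  rw [e, ← hu, C_mul, mul_assoc] at h2
  have h3 := mul_left_cancel₀ (C_ne_zero.2 hr) h2
  rw [h3, coeff_C_mul, mul_comm]
  exact (associated_mul_unit_left _ _ u.isUnit)

end Cofactors

/-! ### Subresultants and ring homomorphisms. -/

section Map

variable {R S : Type*} [CommRing R] [CommRing S] (f : R →+* S)

theorem cofactorCoords_map (A B : R[X]) (dA dB j : ℕ) (i : Fin ((dB - j) + (dA - j))) :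
    cofactorCoords (A.map f) (B.map f) dA dB j i = f (cofactorCoords A B dA dB j i) := by
  have h1 : truncCoords dA dB j (X ^ j : S[X]) = f ∘ truncCoords dA dB j (X ^ j : R[X]) := by
    ext i
    simp only [truncCoords, Function.comp_apply, coeff_X_pow]
    split_ifs <;> simp
  have h2 := RingHom.map_adjugate f (sylvesterTrunc A B dA dB j)
  simp only [RingHom.mapMatrix_apply] at h2
  rw [cofactorCoords, Matrix.cramer_eq_adjugate_mulVec, sylvesterTrunc_map, h1, ← h2,
    cofactorCoords, Matrix.cramer_eq_adjugate_mulVec, RingHom.map_mulVec]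

theorem subresultant_map (A B : R[X]) (dA dB j : ℕ) :
    subresultant (A.map f) (B.map f) dA dB j = (subresultant A B dA dB j).map f := by
  simp only [subresultant, cofactorU, cofactorV, cofactorCoords_map, Polynomial.map_add,
    Polynomial.map_mul, Polynomial.map_sum, Polynomial.map_pow, map_X, map_C]

end Map

namespace IsChain

variable {q : ℝ} {t : ℕ → ℕ} {g : ℕ → ℕ → ℝ}

/-- Only the step starting from n = 0 changes the coefficient of index 0. -/
theorem le_apply_zero (h : IsChain q t g) (n : ℕ) : 1 - (q ^ t 1)⁻¹ ≤ g n 0 := by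
  have hx : 0 ≤ (q ^ t 1)⁻¹ := by have := h.two_le; positivity
  induction n with
  | zero => rw [h.zero, if_pos rfl]; linarith
  | succ n ih =>
    have h1 := h.step n 0
    rw [if_neg (by omega), mul_zero, sub_zero] at h1
    rw [h1]
    rcases Nat.eq_zero_or_pos n with rfl | hn
    · rw [if_pos le_rfl, h.zero, if_pos rfl]; simp
    · rw [if_neg (by omega), mul_zero, sub_zero]; exact ih

end IsChain

/-! ### Equidistribution of the remainder over W. -/

section Remainder

variable {W : Type*} [CommRing W] [IsDomain W] [IsDiscreteValuationRing W]

theorem isUnit_of_isUnit_mk {M : ℕ} (hM : 1 ≤ M) {r : W}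
    (h : IsUnit (Ideal.Quotient.mk (maximalIdeal W ^ M) r)) : IsUnit r := by
  obtain ⟨y, hy⟩ := h.exists_right_inv
  obtain ⟨s, rfl⟩ := Ideal.Quotient.mk_surjective y
  rw [← map_mul, ← map_one (Ideal.Quotient.mk _), Ideal.Quotient.eq] at hy
  have h1 := Ideal.pow_le_self (by omega) hy
  refine isUnit_of_mul_isUnit_left (y := s) ?_
  have h2 := IsLocalRing.isUnit_one_sub_self_of_mem_nonunits (1 - r * s) (by
    rw [← mem_maximalIdeal, ← neg_mem_iff, neg_sub]; exact h1)
  rwa [sub_sub_cancel] at h2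

theorem unitPairs_reduction {M k e : ℕ} (hM : 1 ≤ M) (ω : Pairs W (k + e)) :
    diffPair (redPair (Ideal.Quotient.mk (maximalIdeal W ^ M)) ω) ∈ unitPairs (Trunc W M) k e ↔
      diffPair ω ∈ unitPairs W k e := by
  refine and_congr (iff_of_true ((bijOn_diffPair _ _).mapsTo trivial)
    ((bijOn_diffPair _ _).mapsTo trivial)) ?_
  rw [diffPair_map, psIdeal_map, psIdeal, Ideal.map_span, Set.image_singleton,
    Ideal.span_singleton_eq_top, Ideal.span_singleton_eq_top]
  exact ⟨isUnit_of_isUnit_mk hM, fun h => h.map _⟩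

theorem card_trunc (M : ℕ) :
    Nat.card (Trunc W M) = Nat.card (ResidueField W) ^ M :=
  cardQuot_pow_of_prime (IsDiscreteValuationRing.not_a_field W)

theorem mk_eq_zero_iff {ϖ : W} (hϖ : Irreducible ϖ) (M : ℕ) (y : W) :
    Ideal.Quotient.mk (maximalIdeal W ^ M) y = 0 ↔ ϖ ^ M ∣ y := by
  rw [Ideal.Quotient.eq_zero_iff_mem, maximalIdeal_pow_eq hϖ, Ideal.mem_span_singleton]

/-- Reductions of unit pairs whose remainder has degree `< m`. -/
def remPairs (R : Type*) [CommRing R] (k e m : ℕ) : Set (R[X] × R[X]) :=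
  {x | x ∈ unitPairs R k e ∧ ∃ T, IsRem k e x T ∧ T ∈ degreeLT R m}

theorem reduction_mem_remPairs {M k e m : ℕ} (hM : 1 ≤ M) {ω : Pairs W (k + e)} {T : W[X]}
    (hω : diffPair ω ∈ unitPairs W k e) (hT : IsRem k e (diffPair ω) T) :
    diffPair (redPair (Ideal.Quotient.mk (maximalIdeal W ^ M)) ω) ∈
      remPairs (Trunc W M) k e m ↔
      ∀ i, m ≤ i → Ideal.Quotient.mk (maximalIdeal W ^ M) (T.coeff i) = 0 := by
  have := isLocalRing_trunc (W := W) hM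
  have h1 := (unitPairs_reduction hM ω).2 hω
  have h2 := hT.map (Ideal.Quotient.mk (maximalIdeal W ^ M))
  rw [← diffPair_map] at h2
  simp only [← coeff_map]
  rw [← mem_degreeLT_coeff]
  constructor
  · rintro ⟨-, T', hT', hm⟩
    rwa [h2.unique h1 hT']
  · intro hm
    exact ⟨h1, _, h2, hm⟩

variable [Finite (ResidueField W)] [TopologicalSpace W] [MeasurableSpace W] [BorelSpace W]

section

variable (h : IsAdic (maximalIdeal W)) (μ : Measure W) [μ.IsAddHaarMeasure]
  [IsProbabilityMeasure μ] (k j : ℕ)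
include h

/-- Modulo ϖ^M the remainder is uniform of degree ≤ j, and j + 1 - m of its coefficients must
vanish. On the unit event, m = j gives the tail of V_j and m = 0 that of W_j. -/
theorem measureReal_remPairs {M m : ℕ} (hM : 1 ≤ M) (hm : m ≤ j + 1) :
    (pairMeasure μ (k + (j + 1))).real {ω | diffPair (redPair
        (Ideal.Quotient.mk (maximalIdeal W ^ M)) ω) ∈ remPairs (Trunc W M) k (j + 1) m} =
      (pairMeasure μ (k + (j + 1))).real {ω | diffPair ω ∈ unitPairs W k (j + 1)} /
        ((Nat.card (ResidueField W) : ℝ) ^ M) ^ (j + 1 - m) := by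
  have := finite_trunc (W := W) M
  have := isLocalRing_trunc (W := W) hM
  obtain ⟨N, hN⟩ := exists_ncard_isRem (R := Trunc W M) k (j + 1)
  have key : ∀ m ≤ j + 1, (pairMeasure μ (k + (j + 1))).real {ω | diffPair (redPair
        (Ideal.Quotient.mk (maximalIdeal W ^ M)) ω) ∈ remPairs (Trunc W M) k (j + 1) m} =
      N * ((Nat.card (ResidueField W) : ℝ) ^ M) ^ (j + 1 + m) /
        (Nat.card (W ⧸ maximalIdeal W ^ M) : ℝ) ^ (2 * (k + (j + 1))) := by
    intro m hm
    rw [measureReal_diffPair_preimage h μ M _ (remPairs (Trunc W M) k (j + 1) m)]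
    congr 1
    have h1 := hN fun T => T ∈ degreeLT (Trunc W M) m
    rw [ncard_monicLow_mem hm, card_trunc] at h1
    have h2 : {x | x ∈ monicLow (W ⧸ maximalIdeal W ^ M) (k + (j + 1)) ∧
        x ∈ remPairs (Trunc W M) k (j + 1) m} = {x | x ∈ unitPairs (Trunc W M) k (j + 1) ∧
          ∃ T, IsRem k (j + 1) x T ∧ T ∈ degreeLT (Trunc W M) m} := by
      ext x
      exact ⟨fun hx => hx.2, fun hx => ⟨hx.1.1, hx⟩⟩
    rw [h2, h1]
    push_cast
    rfl
  have hU : {ω : Pairs W (k + (j + 1)) | diffPair ω ∈ unitPairs W k (j + 1)} =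
      {ω | diffPair (redPair (Ideal.Quotient.mk (maximalIdeal W ^ M)) ω) ∈
        remPairs (Trunc W M) k (j + 1) (j + 1)} := by
    ext ω
    constructor
    · intro hω
      obtain ⟨T, hT⟩ := exists_isRem hω
      refine (reduction_mem_remPairs hM hω hT).2 fun i hi => ?_
      rw [mem_degreeLT_coeff.1 hT.1 i hi, map_zero]
    · intro hω
      exact (unitPairs_reduction hM ω).1 hω.1
  rw [hU, key m hm, key (j + 1) le_rfl]
  have hq : ((Nat.card (ResidueField W) : ℝ) ^ M) ≠ 0 :=
    pow_ne_zero _ (by exact_mod_cast Nat.card_pos.ne')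
  have hN0 : (Nat.card (W ⧸ maximalIdeal W ^ M) : ℝ) ≠ 0 := by exact_mod_cast Nat.card_pos.ne'
  obtain ⟨l, hl⟩ := Nat.exists_eq_add_of_le hm
  rw [show j + 1 - m = l by omega, show j + 1 + (j + 1) = j + 1 + m + l by omega,
    pow_add _ (j + 1 + m)]
  field_simp

omit [TopologicalSpace W] [MeasurableSpace W] [BorelSpace W] h [Finite (ResidueField W)] in
theorem unitPairs_iff (ω : Pairs W (k + (j + 1))) :
    diffPair ω ∈ unitPairs W k (j + 1) ↔ valV (j + 1) ω = 0 := by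
  have h1 : diffPair ω ∈ monicLow W (k + (j + 1)) := (bijOn_diffPair _ _).mapsTo trivial
  have h2 : valV (j + 1) ω = 0 ↔ IsUnit (principalSubresultant (monicPoly ω.1) (monicPoly ω.2)
      (k + (j + 1)) (k + (j + 1)) (j + 1)) := by
    rw [valV, IsDiscreteValuationRing.addVal_eq_zero_iff]
  rw [unitPairs, Set.mem_ofPred_eq, and_iff_right h1, ← psIdeal_monic_pair (by omega), h2, psIdeal,
    Ideal.span_singleton_eq_top]

theorem one_sub_inv_le_measureReal_unitPairs :
    1 - (Nat.card (ResidueField W) : ℝ)⁻¹ ≤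
      (pairMeasure μ (k + (j + 1))).real {ω | diffPair ω ∈ unitPairs W k (j + 1)} := by
  obtain ⟨g, hc, hg⟩ := isChain_valV h μ (d := k + (j + 1)) (j := j + 1) (by omega)
  have h1 := hc.le_apply_zero (k + (j + 1) - (j + 1))
  rw [hg 0] at h1
  simp only [unitPairs_iff]
  simpa [expo] using h1

end

end Remainder

/-! ### The expectation of δ_j. -/

section Delta

variable {W : Type*} [CommRing W] [IsDomain W] [IsDiscreteValuationRing W]

theorem le_minValW_iff {ϖ : W} (hϖ : Irreducible ϖ) {d j : ℕ} (i : ℕ) (ω : Pairs W d) :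
    (i : ℕ∞) ≤ minValW j ω ↔
      ∀ n, ϖ ^ i ∣ (subresultant (monicPoly ω.1) (monicPoly ω.2) d d j).coeff n := by
  rw [minValW, le_iInf_iff]
  simp only [le_addVal_iff hϖ]

variable [Finite (ResidueField W)] [TopologicalSpace W] [MeasurableSpace W] [BorelSpace W]

theorem measurable_minValW (h : IsAdic (maximalIdeal W)) {d j : ℕ} :
    Measurable (minValW (W := W) (d := d) j) := by
  refine measurable_of_le fun i => ?_
  obtain ⟨ϖ, hϖ⟩ := IsDiscreteValuationRing.exists_irreducible W
  have := finite_trunc (W := W) i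
  have h1 : {ω : Pairs W d | (i : ℕ∞) ≤ minValW j ω} =
      {ω | redPair (Ideal.Quotient.mk (maximalIdeal W ^ i)) ω ∈
        {x | subresultant (monicPoly x.1) (monicPoly x.2) d d j = 0}} := by
    ext ω
    rw [Set.mem_ofPred_eq, le_minValW_iff hϖ, Set.mem_ofPred_eq, Set.mem_ofPred_eq]
    simp only [redPair]
    rw [← monicPoly_map, ← monicPoly_map, subresultant_map, Polynomial.ext_iff]
    simp only [coeff_map, coeff_zero, mk_eq_zero_iff hϖ]
  rw [h1]
  exact measurableSet_redPair_preimage h i d _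

theorem measurable_delta (h : IsAdic (maximalIdeal W)) {d j : ℕ} (hj : j ≤ d) :
    Measurable (delta (W := W) (d := d) j) :=
  (Measurable.of_discrete (f := fun x : ℕ∞ × ℕ∞ => x.1 - x.2)).comp
    ((measurable_valV h hj).prodMk (measurable_minValW h))

section

variable (h : IsAdic (maximalIdeal W)) (μ : Measure W) [μ.IsAddHaarMeasure]
  [IsProbabilityMeasure μ]
include h

theorem delta_le_valV_ae {d j : ℕ} (hj : j ≤ d) :
    ∀ᵐ ω ∂(pairMeasure μ d), toReal (delta j ω) ≤ toReal (valV j ω) := by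
  filter_upwards [valV_ae_ne_top h μ hj] with ω hω
  exact toReal_mono tsub_le_self hω

theorem integrable_delta {d j : ℕ} (hj : j ≤ d) :
    Integrable (fun ω => toReal (delta j ω)) (pairMeasure μ d) := by
  refine (integral_valV h μ hj).1.mono
    (measurable_toReal (measurable_delta h hj)).aestronglyMeasurable ?_
  filter_upwards [delta_le_valV_ae h μ hj] with ω hω
  rwa [Real.norm_of_nonneg (toReal_nonneg _), Real.norm_of_nonneg (toReal_nonneg _)]

theorem integral_delta_le {d j : ℕ} (hj : j ≤ d) :
    ∫ ω, toReal (delta j ω) ∂(pairMeasure μ d) ≤ ∫ ω, toReal (valV j ω) ∂(pairMeasure μ d) :=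
  integral_mono_ae (integrable_delta h μ hj) (integral_valV h μ hj).1 (delta_le_valV_ae h μ hj)

variable (k j : ℕ)

open Classical in
/-- A variable cut off outside the event that the principal subresultant of index `j + 1` is a
unit. -/
noncomputable def cutoff (X : Pairs W (k + (j + 1)) → ℕ∞) (ω : Pairs W (k + (j + 1))) : ℕ∞ :=
  if diffPair ω ∈ unitPairs W k (j + 1) then X ω else 0

omit [IsDomain W] [IsDiscreteValuationRing W] [Finite (ResidueField W)] [TopologicalSpace W]
  [MeasurableSpace W] [BorelSpace W] h in
theorem succ_le_cutoff_iff (X : Pairs W (k + (j + 1)) → ℕ∞) (ω : Pairs W (k + (j + 1))) (i : ℕ) :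
    ((i + 1 : ℕ) : ℕ∞) ≤ cutoff k j X ω ↔
      diffPair ω ∈ unitPairs W k (j + 1) ∧ ((i + 1 : ℕ) : ℕ∞) ≤ X ω := by
  rw [cutoff]
  split_ifs with hω
  · simp [hω]
  · simp [hω]

theorem measurable_cutoff {X : Pairs W (k + (j + 1)) → ℕ∞} (hX : Measurable X) :
    Measurable (cutoff k j X) := by
  classical
  refine Measurable.ite ?_ hX measurable_const
  simp only [unitPairs_iff]
  exact measurable_valV h (j := j + 1) (by omega) (measurableSet_singleton 0)

omit [Finite (ResidueField W)] [TopologicalSpace W] [MeasurableSpace W] [BorelSpace W] h in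
theorem succ_le_cutoff_valV_iff (ω : Pairs W (k + (j + 1))) (i : ℕ) :
    ((i + 1 : ℕ) : ℕ∞) ≤ cutoff k j (valV j) ω ↔
      diffPair (redPair (Ideal.Quotient.mk (maximalIdeal W ^ (i + 1))) ω) ∈
        remPairs (Trunc W (i + 1)) k (j + 1) j := by
  obtain ⟨ϖ, hϖ⟩ := IsDiscreteValuationRing.exists_irreducible W
  rw [succ_le_cutoff_iff]
  have h0 : diffPair (redPair (Ideal.Quotient.mk (maximalIdeal W ^ (i + 1))) ω) ∈
      remPairs (Trunc W (i + 1)) k (j + 1) j → diffPair ω ∈ unitPairs W k (j + 1) := fun hω =>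
    (unitPairs_reduction (by omega) ω).1 hω.1
  rw [← and_iff_right_of_imp h0]
  refine and_congr_right fun hω => ?_
  obtain ⟨T, hT⟩ := exists_isRem hω
  rw [reduction_mem_remPairs (by omega) hω hT]
  have h1 := hT.psIdeal_eq hω
  rw [← psIdeal_monic_pair (by omega), psIdeal, Ideal.span_singleton_eq_span_singleton] at h1
  simp only [mk_eq_zero_iff hϖ]
  rw [valV, le_addVal_iff hϖ, h1.dvd_iff_dvd_right]
  constructor
  · intro h2 n hn
    rcases hn.eq_or_lt with rfl | hn
    · exact h2
    · rw [mem_degreeLT_coeff.1 hT.1 n hn]; exact dvd_zero _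
  · intro h2
    exact h2 j le_rfl

omit [Finite (ResidueField W)] [TopologicalSpace W] [MeasurableSpace W] [BorelSpace W] h in
-- Finiteness of V_j means r_j ≠ 0, which `associated_remainder` needs to compare R_j with the
-- remainder.
theorem succ_le_cutoff_minValW_iff {ω : Pairs W (k + (j + 1))} (hr : valV j ω ≠ ⊤) (i : ℕ) :
    ((i + 1 : ℕ) : ℕ∞) ≤ cutoff k j (minValW j) ω ↔
      diffPair (redPair (Ideal.Quotient.mk (maximalIdeal W ^ (i + 1))) ω) ∈
        remPairs (Trunc W (i + 1)) k (j + 1) 0 := by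
  obtain ⟨ϖ, hϖ⟩ := IsDiscreteValuationRing.exists_irreducible W
  rw [succ_le_cutoff_iff]
  have h0 : diffPair (redPair (Ideal.Quotient.mk (maximalIdeal W ^ (i + 1))) ω) ∈
      remPairs (Trunc W (i + 1)) k (j + 1) 0 → diffPair ω ∈ unitPairs W k (j + 1) := fun hω =>
    (unitPairs_reduction (by omega) ω).1 hω.1
  rw [← and_iff_right_of_imp h0]
  refine and_congr_right fun hω => ?_
  obtain ⟨T, hT⟩ := exists_isRem hω
  rw [reduction_mem_remPairs (by omega) hω hT, le_minValW_iff hϖ]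
  have hr' : principalSubresultant (monicPoly ω.1) (monicPoly ω.2) (k + (j + 1)) (k + (j + 1)) j ≠
      0 := by
    intro h1
    rw [valV, h1, IsDiscreteValuationRing.addVal_zero] at hr
    exact hr rfl
  have h1 := associated_remainder hω hT (monicPoly_snd ω) hr'
  simp only [mk_eq_zero_iff hϖ, Nat.zero_le, forall_true_left]
  exact forall_congr' fun n => ((h1 n).dvd_iff_dvd_right).symm

/-- The probability that the principal subresultant of index `j + 1` is a unit. -/
noncomputable def unitProb : ℝ :=
  (pairMeasure μ (k + (j + 1))).real {ω | diffPair ω ∈ unitPairs W k (j + 1)}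

omit [μ.IsAddHaarMeasure] in
theorem integral_cutoff {X : Pairs W (k + (j + 1)) → ℕ∞} (hX : Measurable X) {l : ℕ} (hl : 1 ≤ l)
    (htail : ∀ i : ℕ, (pairMeasure μ (k + (j + 1))).real {ω | ((i + 1 : ℕ) : ℕ∞) ≤ cutoff k j X ω} =
      unitProb μ k j / ((Nat.card (ResidueField W) : ℝ) ^ (i + 1)) ^ l) :
    (∀ᵐ ω ∂(pairMeasure μ (k + (j + 1))), cutoff k j X ω ≠ ⊤) ∧
      Integrable (fun ω => toReal (cutoff k j X ω)) (pairMeasure μ (k + (j + 1))) ∧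
      ∫ ω, toReal (cutoff k j X ω) ∂(pairMeasure μ (k + (j + 1))) =
        unitProb μ k j / ((Nat.card (ResidueField W) : ℝ) ^ l - 1) := by
  have hq : 1 < Nat.card (ResidueField W) := Finite.one_lt_card
  have hq1 : (1 : ℝ) < (Nat.card (ResidueField W) : ℝ) ^ l :=
    one_lt_pow₀ (by exact_mod_cast hq) (by omega)
  set y := (Nat.card (ResidueField W) : ℝ) ^ l
  have hy : y⁻¹ < 1 := inv_lt_one_of_one_lt₀ hq1
  have hy0 : 0 ≤ y⁻¹ := inv_nonneg.2 (by linarith)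
  have hs : HasSum (fun i : ℕ => (pairMeasure μ (k + (j + 1))).real
      {ω | ((i + 1 : ℕ) : ℕ∞) ≤ cutoff k j X ω}) (unitProb μ k j / (y - 1)) := by
    simp only [htail]
    have h1 := (hasSum_geometric_of_lt_one hy0 hy).mul_left (unitProb μ k j * y⁻¹)
    have e1 : unitProb μ k j * y⁻¹ * (1 - y⁻¹)⁻¹ = unitProb μ k j / (y - 1) := by
      have : y - 1 ≠ 0 := by linarith
      have : y ≠ 0 := by linarith
      have : (1 - y⁻¹) ≠ 0 := by linarith
      field_simp
    rw [← e1]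
    have e2 : (fun i : ℕ => unitProb μ k j / ((Nat.card (ResidueField W) : ℝ) ^ (i + 1)) ^ l) =
        fun i => unitProb μ k j * y⁻¹ * y⁻¹ ^ i := by
      funext i
      rw [pow_right_comm]
      change _ / y ^ (i + 1) = _
      rw [div_eq_mul_inv, pow_succ, mul_inv, inv_pow]
      ring
    rw [e2]
    exact h1
  obtain ⟨h1, h2, h3⟩ := integral_toReal (measurable_cutoff h k j hX) hs.summable
  exact ⟨h1, h2, h3.trans hs.tsum_eq⟩

theorem integral_cutoff_valV :
    (∀ᵐ ω ∂(pairMeasure μ (k + (j + 1))), cutoff k j (valV j) ω ≠ ⊤) ∧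
      Integrable (fun ω => toReal (cutoff k j (valV j) ω)) (pairMeasure μ (k + (j + 1))) ∧
      ∫ ω, toReal (cutoff k j (valV j) ω) ∂(pairMeasure μ (k + (j + 1))) =
        unitProb μ k j / ((Nat.card (ResidueField W) : ℝ) ^ 1 - 1) := by
  refine integral_cutoff h μ k j (measurable_valV h (by omega)) le_rfl fun i => ?_
  simp only [succ_le_cutoff_valV_iff]
  rw [measureReal_remPairs h μ k j (by omega) (by omega), Nat.add_sub_cancel_left]
  rfl

theorem integral_cutoff_minValW :
    (∀ᵐ ω ∂(pairMeasure μ (k + (j + 1))), cutoff k j (minValW j) ω ≠ ⊤) ∧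
      Integrable (fun ω => toReal (cutoff k j (minValW j) ω)) (pairMeasure μ (k + (j + 1))) ∧
      ∫ ω, toReal (cutoff k j (minValW j) ω) ∂(pairMeasure μ (k + (j + 1))) =
        unitProb μ k j / ((Nat.card (ResidueField W) : ℝ) ^ (j + 1) - 1) := by
  refine integral_cutoff h μ k j (measurable_minValW h) (by omega) fun i => ?_
  refine (measureReal_congr ?_).trans
    (measureReal_remPairs h μ k j (M := i + 1) (m := 0) (by omega) (by omega))
  filter_upwards [valV_ae_ne_top h μ (d := k + (j + 1)) (j := j) (by omega)] with ω hω
  exact propext (succ_le_cutoff_minValW_iff k j hω i)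

/-- Outside the event that r_{j+1} is a unit, δ_j ≥ 0 suffices. On it the integral is at least
`unitProb` times 1/(q-1) - 1/(q^(j+1)-1), and bounding the probability below by 1 - 1/q yields
exactly the stated quotient. -/
theorem le_integral_delta :
    ((Nat.card (ResidueField W) : ℝ) ^ j - 1) / ((Nat.card (ResidueField W) : ℝ) ^ (j + 1) - 1) ≤
      ∫ ω, toReal (delta j ω) ∂(pairMeasure μ (k + (j + 1))) := by
  obtain ⟨a1, a2, a3⟩ := integral_cutoff_valV h μ k j
  obtain ⟨b1, b2, b3⟩ := integral_cutoff_minValW h μ k j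
  have h1 : ∫ ω, toReal (cutoff k j (valV j) ω) - toReal (cutoff k j (minValW j) ω)
      ∂(pairMeasure μ (k + (j + 1))) ≤ ∫ ω, toReal (delta j ω) ∂(pairMeasure μ (k + (j + 1))) := by
    refine integral_mono_ae (a2.sub b2) (integrable_delta h μ (by omega)) ?_
    filter_upwards [b1] with ω hω
    unfold cutoff at hω ⊢
    split_ifs at hω ⊢ with hU
    · rw [delta, toReal, toReal, toReal, ENat.toNat_sub hω, sub_le_iff_le_add]
      exact_mod_cast le_tsub_add
    · simp only [sub_self]; exact toReal_nonneg _
  rw [integral_sub a2 b2, a3, b3] at h1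
  refine le_trans ?_ h1
  have hq : 1 < Nat.card (ResidueField W) := Finite.one_lt_card
  have hU := one_sub_inv_le_measureReal_unitPairs h μ k j
  rw [← unitProb] at hU
  have hq1 : (1 : ℝ) < Nat.card (ResidueField W) := by exact_mod_cast hq
  set q : ℝ := (Nat.card (ResidueField W) : ℝ)
  have hy : 1 ≤ q ^ j := one_le_pow₀ hq1.le
  have hy1 : 0 < q ^ (j + 1) - 1 := by rw [pow_succ]; nlinarith
  have hq2 : 0 < q - 1 := by linarith
  have e1 : unitProb μ k j / (q ^ 1 - 1) - unitProb μ k j / (q ^ (j + 1) - 1) =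
      unitProb μ k j * ((q ^ (j + 1) - q) / ((q - 1) * (q ^ (j + 1) - 1))) := by
    rw [pow_one]; field_simp; ring
  have e2 : (q ^ j - 1) / (q ^ (j + 1) - 1) =
      (1 - q⁻¹) * ((q ^ (j + 1) - q) / ((q - 1) * (q ^ (j + 1) - 1))) := by
    rw [pow_succ] at hy1 ⊢; field_simp
  rw [e1, e2]
  refine mul_le_mul_of_nonneg_right hU (div_nonneg ?_ (by positivity))
  rw [pow_succ]; nlinarith

end

end Delta

/-! ### Numerical estimates for the maximum. -/

section Estimates

/-- With x = m - L the exponent is 9√m - x log q. The threshold gives 9√L ≤ (x - i)/10, and (√x -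
45)² ≥ 0 gives 9√x ≤ x/10 + 202.5. As log q ≥ 0.69 and x ≥ i, what is left is below 203 - 2i/5. -/
theorem mul_inv_pow_mul_exp_le {q D L : ℝ} (hq : 2 ≤ q) (hD : D = Real.exp (L * Real.log q))
    (hL : 0 ≤ L) {m i : ℕ} (hm : L + 90 * √L + i ≤ m) :
    D * ((q ^ m)⁻¹ * Real.exp (9 * √(m : ℝ))) ≤ Real.exp 203 * Real.exp (-(2 / 5)) ^ i := by
  have hq0 : 0 < q := by linarith
  have hlog : 0.69 ≤ Real.log q := by
    have h1 := Real.log_le_log (by norm_num) hq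
    have h2 := Real.log_two_gt_d9
    linarith
  obtain ⟨x, hx⟩ : ∃ x, x = (m : ℝ) - L := ⟨_, rfl⟩
  have hs := Real.sqrt_nonneg L
  have hi : (0 : ℝ) ≤ i := Nat.cast_nonneg i
  have hx1 : 90 * √L + i ≤ x := by linarith
  have hx0 : 0 ≤ x := by linarith
  have h1 : √(m : ℝ) ≤ √L + √x := by
    rw [show (m : ℝ) = L + x by linarith]
    refine Real.sqrt_le_iff.2 ⟨by positivity, ?_⟩
    nlinarith [Real.sq_sqrt hL, Real.sq_sqrt hx0, mul_nonneg hs (Real.sqrt_nonneg x)]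
  have h2 : 9 * √x ≤ x / 10 + 202.5 := by
    nlinarith [Real.sq_sqrt hx0, sq_nonneg (√x - 45)]
  have e1 : (q ^ m)⁻¹ = Real.exp (-(m * Real.log q)) := by
    rw [Real.exp_neg, Real.exp_nat_mul, Real.exp_log hq0]
  rw [hD, e1, ← Real.exp_add, ← Real.exp_add, ← Real.exp_nat_mul, ← Real.exp_add, Real.exp_le_exp]
  have h3 : 0.69 * x ≤ x * Real.log q := by nlinarith
  have h4 : x * Real.log q = m * Real.log q - L * Real.log q := by rw [hx]; ring
  linarith

/-- From log(q/d) ≤ q/d - 1 one gets d/q ≤ 4 log_q d: the logarithm is small only when d/q is small.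
-/
theorem div_le_sqrt_logb {q d : ℝ} (hd : 2 ≤ d) (hdq : d ≤ q) : d / q ≤ 2 * √(Real.logb q d) := by
  have hd0 : 0 < d := by linarith
  have hq0 : 0 < q := by linarith
  have hlog2 : 1 / 2 < Real.log 2 := by have := Real.log_two_gt_d9; linarith
  have hld : Real.log 2 ≤ Real.log d := Real.log_le_log (by norm_num) hd
  have hlq : Real.log d ≤ Real.log q := Real.log_le_log hd0 hdq
  have hlq0 : 0 < Real.log q := by linarith
  have h1 : Real.log (q / d) ≤ q / d - 1 := Real.log_le_sub_one_of_pos (by positivity)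
  rw [Real.log_div hq0.ne' hd0.ne'] at h1
  obtain ⟨r, hr⟩ : ∃ r, r = d / q := ⟨_, rfl⟩
  have hr0 : 0 < r := by rw [hr]; positivity
  have hr1 : r ≤ 1 := by rw [hr]; exact (div_le_one hq0).2 hdq
  have hqd : q / d = 1 / r := by rw [hr, one_div_div]
  have h2 : r / 4 ≤ Real.logb q d := by
    rw [Real.logb, le_div_iff₀ hlq0]
    rw [hqd] at h1
    have h3 : r * Real.log q ≤ r * (Real.log d + (1 / r - 1)) :=
      mul_le_mul_of_nonneg_left (by linarith) hr0.le
    have h4 : r * (Real.log d + (1 / r - 1)) = r * Real.log d + 1 - r := by field_simp; ring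
    have h5 : r * Real.log d ≤ 1 * Real.log d := mul_le_mul_of_nonneg_right hr1 (by linarith)
    linarith
  have h3 : r / 2 ≤ √(Real.logb q d) := by
    refine Real.le_sqrt_of_sq_le ?_
    refine le_trans ?_ h2
    nlinarith
  rw [← hr]
  linarith

end Estimates

/-! ### The expectation of the maximum. -/

section Max

variable {W : Type*} [CommRing W] [IsDomain W] [IsDiscreteValuationRing W]

theorem setOf_succ_le_maxV (d i : ℕ) : {ω : Pairs W d | ((i + 1 : ℕ) : ℕ∞) ≤ maxV ω} =
    ⋃ j ∈ Finset.range d, {ω | ((i + 1 : ℕ) : ℕ∞) ≤ valV j ω} := by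
  ext ω
  have h0 : (⊥ : ℕ∞) < ((i + 1 : ℕ) : ℕ∞) := by
    rw [bot_eq_zero]; exact_mod_cast Nat.succ_pos i
  simp only [Set.mem_ofPred_eq, Set.mem_iUnion, exists_prop, maxV, Finset.le_sup_iff h0]

variable [Finite (ResidueField W)] [TopologicalSpace W] [MeasurableSpace W] [BorelSpace W]
  (h : IsAdic (maximalIdeal W)) (μ : Measure W) [μ.IsAddHaarMeasure] [IsProbabilityMeasure μ]
include h

theorem measurable_maxV (d : ℕ) : Measurable (maxV (W := W) (d := d)) := by
  refine measurable_of_le fun i => ?_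
  rcases i with _ | i
  · simp
  · rw [setOf_succ_le_maxV]
    refine Finset.measurableSet_biUnion _ fun j hj => ?_
    exact measurableSet_le_valV h (Finset.mem_range.1 hj).le _

theorem tail_maxV_le (d i : ℕ) :
    (pairMeasure μ d).real {ω | ((i + 1 : ℕ) : ℕ∞) ≤ maxV ω} ≤
      d * (((Nat.card (ResidueField W) : ℝ) ^ (i + 1))⁻¹ * Real.exp (9 * √((i + 1 : ℕ) : ℝ))) := by
  rw [setOf_succ_le_maxV]
  refine (measureReal_biUnion_finset_le _ _).trans ?_
  refine (Finset.sum_le_sum fun j hj => tail_valV_le h μ (Finset.mem_range.1 hj).le (i + 1)).trans ?_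
  rw [Finset.sum_const, Finset.card_range, nsmul_eq_mul]

theorem maxV_le_sum_ae (d : ℕ) :
    ∀ᵐ ω ∂(pairMeasure μ d), toReal (maxV ω) ≤ ∑ j ∈ Finset.range d, toReal (valV j ω) := by
  have h1 : ∀ᵐ ω ∂(pairMeasure μ d), ∀ j ∈ Finset.range d, valV j ω ≠ ⊤ := by
    rw [Filter.eventually_all_finset]
    intro j hj
    exact valV_ae_ne_top h μ (Finset.mem_range.1 hj).le
  filter_upwards [h1] with ω hω
  have h2 : maxV ω ≤ ∑ j ∈ Finset.range d, valV j ω :=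
    Finset.sup_le fun j hj => Finset.single_le_sum (f := fun j => valV j ω)
      (fun _ _ => zero_le) hj
  have h3 : ∑ j ∈ Finset.range d, valV j ω ≠ ⊤ := WithTop.sum_ne_top.2 hω
  refine (toReal_mono h2 h3).trans ?_
  rw [toReal, ENat.toNat_sum hω, Nat.cast_sum]
  rfl

theorem integral_maxV_le_sum (d : ℕ) :
    Integrable (fun ω : Pairs W d => toReal (maxV ω)) (pairMeasure μ d) ∧
      ∫ ω : Pairs W d, toReal (maxV ω) ∂(pairMeasure μ d) ≤
        ∑ j ∈ Finset.range d, ∫ ω, toReal (valV j ω) ∂(pairMeasure μ d) := by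
  have h1 : ∀ j ∈ Finset.range d, Integrable (fun ω => toReal (valV j ω)) (pairMeasure μ d) :=
    fun j hj => (integral_valV h μ (Finset.mem_range.1 hj).le).1
  have hint : Integrable (fun ω : Pairs W d => toReal (maxV ω)) (pairMeasure μ d) := by
    refine (integrable_finsetSum _ h1).mono
      (measurable_toReal (measurable_maxV h d)).aestronglyMeasurable ?_
    filter_upwards [maxV_le_sum_ae h μ d] with ω hω
    rw [Real.norm_of_nonneg (toReal_nonneg _)]
    exact hω.trans (le_abs_self _)
  refine ⟨hint, ?_⟩
  rw [← integral_finsetSum _ h1]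
  exact integral_mono_ae hint (integrable_finsetSum _ h1) (maxV_le_sum_ae h μ d)

/-- The constant in the bound for the expectation of the maximum. -/
noncomputable def maxConst : ℝ := 91 + Real.exp 203 * (1 - Real.exp (-(2 / 5)))⁻¹

omit h in
theorem eight_le_maxConst : 8 ≤ maxConst := by
  have h1 : Real.exp (-(2 / 5)) < 1 := Real.exp_lt_one_iff.2 (by norm_num)
  have h2 : 0 < 1 - Real.exp (-(2 / 5)) := by linarith
  have h3 : 0 < Real.exp 203 * (1 - Real.exp (-(2 / 5)))⁻¹ := by positivity
  rw [maxConst]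
  linarith

/-- For d ≤ q, where log_q d can be close to 0, the sum of the means suffices. For d ≥ q, the tail
sum is cut near L + 90√L: terms before the cut are at most 1, and after it the union bound decays
geometrically, uniformly in q and d. -/
theorem integral_maxV_le {d : ℕ} (hd : 2 ≤ d) :
    ∫ ω : Pairs W d, toReal (maxV ω) ∂(pairMeasure μ d) ≤
      Real.logb (Nat.card (ResidueField W)) d +
        maxConst * √(Real.logb (Nat.card (ResidueField W)) d) := by
  have hq : 2 ≤ Nat.card (ResidueField W) := Finite.one_lt_card
  have hq2 : (2 : ℝ) ≤ Nat.card (ResidueField W) := by exact_mod_cast hq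
  have hd2 : (2 : ℝ) ≤ d := by exact_mod_cast hd
  have htail := tail_maxV_le h μ d
  have hbound := (integral_maxV_le_sum h μ d).2
  have hmean : ∀ j ∈ Finset.range d, ∫ ω, toReal (valV j ω) ∂(pairMeasure μ d) ≤
      (Nat.card (ResidueField W) : ℝ) / ((Nat.card (ResidueField W) : ℝ) - 1) ^ 2 := by
    intro j hj
    rw [(integral_valV h μ (Finset.mem_range.1 hj).le).2]
    exact (chainMean_lt hq2 (fun n => by unfold expo; omega) _).le
  set q : ℝ := (Nat.card (ResidueField W) : ℝ)
  set L := Real.logb q d with hL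
  have hL0 : 0 ≤ L := Real.logb_nonneg (by linarith) (by linarith)
  have hs := Real.sqrt_nonneg L
  rcases le_total (d : ℝ) q with hdq | hdq
  · have h1 := hbound.trans (Finset.sum_le_sum hmean)
    rw [Finset.sum_const, Finset.card_range, nsmul_eq_mul] at h1
    have h2 := div_le_sqrt_logb hd2 hdq
    have h3 : q / (q - 1) ^ 2 ≤ 4 / q := by
      rw [div_le_div_iff₀ (by nlinarith) (by linarith)]
      nlinarith
    have h4 : d * (q / (q - 1) ^ 2) ≤ 4 * (d / q) := by
      calc d * (q / (q - 1) ^ 2) ≤ d * (4 / q) := mul_le_mul_of_nonneg_left h3 (by linarith)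
        _ = _ := by ring
    have h5 := mul_le_mul_of_nonneg_right eight_le_maxConst hs
    linarith
  · have hL1 : 1 ≤ L := by
      rw [hL, Real.le_logb_iff_rpow_le (by linarith) (by linarith), Real.rpow_one]
      exact hdq
    have hD : (d : ℝ) = Real.exp (L * Real.log q) := by
      rw [hL, Real.logb, div_mul_cancel₀, Real.exp_log (by linarith)]
      exact (Real.log_pos (by linarith)).ne'
    obtain ⟨M, hM⟩ : ∃ M, M = ⌈L + 90 * √L⌉₊ := ⟨_, rfl⟩
    have hM1 : L + 90 * √L ≤ M := by rw [hM]; exact Nat.le_ceil _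
    have hM2 : (M : ℝ) ≤ L + 90 * √L + 1 := by
      rw [hM]; exact (Nat.ceil_lt_add_one (by positivity)).le
    have hr1 : Real.exp (-(2 / 5)) < 1 := Real.exp_lt_one_iff.2 (by norm_num)
    have hgeo := (hasSum_geometric_of_lt_one (Real.exp_nonneg _) hr1).mul_left (Real.exp 203)
    have hle : ∀ i : ℕ, (pairMeasure μ d).real {ω : Pairs W d | ((i + M + 1 : ℕ) : ℕ∞) ≤ maxV ω} ≤
        Real.exp 203 * Real.exp (-(2 / 5)) ^ i := fun i =>
      (htail (i + M)).trans (mul_inv_pow_mul_exp_le hq2 hD hL0 (by push_cast; linarith))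
    have hsum := Summable.of_nonneg_of_le (fun _ => measureReal_nonneg) hle hgeo.summable
    have hsum' := (summable_nat_add_iff (f := fun i : ℕ =>
      (pairMeasure μ d).real {ω : Pairs W d | ((i + 1 : ℕ) : ℕ∞) ≤ maxV ω}) M).1 hsum
    obtain ⟨-, -, h3⟩ := integral_toReal (measurable_maxV h d) hsum'
    rw [h3, ← hsum'.sum_add_tsum_nat_add M]
    have h4 : ∑ i ∈ Finset.range M,
        (pairMeasure μ d).real {ω : Pairs W d | ((i + 1 : ℕ) : ℕ∞) ≤ maxV ω} ≤ M := by
      refine (Finset.sum_le_sum fun i _ => measureReal_le_one).trans_eq ?_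
      simp
    have h5 := (hsum.tsum_le_tsum hle hgeo.summable).trans_eq hgeo.tsum_eq
    -- This absorbs into a multiple of √L both the rounding of M, which turns 90 into the 91 of
    -- `maxConst`, and the geometric sum.
    have h6 : 1 ≤ √L := Real.one_le_sqrt.2 hL1
    have h7 : 0 ≤ Real.exp 203 * (1 - Real.exp (-(2 / 5)))⁻¹ := by
      have : 0 < 1 - Real.exp (-(2 / 5)) := by linarith
      positivity
    have h8 := mul_le_mul_of_nonneg_left h6 h7
    rw [maxConst]
    linarith

end Max

end SubresVal

theorem corollary3p6 :
    ∃ C₁ C₂ : ℝ,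
      ∀ (W : Type*) [CommRing W] [IsDomain W] [IsDiscreteValuationRing W]
        [IsAdicComplete (maximalIdeal W) W] [Finite (ResidueField W)]
        [TopologicalSpace W] (_ : IsAdic (maximalIdeal W)) [MeasurableSpace W] [BorelSpace W]
        (μ : Measure W) [μ.IsAddHaarMeasure] [IsProbabilityMeasure μ]
        (q : ℕ) (_ : q = Nat.card (ResidueField W)) (d : ℕ),
        (∀ j : ℕ, j < d →
          -- the random variables are almost surely finite, and their moments exist
          ((∀ᵐ ω ∂(SubresVal.pairMeasure μ d), SubresVal.valV j ω ≠ ⊤) ∧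
            MemLp (fun ω => SubresVal.toReal (SubresVal.valV j ω)) 2
              (SubresVal.pairMeasure μ d) ∧
            Integrable (fun ω => SubresVal.toReal (SubresVal.delta j ω))
              (SubresVal.pairMeasure μ d)) ∧
          -- expectation of `V_j`
          ((∫ ω, SubresVal.toReal (SubresVal.valV j ω) ∂(SubresVal.pairMeasure μ d)) =
              ∑ i ∈ Finset.Icc 1 (d - j), 1 / ((q : ℝ) ^ SubresVal.sigma d i - 1) ∧
            1 / ((q : ℝ) - 1) ≤
              ∫ ω, SubresVal.toReal (SubresVal.valV j ω) ∂(SubresVal.pairMeasure μ d) ∧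
            (∫ ω, SubresVal.toReal (SubresVal.valV j ω) ∂(SubresVal.pairMeasure μ d)) <
              (q : ℝ) / ((q : ℝ) - 1) ^ 2) ∧
          -- expectation of `δ_j`
          (((q : ℝ) ^ j - 1) / ((q : ℝ) ^ (j + 1) - 1) ≤
              ∫ ω, SubresVal.toReal (SubresVal.delta j ω) ∂(SubresVal.pairMeasure μ d) ∧
            (∫ ω, SubresVal.toReal (SubresVal.delta j ω) ∂(SubresVal.pairMeasure μ d)) ≤
              ∫ ω, SubresVal.toReal (SubresVal.valV j ω) ∂(SubresVal.pairMeasure μ d)) ∧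
          -- variance and standard deviation of `V_j`
          (variance (fun ω => SubresVal.toReal (SubresVal.valV j ω))
                (SubresVal.pairMeasure μ d) =
              ∑ i ∈ Finset.Icc 1 (d - j),
                (2 * (i : ℝ) - 1) * (q : ℝ) ^ SubresVal.tau d j i /
                  ((q : ℝ) ^ SubresVal.tau d j i - 1) ^ 2 ∧
            √(q : ℝ) / ((q : ℝ) - 1) ≤
              √(variance (fun ω => SubresVal.toReal (SubresVal.valV j ω))
                (SubresVal.pairMeasure μ d)) ∧
            √(variance (fun ω => SubresVal.toReal (SubresVal.valV j ω))
                (SubresVal.pairMeasure μ d)) <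
              (q : ℝ) * √((q : ℝ) + 1) / ((q : ℝ) - 1) ^ 2) ∧
          -- tail of `V_j`
          (∀ m : ℕ, (SubresVal.pairMeasure μ d).real {ω | (m : ℕ∞) ≤ SubresVal.valV j ω} ≤
            (q : ℝ) ^ (-(m : ℝ) + C₁ * √(m : ℝ)))) ∧
        -- expectation of the maximum of `V_0, …, V_{d-1}`
        (2 ≤ d →
          Integrable (fun ω : SubresVal.Pairs W d => SubresVal.toReal (SubresVal.maxV ω))
              (SubresVal.pairMeasure μ d) ∧
          (∫ ω : SubresVal.Pairs W d, SubresVal.toReal (SubresVal.maxV ω)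
              ∂(SubresVal.pairMeasure μ d)) ≤
            Real.logb q d + C₂ * √(Real.logb q d)) := by
  -- Since q ≥ 2, exp(9√m) = q^(9√m / log q) ≤ q^((9 / log 2)√m).
  refine ⟨9 / Real.log 2, SubresVal.maxConst, ?_⟩
  intro W _ _ _ _ _ _ hI _ _ μ _ _ q hqW d
  subst hqW
  have hq : 2 ≤ Nat.card (ResidueField W) := Finite.one_lt_card
  have hq2 : (2 : ℝ) ≤ Nat.card (ResidueField W) := by exact_mod_cast hq
  refine ⟨fun j hj => ?_, fun hd => ⟨(SubresVal.integral_maxV_le_sum hI μ d).1,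
    SubresVal.integral_maxV_le hI μ hd⟩⟩
  have ht : ∀ n, n ≤ SubresVal.expo j n := fun n => by unfold SubresVal.expo; omega
  have ht1 : SubresVal.expo j 1 = 1 := by unfold SubresVal.expo; omega
  have hmean := (SubresVal.integral_valV hI μ hj.le).2
  have hvar := SubresVal.variance_valV hI μ hj.le
  refine ⟨⟨SubresVal.valV_ae_ne_top hI μ hj.le, SubresVal.memLp_valV hI μ hj.le,
    SubresVal.integrable_delta hI μ hj.le⟩, ⟨?_, ?_, ?_⟩,
    ⟨?_, SubresVal.integral_delta_le hI μ hj.le⟩, ⟨?_, ?_, ?_⟩, fun m => ?_⟩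
  · rw [hmean, SubresVal.sum_sigma_eq_chainMean hj]
  · rw [hmean]
    exact SubresVal.one_div_le_chainMean hq2 ht ht1 (by omega)
  · rw [hmean]
    exact SubresVal.chainMean_lt hq2 ht _
  · obtain ⟨k, rfl⟩ : ∃ k, d = k + (j + 1) := ⟨d - (j + 1), by omega⟩
    exact SubresVal.le_integral_delta hI μ k j
  · rw [hvar, SubresVal.sum_tau_eq_chainVar hj]
  · rw [hvar]
    refine Real.le_sqrt_of_sq_le ?_
    rw [div_pow, Real.sq_sqrt (by linarith)]
    exact SubresVal.div_le_chainVar hq2 ht1 (by omega)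
  · rw [hvar, Real.sqrt_lt' (by
      have : (0 : ℝ) < Nat.card (ResidueField W) - 1 := by linarith
      positivity), div_pow, mul_pow, Real.sq_sqrt (by linarith), ← pow_mul]
    exact SubresVal.chainVar_lt hq2 ht _
  · refine (SubresVal.tail_valV_le hI μ hj.le m).trans ?_
    have hq0 : (0 : ℝ) < Nat.card (ResidueField W) := by linarith
    rw [Real.rpow_add hq0, Real.rpow_neg hq0.le, Real.rpow_natCast]
    refine mul_le_mul_of_nonneg_left ?_ (by positivity)
    rw [Real.rpow_def_of_pos hq0, Real.exp_le_exp]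
    have hl2 : 0 < Real.log 2 := Real.log_pos (by norm_num)
    have hl := Real.log_le_log (by norm_num) hq2
    have h1 : 9 ≤ Real.log (Nat.card (ResidueField W)) * (9 / Real.log 2) := by
      rw [mul_div_assoc', le_div_iff₀ hl2]; linarith
    rw [← mul_assoc]
    exact mul_le_mul_of_nonneg_right h1 (Real.sqrt_nonneg _)
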